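/- Let $K$ be a differential field of characteristic $0$ with three commuting derivations $\partial_1,\partial_2,\partial_3$, and let $\omega=(\omega_{ij})$ be a symmetric $3\times 3$ matrix over $K$ with $\det\omega\neq 0$ (for instance the Euclidean metric). Put $T=K^3$, let $S_qT^*\otimes E$ be the space of families $(v_\mu)_{|\mu|=q}$ in $E$, and let $\delta:\wedge^sT^*\otimes S_{q+1}T^*\otimes E\to\wedge^{s+1}T^*\otimes S_qT^*\otimes E$, $(\delta v)_\mu=\sum_i dx^i\wedge v_{\mu+1_i}$, be the Spencer map. A symbol $g_q\subseteq S_qT^*\otimes E$ with prolongations $g_{q+r}$ is $s$-acyclic if the $\delta$-cohomology at $\wedge^tT^*\otimes g_{q+r}$ vanishes for $1\le t\le s$ and all $r\ge 0$. Let $\hat g_1\subset T^*\otimes T$ be the symbol of the conformal Killing system, $\omega_{rj}\xi^r_i+\omega_{ir}\xi^r_j-\frac23\omega_{ij}\xi^r_r=0$, with prolongations $\hat g_2,\hat g_3,\dots$; let $\hat F_0=(T^*\otimes T)/\hat g_1$ and let $\hat h_q\subseteq S_qT^*\otimes\hat F_0$ be the image of the induced map $S_{q+1}T^*\otimes T\to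 S_qT^*\otimes\hat F_0$. (1) $\hat g_2$ is not $2$-acyclic and $\hat g_3=0$; the least $s$ for which $\hat g_{1+s}$ is $2$-acyclic is $s=2$. (2) $\dim\hat F_0=5$, and the cokernel $\hat F_1$ of $S_4T^*\otimes T\to S_3T^*\otimes\hat F_0$ has dimension $5$ and is isomorphic to the kernel of $\delta:\wedge^2T^*\otimes\hat g_2\to\wedge^3T^*\otimes\hat g_1$; thus there are exact sequences $$0\to S_4T^*\otimes T\to S_3T^*\otimes\hat F_0\to\hat F_1\to 0,\qquad 0\to\hat F_1\to\wedge^2T^*\otimes\hat g_2\xrightarrow{\ \delta\ }\wedge^3T^*\otimes\hat g_1\to 0 .$$ (3) $\hat h_3$ is $2$-acyclic, and the cokernel $\hat F_2$ of the induced map $S_4T^*\otimes\hat F_0\to T^*\otimes\hat F_1$ has dimension $3$, is isomorphic to $\wedge^3T^*\otimes\hat g_2$, and gives the exact sequence $$0\to S_5T^*\otimes T\to S_4T^*\otimes\hat F_0\to T^*\otimes\hat F_1\to\hat F_2\to 0 .$$ (4) Assume in addition that $\lambda\omega$ has constant Riemannian curvature for some nonzero $\lambda\in K$, that is, its curvature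 satisfies $\rho^k_{l,ij}=c\,\lambda(\delta^k_i\omega_{lj}-\delta^k_j\omega_{li})$ with $\partial_1c=\partial_2c=\partial_3c=0$. Let $D=K[d_1,d_2,d_3]$ be the ring of differential operators ($d_id_j=d_jd_i$, $d_ia=a\,d_i+(\partial_ia)$ for $a\in K$); a matrix of operators with $p$ rows and $m$ columns acts on row vectors from the right, $D^p\to D^m$. For a matrix of operators $S$, a compatibility condition (CC) of $S$ is a row $P$ over $D$ with $PS=0$; an operator $S'$ of order $e$ generates the CC of $S$ if, for every $r\ge 0$, the CC of $S$ of order at most $r+e$ are exactly the rows $QS'$ with $Q$ of order at most $r$. Let $\Omega_{ij}=\omega_{rj}d_i\xi^r+\omega_{ir}d_j\xi^r+\xi^r\partial_r\omega_{ij}$. The $K$-span of the conformal Killing equations $\Omega_{ij}-\frac13\omega_{ij}\,\omega^{kl}\Omega_{kl}=0$ has dimension $5$. Take any basis of it as the rows of the first-order operator $\mathrm{CKilling}$ ($5\times 3$). It has no nonzero CC of order at most $2$, and its CC of order at most $3$ form a $5$-dimensional $K$-space, whose dual is isomorphic to $\hat F_1$. Any basis of this space is a third-order operator $\mathrm{Weyl}$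 ($5\times 5$) which generates the CC of $\mathrm{CKilling}$. The operator $\mathrm{Weyl}$ has no nonzero CC of order $0$, and its CC of order at most $1$ form a $3$-dimensional $K$-space, whose dual is isomorphic to $\hat F_2$. Any basis of this space is a first-order operator $\mathrm{Bianchi}$ ($3\times 5$) which generates the CC of $\mathrm{Weyl}$, and $\mathrm{Bianchi}$ has no nonzero CC. In other words the sequence $$0\to\hat\Theta\to 3\xrightarrow{\mathrm{CKilling}}5\xrightarrow{\mathrm{Weyl}}5\xrightarrow{\mathrm{Bianchi}}3\to 0$$ of operators of orders $1,3,1$, where $\hat\Theta$ denotes the solutions of the conformal Killing equations, is formally exact. -/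

import Mathlib

/-! # Formal theory: jets, symbols, the Spencer complex, differential operators

`K` is a (differential) field, `n` the number of independent variables, and a multi-index is an
element `μ` of `Fin n →₀ ℕ` of length `μ.degree`; `μ + 1_i` is `μ + Finsupp.single i 1`. -/

namespace FormalPDE

/-! ## Symbols and the Spencer `δ`-complex -/

/-- Families `(v_μ)` of elements of `E` indexed by all multi-indices. -/
abbrev Jet (n : ℕ) (E : Type*) : Type _ := (Fin n →₀ ℕ) → E

/-- `S_q T* ⊗ E`: the families `(v_μ)` that are concentrated on the multi-indices of length `q`. -/
def Sym (K : Type*) [Field K] (n q : ℕ) (E : Type*) [AddCommGroup E] [Module K E] :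
    Submodule K (Jet n E) where
  carrier := {v | ∀ μ, μ.degree ≠ q → v μ = 0}
  zero_mem' := fun _ _ => rfl
  add_mem' := fun {v w} hv hw μ hμ => by simp [hv μ hμ, hw μ hμ]
  smul_mem' := fun c v hv μ hμ => by simp [hv μ hμ]

/-- The shift `(v_μ) ↦ (v_{μ+ν})`. -/
noncomputable def shift (K : Type*) [Field K] {n : ℕ} {E : Type*} [AddCommGroup E] [Module K E]
    (ν : Fin n →₀ ℕ) : Jet n E →ₗ[K] Jet n E where
  toFun v := fun μ => v (μ + ν)
  map_add' _ _ := rfl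
  map_smul' _ _ := rfl

/-- The `r`-th prolongation `g_{q+r} ⊆ S_{q+r} T* ⊗ E` of a symbol `g = g_q ⊆ S_q T* ⊗ E`. -/
noncomputable def prolong {K : Type*} [Field K] {n : ℕ} {E : Type*} [AddCommGroup E] [Module K E]
    (q : ℕ) (g : Submodule K (Jet n E)) (r : ℕ) : Submodule K (Jet n E) where
  carrier := {v | v ∈ Sym K n (q + r) E ∧ ∀ ν : Fin n →₀ ℕ, ν.degree = r → shift K ν v ∈ g}
  zero_mem' := ⟨Submodule.zero_mem _, fun ν _ => by simp⟩
  add_mem' := fun hv hw => ⟨Submodule.add_mem _ hv.1 hw.1, fun ν hν => by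
    rw [map_add]; exact g.add_mem (hv.2 ν hν) (hw.2 ν hν)⟩
  smul_mem' := fun c v hv => ⟨Submodule.smul_mem _ c hv.1, fun ν hν => by
    rw [map_smul]; exact g.smul_mem c (hv.2 ν hν)⟩

/-- `∧^s T* ⊗ g`: an element is the family of its components `ω_I ∈ g` on the basis
`dx^I = dx^{i_1} ∧ … ∧ dx^{i_s}`, `I = {i_1 < … < i_s}`. -/
def forms {K : Type*} [Field K] {n : ℕ} {E : Type*} [AddCommGroup E] [Module K E]
    (s : ℕ) (g : Submodule K (Jet n E)) : Submodule K (Finset (Fin n) → Jet n E) where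
  carrier := {ω | ∀ I, ω I ∈ g ∧ (I.card ≠ s → ω I = 0)}
  zero_mem' := fun _ => ⟨g.zero_mem, fun _ => rfl⟩
  add_mem' := fun {v w} hv hw I => ⟨g.add_mem (hv I).1 (hw I).1, fun h => by
    simp [(hv I).2 h, (hw I).2 h]⟩
  smul_mem' := fun c v hv I => ⟨g.smul_mem c (hv I).1, fun h => by simp [(hv I).2 h]⟩

/-- The Spencer map `(δω)_μ = ∑ i, dx^i ∧ ω_{μ + 1_i}`. The component of `dx^i ∧ dx^J` on
`dx^I`, `I = J ∪ {i}`, is `(-1)` to the number of elements of `I` below `i`. -/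
noncomputable def delta (K : Type*) [Field K] {n : ℕ} {E : Type*} [AddCommGroup E] [Module K E] :
    (Finset (Fin n) → Jet n E) →ₗ[K] (Finset (Fin n) → Jet n E) where
  toFun ω := fun I μ => ∑ i ∈ I, (-1 : K) ^ (I.filter (fun j => j < i)).card •
    ω (I.erase i) (μ + Finsupp.single i 1)
  map_add' v w := by
    funext I μ
    simp [smul_add, Finset.sum_add_distrib]
  map_smul' c v := by
    funext I μ
    simp [Finset.smul_sum, smul_comm c]

/-- A symbol `g = g_q ⊆ S_q T* ⊗ E` is `s`-acyclic if the cohomology of the Spencer sequence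
vanishes at `∧^t T* ⊗ g_{q+r}` for all `1 ≤ t ≤ s` and all `r ≥ 0`. -/
noncomputable def IsAcyclic {K : Type*} [Field K] {n : ℕ} {E : Type*} [AddCommGroup E] [Module K E]
    (q : ℕ) (g : Submodule K (Jet n E)) (s : ℕ) : Prop :=
  ∀ t, 1 ≤ t → t ≤ s → ∀ r, ∀ ω ∈ forms t (prolong q g r), delta K ω = 0 →
    ∃ η ∈ forms (t - 1) (prolong q g (r + 1)), delta K η = ω

/-! ## The symbols of the conformal Killing system -/

/-- `ĝ_1 ⊆ T* ⊗ T`: the `(ξ^k_i)`, written `ξ i k`, with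
`ω_{rj} ξ^r_i + ω_{ir} ξ^r_j - (2/n) ω_{ij} ξ^r_r = 0`. -/
def confOne {K : Type*} [Field K] {n : ℕ} (ω : Matrix (Fin n) (Fin n) K) :
    Submodule K (Fin n → Fin n → K) where
  carrier := {ξ | ∀ i j, ∑ r, ω r j * ξ i r + ∑ r, ω i r * ξ j r
    - 2 / (n : K) * ω i j * ∑ r, ξ r r = 0}
  zero_mem' := fun i j => by simp
  add_mem' := fun {v w} hv hw i j => by
    have h1 := hv i j
    have h2 := hw i j
    simp only [Pi.add_apply, mul_add, Finset.sum_add_distrib]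
    linear_combination h1 + h2
  smul_mem' := fun c v hv i j => by
    have h1 := hv i j
    simp only [Pi.smul_apply, smul_eq_mul, mul_left_comm _ c, ← Finset.mul_sum]
    linear_combination c * h1

/-- The family `(ξ_{ν + 1_i})_i`, an element of `T* ⊗ E`. -/
noncomputable def firstJet {K : Type*} [Field K] {n : ℕ} {E : Type*} [AddCommGroup E] [Module K E]
    (ν : Fin n →₀ ℕ) : Jet n E →ₗ[K] (Fin n → E) where
  toFun v := fun i => v (ν + Finsupp.single i 1)
  map_add' _ _ := rfl
  map_smul' _ _ := rfl

/-- `ĝ_q ⊆ S_q T* ⊗ T` for `q ≥ 1`: the solutions of all the equations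
`ω_{rj} ξ^r_{ν+1_i} + ω_{ir} ξ^r_{ν+1_j} - (2/n) ω_{ij} ξ^r_{ν+1_r} = 0`, `|ν| = q - 1`. -/
noncomputable def confSymbol {K : Type*} [Field K] {n : ℕ} (ω : Matrix (Fin n) (Fin n) K) (q : ℕ) :
    Submodule K (Jet n (Fin n → K)) where
  carrier := {v | v ∈ Sym K n q (Fin n → K) ∧ ∀ ν, firstJet (K := K) ν v ∈ confOne ω}
  zero_mem' := ⟨Submodule.zero_mem _, fun ν => by simp⟩
  add_mem' := fun hv hw => ⟨Submodule.add_mem _ hv.1 hw.1, fun ν => by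
    rw [map_add]; exact Submodule.add_mem _ (hv.2 ν) (hw.2 ν)⟩
  smul_mem' := fun c v hv => ⟨Submodule.smul_mem _ c hv.1, fun ν => by
    rw [map_smul]; exact Submodule.smul_mem _ c (hv.2 ν)⟩

/-- `F̂_0 = (T* ⊗ T) / ĝ_1`. -/
abbrev FZero {K : Type*} [Field K] {n : ℕ} (ω : Matrix (Fin n) (Fin n) K) : Type _ :=
  (Fin n → Fin n → K) ⧸ confOne ω

/-- The symbol map `σ_q(Φ) : S_{q+1} T* ⊗ T → S_q T* ⊗ F̂_0` of the conformal Killing operator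
and of its prolongations. -/
noncomputable def symPhi {K : Type*} [Field K] {n : ℕ} (ω : Matrix (Fin n) (Fin n) K) (q : ℕ) :
    Sym K n (q + 1) (Fin n → K) →ₗ[K] Sym K n q (FZero ω) where
  toFun v := ⟨fun ν => (confOne ω).mkQ (firstJet (K := K) ν v.1), fun ν hν => by
    have h : firstJet (K := K) ν v.1 = 0 := by
      funext i
      exact v.2 _ (by simpa [map_add] using hν)
    simp [h]⟩
  map_add' v w := by
    apply Subtype.ext
    funext ν
    simp
  map_smul' c v := by
    apply Subtype.ext
    funext ν
    simp

/-- `ĥ_q ⊆ S_q T* ⊗ F̂_0`, the image of `σ_q(Φ)`. -/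
noncomputable def confImage {K : Type*} [Field K] {n : ℕ} (ω : Matrix (Fin n) (Fin n) K) (q : ℕ) :
    Submodule K (Jet n (FZero ω)) :=
  (LinearMap.range (symPhi ω q)).map (Sym K n q (FZero ω)).subtype

/-- `F̂_1`, the cokernel of `S_4 T* ⊗ T → S_3 T* ⊗ F̂_0`. -/
noncomputable abbrev FOne {K : Type*} [Field K] {n : ℕ} (ω : Matrix (Fin n) (Fin n) K) : Type _ :=
  Sym K n 3 (FZero ω) ⧸ LinearMap.range (symPhi ω 3)

/-- The map `S_4 T* ⊗ F̂_0 → T* ⊗ F̂_1` induced by `S_4 T* ⊗ F̂_0 → T* ⊗ S_3 T* ⊗ F̂_0`. -/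
noncomputable def symPsi {K : Type*} [Field K] {n : ℕ} (ω : Matrix (Fin n) (Fin n) K) :
    Sym K n 4 (FZero ω) →ₗ[K] (Fin n → FOne ω) where
  toFun u := fun i => (LinearMap.range (symPhi ω 3)).mkQ
    ⟨shift K (Finsupp.single i 1) u.1, fun μ hμ => by
      refine u.2 _ ?_
      simp only [map_add, Finsupp.degree_single]
      omega⟩
  map_add' u v := by
    funext i
    rw [Pi.add_apply, ← map_add]
    rfl
  map_smul' c v := by
    funext i
    rw [RingHom.id_apply, Pi.smul_apply, ← map_smul]
    rfl

/-- `F̂_2`, the cokernel of `S_4 T* ⊗ F̂_0 → T* ⊗ F̂_1`. -/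
noncomputable abbrev FTwo {K : Type*} [Field K] {n : ℕ} (ω : Matrix (Fin n) (Fin n) K) : Type _ :=
  (Fin n → FOne ω) ⧸ LinearMap.range (symPsi ω)

/-! ## Linear differential operators over a differential field

`D = K[d_1, …, d_n]` is the ring of differential operators: `d_i d_j = d_j d_i` and
`d_i a = a d_i + ∂_i a` for `a ∈ K`. The operator `∑ a_μ d_μ` is written as the polynomial
`∑ a_μ X^μ`, with the coefficients on the left. `D^m` is the left module of rows
`(P_1, …, P_m)`, which stand for `y ↦ ∑ k, P_k y^k`. -/

/-- The free left `D`-module `D^m`, as a vector space over `K`. -/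
abbrev Row (K : Type*) [Field K] (n m : ℕ) : Type _ := Fin m → MvPolynomial (Fin n) K

/-- Left multiplication by `d_i` in `D`: `d_i (a d_μ) = a d_{μ + 1_i} + (∂_i a) d_μ`. -/
noncomputable def dLeft {K : Type*} [Field K] {n : ℕ} (der : Fin n → Derivation ℤ K K)
    (i : Fin n) (P : MvPolynomial (Fin n) K) : MvPolynomial (Fin n) K :=
  MvPolynomial.X i * P + ∑ μ ∈ P.support, MvPolynomial.monomial μ (der i (P.coeff μ))

/-- Left multiplication by `d_μ = d_1^{μ_1} ⋯ d_n^{μ_n}` on `D^m`. -/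
noncomputable def dPow {K : Type*} [Field K] {n m : ℕ} (der : Fin n → Derivation ℤ K K)
    (μ : Fin n →₀ ℕ) (v : Row K n m) : Row K n m := fun k =>
  (List.finRange n).foldr (fun i P => (dLeft der i)^[μ i] P) (v k)

/-- The map `D^p → D^m`, `(P_1, …, P_p) ↦ ∑ a, P_a S_a`, of left `D`-modules given by a matrix
`S` of operators with rows `S_a`, that is by the operator `S : K^m → K^p`. -/
noncomputable def rowMul {K : Type*} [Field K] {n m p : ℕ} (der : Fin n → Derivation ℤ K K)
    (S : Fin p → Row K n m) : Row K n p →ₗ[K] Row K n m :=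
  ∑ a, ((MvPolynomial.basisMonomials (Fin n) K).constr K fun μ => dPow der μ (S a)) ∘ₗ
    LinearMap.proj a

/-- The rows of operators of order at most `r`. -/
noncomputable def ordLE (K : Type*) [Field K] (n m r : ℕ) : Submodule K (Row K n m) :=
  Submodule.pi Set.univ fun _ => MvPolynomial.restrictTotalDegree (Fin n) K r

/-- The compatibility conditions of order at most `e` of the inhomogeneous system `S y = z`:
the rows `P` of order at most `e` with `P S = 0`. -/
noncomputable def compat {K : Type*} [Field K] {n m p : ℕ} (der : Fin n → Derivation ℤ K K)
    (S : Fin p → Row K n m) (e : ℕ) : Submodule K (Row K n p) :=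
  LinearMap.ker (rowMul der S) ⊓ ordLE K n p e

/-- The operator `S'`, of order `e`, generates the compatibility conditions of `S`: for every
`r`, those of order at most `r + e` are exactly the `Q S'` with `Q` of order at most `r`. -/
def Generates {K : Type*} [Field K] {n m p l : ℕ} (der : Fin n → Derivation ℤ K K)
    (S' : Fin l → Row K n p) (e : ℕ) (S : Fin p → Row K n m) : Prop :=
  ∀ r, (ordLE K n l r).map (rowMul der S') = compat der S (r + e)

/-! ## Metrics over a differential field -/

/-- Christoffel symbols `γ^k_{ij}`. -/
noncomputable def christoffel {K : Type*} [Field K] {n : ℕ} (der : Fin n → Derivation ℤ K K)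
    (ω : Matrix (Fin n) (Fin n) K) (k i j : Fin n) : K :=
  1 / 2 * ∑ r, ω⁻¹ k r * (der i (ω r j) + der j (ω i r) - der r (ω i j))

/-- The curvature `ρ^k_{l,ij}`. -/
noncomputable def riemann {K : Type*} [Field K] {n : ℕ} (der : Fin n → Derivation ℤ K K)
    (ω : Matrix (Fin n) (Fin n) K) (k l i j : Fin n) : K :=
  der i (christoffel der ω k l j) - der j (christoffel der ω k l i)
    + ∑ r, (christoffel der ω r l j * christoffel der ω k r i
      - christoffel der ω r l i * christoffel der ω k r j)

/-- Constant Riemannian curvature: `ρ^k_{l,ij} = c (δ^k_i ω_{lj} - δ^k_j ω_{li})`. -/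
def IsConstCurvature {K : Type*} [Field K] {n : ℕ} (der : Fin n → Derivation ℤ K K)
    (ω : Matrix (Fin n) (Fin n) K) : Prop :=
  ∃ c : K, (∀ i, der i c = 0) ∧ ∀ k l i j, riemann der ω k l i j =
    c * ((1 : Matrix (Fin n) (Fin n) K) k i * ω l j
      - (1 : Matrix (Fin n) (Fin n) K) k j * ω l i)

/-- The Killing operator `Ω_{ij} = ω_{rj} d_i ξ^r + ω_{ir} d_j ξ^r + ξ^r ∂_r ω_{ij}`. -/
noncomputable def killing {K : Type*} [Field K] {n : ℕ} (der : Fin n → Derivation ℤ K K)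
    (ω : Matrix (Fin n) (Fin n) K) (i j : Fin n) : Row K n n := fun r =>
  MvPolynomial.C (ω r j) * MvPolynomial.X i + MvPolynomial.C (ω i r) * MvPolynomial.X j
    + MvPolynomial.C (der r (ω i j))

/-- The conformal Killing equations: `L(ξ)ω = A ω` with `A` eliminated by taking the trace,
`Ω_{ij} - (1/n) ω_{ij} ω^{kl} Ω_{kl} = 0`. -/
noncomputable def confKilling {K : Type*} [Field K] {n : ℕ} (der : Fin n → Derivation ℤ K K)
    (ω : Matrix (Fin n) (Fin n) K) (i j : Fin n) : Row K n n :=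
  killing der ω i j - (1 / (n : K) * ω i j) • ∑ k, ∑ l, ω⁻¹ k l • killing der ω k l

/-- The linear combinations over `K` of the conformal Killing equations: the linear forms on
`J_1(T)` vanishing on `R̂_1`, that is the dual of `J_1(T) / R̂_1 = F̂_0`. -/
noncomputable def confEquations {K : Type*} [Field K] {n : ℕ}
    (der : Fin n → Derivation ℤ K K) (ω : Matrix (Fin n) (Fin n) K) :
    Submodule K (Row K n n) :=
  Submodule.span K (Set.range fun ij : Fin n × Fin n => confKilling der ω ij.1 ij.2)

end FormalPDE

namespace FormalPDE

/-! ## Multi-indices -/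

/-! Everything rests on one algebraic fact, `conformal_third_prolongation`: if commuting operators
satisfy the conformal Killing symbol equations, three of them in succession kill the unknowns. With
index shifts as operators this gives `ĝ_3 = 0`. With multiplication by the variables on the quotient
of polynomial rows by the symbol rows, it says that this quotient vanishes in degrees at least 3.

The symbol statements follow by counting and by the Poincaré lemma. The spaces `S_3 T* ⊗ T` and `S_2
T* ⊗ F̂_0` both have dimension 30, so the injectivity given by `ĝ_3 = 0` is bijectivity
(`symPhi_two_surjective`). Surjectivity descends to lower degrees, and `ĝ_1`, `ĝ_2` have dimensions
4 and 3. A diagram chase makes `δ : ∧² T* ⊗ ĝ_2 → ∧³ T* ⊗ ĝ_1` onto, so its kernel has dimension 9 -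
4 = 5; these cocycles cannot be coboundaries, because `ĝ_3 = 0`. Acyclicity of `ĥ_3` holds because
cocycles lift uniquely to `T`-valued ones, to which the Poincaré lemma applies.

For the operators, leading parts are compared first. The Koszul complex in three variables shows
that syzygies of the symbol of `CKilling` in degree above 3 come from degree 3, and that those of
the symbol of `Weyl` in degree above 1 come from degree 1 (`exists_syzygy_sum`,
`exists_second_syzygy_sum`). By `generates_of_symbol`, an operator whose symbol generates the
syzygies generates the compatibility conditions, provided there are none of lower order.

What remains is to lift a degree 3 symbol syzygy to a genuine compatibility condition. This is
formal integrability, and it is where constant curvature enters. The curvature hypothesis makes an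
explicit rank 5 connection flat, and its bivectors form a left module of dimension 10 containing a
formal solution of the conformal Killing equations. Evaluation at this solution kills all
consequences of the equations and has rank at least 10 on operators of order at most 2
(`exists_solution_space`). In order at most 3 there are 60 dimensions of rows, while the equations
and their derivatives fill 50, so nothing else is killed (`map_rowMul_two_and_finrank`). The
dimensions of all spaces of compatibility conditions are then determined, and the same count shows
that `Bianchi` has no compatibility conditions. -/

theorem exists_eq_add_single {n : ℕ} {μ : Fin n →₀ ℕ} (h : μ.degree ≠ 0) :
    ∃ i ν, μ = ν + Finsupp.single i 1 := by
  have hμ : μ ≠ 0 := fun h0 => h (by simp [h0])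
  obtain ⟨i, hi⟩ := Finsupp.ne_iff.1 hμ
  refine ⟨i, μ - Finsupp.single i 1, (tsub_add_cancel_of_le ?_).symm⟩
  simpa [Finsupp.single_le_iff, Nat.one_le_iff_ne_zero] using hi

theorem exists_eq_add_degree {n : ℕ} (r : ℕ) :
    ∀ μ : Fin n →₀ ℕ, r ≤ μ.degree → ∃ ν κ, κ.degree = r ∧ μ = ν + κ := by
  induction r with
  | zero => exact fun μ _ => ⟨μ, 0, by simp, by simp⟩
  | succ r ih =>
    intro μ h
    obtain ⟨ν, κ, hκ, rfl⟩ := ih μ (by omega)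
    have hν : ν.degree ≠ 0 := by
      rw [map_add] at h
      omega
    obtain ⟨i, ν', rfl⟩ := exists_eq_add_single hν
    exact ⟨ν', Finsupp.single i 1 + κ, by simp [hκ, add_comm], by rw [add_assoc]⟩

/-- The multi-indices of length `q`. -/
abbrev Deg (n q : ℕ) : Type := {μ : Fin n →₀ ℕ // μ.degree = q}

/-- The multi-indices of length `q`, as an antidiagonal. -/
def degEquiv (n q : ℕ) :
    Deg n q ≃ ((Finset.univ : Finset (Fin n)).finsuppAntidiag q) :=
  Equiv.subtypeEquivRight fun μ => by
    simp [Finset.mem_finsuppAntidiag, Finsupp.degree_eq_sum]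

noncomputable instance (n q : ℕ) : Fintype (Deg n q) := Fintype.ofEquiv _ (degEquiv n q).symm

theorem card_deg (n q : ℕ) : Fintype.card (Deg n q) = (n + q - 1).choose q := by
  rw [Fintype.card_congr (degEquiv n q), Fintype.card_coe,
    Finset.card_finsuppAntidiag_nat_eq_choose, Finset.card_univ, Fintype.card_fin]

/-! ## Symmetric forms -/

section Sym

variable {K : Type*} [Field K] {n : ℕ} {E : Type*} [AddCommGroup E] [Module K E]

/-- An element of `S_q T* ⊗ E` is determined by its components of length `q`. -/
noncomputable def symEquiv (K : Type*) [Field K] (n q : ℕ) (E : Type*) [AddCommGroup E]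
    [Module K E] : Sym K n q E ≃ₗ[K] (Deg n q → E) where
  toFun v μ := v.1 μ.1
  map_add' _ _ := rfl
  map_smul' _ _ := rfl
  invFun w := ⟨fun μ => if h : μ.degree = q then w ⟨μ, h⟩ else 0, fun μ h => by simp [h]⟩
  left_inv v := by
    apply Subtype.ext
    funext μ
    by_cases h : μ.degree = q
    · simp [h]
    · simp [h, v.2 μ h]
  right_inv w := by
    funext μ
    simp [μ.2]

instance [FiniteDimensional K E] (q : ℕ) : FiniteDimensional K (Sym K n q E) :=
  Module.Finite.equiv (symEquiv K n q E).symm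

theorem finrank_sym [FiniteDimensional K E] (q : ℕ) :
    Module.finrank K (Sym K n q E) = (n + q - 1).choose q * Module.finrank K E := by
  rw [(symEquiv K n q E).finrank_eq, Module.finrank_pi_fintype, Finset.sum_const,
    Finset.card_univ, card_deg, smul_eq_mul]

theorem shift_apply (ν μ : Fin n →₀ ℕ) (v : Jet n E) : shift K ν v μ = v (μ + ν) := rfl

theorem shift_shift (ν κ : Fin n →₀ ℕ) (v : Jet n E) :
    shift K ν (shift K κ v) = shift K (ν + κ) v := by
  funext μ
  simp [shift_apply, add_assoc]

theorem shift_mem_sym {q r : ℕ} {v : Jet n E} (hv : v ∈ Sym K n (q + r) E) {ν : Fin n →₀ ℕ}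
    (hν : ν.degree = r) : shift K ν v ∈ Sym K n q E := fun μ hμ => by
  refine hv _ ?_
  rw [map_add]
  omega

theorem shift_single_mem_sym {q : ℕ} {v : Jet n E} (hv : v ∈ Sym K n (q + 1) E) (i : Fin n) :
    shift K (Finsupp.single i 1) v ∈ Sym K n q E :=
  shift_mem_sym hv (by simp)

theorem eq_of_shift_eq {q : ℕ} {v w : Jet n E} (hv : v ∈ Sym K n (q + 1) E)
    (hw : w ∈ Sym K n (q + 1) E)
    (h : ∀ i, shift K (Finsupp.single i 1) v = shift K (Finsupp.single i 1) w) : v = w := by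
  funext μ
  by_cases hμ : μ.degree = 0
  · rw [hv μ (by omega), hw μ (by omega)]
  · obtain ⟨i, ν, rfl⟩ := exists_eq_add_single hμ
    exact congrFun (h i) ν

/-- The Poincaré lemma for `1`-forms. -/
theorem exists_shift_eq_of_closed {q : ℕ} (b : Fin n → Jet n E)
    (hb : ∀ i, b i ∈ Sym K n q E)
    (h : ∀ i j, shift K (Finsupp.single i 1) (b j) = shift K (Finsupp.single j 1) (b i)) :
    ∃ v ∈ Sym K n (q + 1) E, ∀ i, shift K (Finsupp.single i 1) v = b i := by
  classical
  -- The component of `v` at `μ` is read off from an arbitrarily chosen way of splitting one unit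
  -- from `μ`; closedness makes the value independent of that choice.
  have key : ∀ i j ν κ, ν + Finsupp.single i 1 = κ + Finsupp.single j 1 → b i ν = b j κ := by
    intro i j ν κ e
    by_cases hij : i = j
    · subst hij
      rw [add_right_cancel e]
    · have hi : 1 ≤ κ i := by
        have := DFunLike.congr_fun e i
        simp [Ne.symm hij] at this
        omega
      obtain ⟨τ, rfl⟩ : ∃ τ, κ = τ + Finsupp.single i 1 :=
        ⟨κ - Finsupp.single i 1, (tsub_add_cancel_of_le (by simpa using hi)).symm⟩
      have e' : ν = τ + Finsupp.single j 1 := by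
        rw [add_right_comm] at e
        exact add_right_cancel e
      subst e'
      exact congrFun (h j i) τ
  refine ⟨fun μ => if hμ : ∃ p : Fin n × (Fin n →₀ ℕ), μ = p.2 + Finsupp.single p.1 1 then
    b hμ.choose.1 hμ.choose.2 else 0, fun μ hμ => ?_, fun i => ?_⟩
  · dsimp only
    split_ifs with hp
    · refine hb _ _ ?_
      have := congrArg Finsupp.degree hp.choose_spec
      simp at this
      omega
    · rfl
  · funext μ
    have hp : ∃ p : Fin n × (Fin n →₀ ℕ),
        μ + Finsupp.single i 1 = p.2 + Finsupp.single p.1 1 := ⟨(i, μ), rfl⟩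
    rw [shift_apply, dif_pos hp]
    exact (key _ _ _ _ hp.choose_spec).symm

/-- The Poincaré lemma in top degree. -/
theorem exists_shift_eq {q : ℕ} (i : Fin n) (v : Jet n E) (hv : v ∈ Sym K n q E) :
    ∃ w ∈ Sym K n (q + 1) E, shift K (Finsupp.single i 1) w = v ∧ ∀ μ, μ i = 0 → w μ = 0 := by
  classical
  -- Integration in the variable `i` with zero integration constant. The recorded vanishing at `μ i
  -- = 0` is the normalization used for 2-forms.
  refine ⟨fun μ => if μ i = 0 then 0 else v (μ - Finsupp.single i 1), fun μ hμ => ?_, ?_, ?_⟩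
  · dsimp only
    split_ifs with h
    · rfl
    · refine hv _ fun h' => hμ ?_
      have e : μ = (μ - Finsupp.single i 1) + Finsupp.single i 1 :=
        (tsub_add_cancel_of_le (by rw [Finsupp.single_le_iff]; omega)).symm
      rw [← h']
      conv_lhs => rw [e]
      simp
  · funext μ
    simp [shift_apply]
  · intro μ hμ
    simp [hμ]

/-- The Poincaré lemma for `2`-forms in three variables. -/
theorem exists_shift_sub_shift_eq {q : ℕ} (a b c : Jet 3 E) (ha : a ∈ Sym K 3 q E)
    (hb : b ∈ Sym K 3 q E) (hc : c ∈ Sym K 3 q E)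
    (h : shift K (Finsupp.single 0 1) a - shift K (Finsupp.single 1 1) b
      + shift K (Finsupp.single 2 1) c = 0) :
    ∃ u : Fin 3 → Jet 3 E, (∀ i, u i ∈ Sym K 3 (q + 1) E) ∧
      shift K (Finsupp.single 1 1) (u 2) - shift K (Finsupp.single 2 1) (u 1) = a ∧
      shift K (Finsupp.single 0 1) (u 2) - shift K (Finsupp.single 2 1) (u 0) = b ∧
      shift K (Finsupp.single 0 1) (u 1) - shift K (Finsupp.single 1 1) (u 0) = c := by
  classical
  -- Integrating `a` and `b` in the last variable settles two of the three equations. In the third,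
  -- closedness takes care of the components with `μ 2 ≠ 0`, so only the part of `c` free of that
  -- variable remains, and it is integrated in the first variable.
  obtain ⟨u₀, h₀, hs₀, hz₀⟩ := exists_shift_eq (K := K) 2 b hb
  obtain ⟨u₁, h₁, hs₁, hz₁⟩ := exists_shift_eq (K := K) 2 a ha
  have hc' : (fun μ => if μ 2 = 0 then c μ else 0) ∈ Sym K 3 q E := fun μ hμ => by
    simp [hc μ hμ]
  obtain ⟨u₂, h₂, hs₂, hz₂⟩ := exists_shift_eq (K := K) 0 _ hc'
  -- The correction `u₂` is free of the last variable, so it does not disturb the equation for `a`.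
  have hs₂' : shift K (Finsupp.single 2 1) u₂ = 0 := by
    funext μ
    by_cases hμ : μ 0 = 0
    · exact hz₂ _ (by simp [hμ])
    · obtain ⟨τ, rfl⟩ : ∃ τ, μ = τ + Finsupp.single 0 1 :=
        ⟨μ - Finsupp.single 0 1, (tsub_add_cancel_of_le (by
          rw [Finsupp.single_le_iff]; omega)).symm⟩
      rw [shift_apply, add_right_comm]
      refine (congrFun hs₂ (τ + Finsupp.single 2 1)).trans ?_
      simp
  refine ⟨![-u₀, u₂ - u₁, 0], fun i => ?_, ?_, ?_, ?_⟩
  · fin_cases i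
    · exact Submodule.neg_mem _ h₀
    · exact Submodule.sub_mem _ h₂ h₁
    · exact Submodule.zero_mem _
  · simp [hs₁, hs₂']
  · simp [hs₀]
  · funext μ
    have e₂ := congrFun hs₂ μ
    by_cases hμ : μ 2 = 0
    · have e₀ := hz₀ (μ + Finsupp.single 1 1) (by simp [hμ])
      have e₁ := hz₁ (μ + Finsupp.single 0 1) (by simp [hμ])
      simp only [hμ, if_true] at e₂
      simp only [Matrix.cons_val_zero, Matrix.cons_val_one, map_sub, map_neg, Pi.sub_apply,
        Pi.neg_apply, e₂]
      simp only [shift_apply, e₀, e₁]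
      simp
    · obtain ⟨τ, rfl⟩ : ∃ τ, μ = τ + Finsupp.single 2 1 :=
        ⟨μ - Finsupp.single 2 1, (tsub_add_cancel_of_le (by
          rw [Finsupp.single_le_iff]; omega)).symm⟩
      have e₀ := congrFun hs₀ (τ + Finsupp.single 1 1)
      have e₁ := congrFun hs₁ (τ + Finsupp.single 0 1)
      have e := congrFun h τ
      simp only [hμ, if_false] at e₂
      simp only [Matrix.cons_val_zero, Matrix.cons_val_one, map_sub, map_neg, Pi.sub_apply,
        Pi.neg_apply, e₂]
      simp only [shift_apply, Pi.add_apply, Pi.sub_apply, Pi.zero_apply] at e₀ e₁ e ⊢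
      rw [add_right_comm τ, add_right_comm τ (Finsupp.single 2 1) (Finsupp.single 1 1), e₀, e₁]
      rw [← sub_eq_zero]
      refine Eq.trans ?_ (neg_eq_zero.2 e)
      abel

end Sym

/-! ## The third prolongation of the conformal Killing equations -/

section Abstract

variable {K : Type*} [Field K] {M : Type*} [AddCommGroup M] [Module K M]

/-- If `X_i ξ_j + X_j ξ_i = ω_{ij} s` for commuting operators `X_i`, then `X_l X_k X_i ξ_j = 0`. -/
theorem conformal_third_prolongation [CharZero K] {ω : Matrix (Fin 3) (Fin 3) K}
    (hsymm : ω.IsSymm) (hdet : ω.det ≠ 0) (X : Fin 3 → M →ₗ[K] M)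
    (hX : ∀ i j m, X i (X j m) = X j (X i m)) (ξ : Fin 3 → M) (s : M)
    (h : ∀ i j, X i (ξ j) + X j (ξ i) = ω i j • s) (i j k l : Fin 3) :
    X l (X k (X i (ξ j))) = 0 := by
  have hs : ∀ a b, ω a b = ω b a := fun a b => hsymm.apply b a
  have hu : IsUnit ω.det := isUnit_iff_ne_zero.2 hdet
  -- As for Christoffel symbols: differentiate the three cyclic versions of the equation and take
  -- the alternating combination.
  have hT : ∀ k i j, (2 : K) • X k (X i (ξ j)) =
      ω i j • X k s + ω k j • X i s - ω k i • X j s := by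
    intro k i j
    have h1 := congrArg (X k) (h i j)
    have h2 := congrArg (X i) (h j k)
    have h3 := congrArg (X j) (h k i)
    simp only [map_add, map_smul] at h1 h2 h3
    rw [hX j k, hX j i] at h3
    rw [hX i k] at h2
    rw [hs k j, ← h1, ← h2, ← h3]
    module
  -- Integrability condition: `X l (X k (X i (ξ j)))` is symmetric in `i` and `l`, and `hT`
  -- expresses it by second derivatives of `s`.
  have hR : ∀ i j k l, ω i j • X k (X l s) - ω k i • X j (X l s) =
      ω l j • X k (X i s) - ω k l • X j (X i s) := by
    intro i j k l
    have h1 := congrArg (X l) (hT k i j)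
    have h2 := congrArg (X i) (hT k l j)
    simp only [map_add, map_sub, map_smul] at h1 h2
    have e : X l (X k (X i (ξ j))) = X i (X k (X l (ξ j))) := by
      rw [hX l k, hX l i, hX k i]
    rw [e, h2] at h1
    rw [hX k l, hX j l, hX k i, hX j i]
    rw [hX i l] at h1
    linear_combination (norm := module) (-1 : K) • h1
  have hinv : ∀ a b, ∑ c, ω a c * ω⁻¹ c b = if a = b then 1 else 0 := by
    intro a b
    rw [← Matrix.mul_apply, Matrix.mul_nonsing_inv _ hu, Matrix.one_apply]
  have hinv' : ∀ a b, ∑ c, ω⁻¹ a c * ω c b = if a = b then 1 else 0 := by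
    intro a b
    rw [← Matrix.mul_apply, Matrix.nonsing_inv_mul _ hu, Matrix.one_apply]
  have hy : ∀ a b, X a (X b s) = X b (X a s) := fun a b => hX a b s
  set Δ : M := ∑ i, ∑ j, ω⁻¹ i j • X j (X i s) with hΔ
  have hc : ∀ (m : Fin 3 → M) (a : Fin 3),
      ∑ i, ∑ j, ω⁻¹ j i • (ω i a • m j) = m a := by
    intro m a
    rw [Finset.sum_comm]
    simp only [smul_smul, ← Finset.sum_smul, hinv', ite_smul, one_smul, zero_smul,
      Finset.sum_ite_eq', Finset.mem_univ, if_true]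
  have hinvs : ∀ a b, ω⁻¹ a b = ω⁻¹ b a := fun a b => hsymm.inv.apply b a
  have hc' : ∀ (m : Fin 3 → M) (a : Fin 3),
      ∑ i, ∑ j, ω⁻¹ i j • (ω j a • m i) = m a := by
    intro m a
    rw [Finset.sum_comm]
    exact hc m a
  have htr : ∑ i, ∑ j, ω⁻¹ i j * ω i j = 3 := by
    have : ∀ i, ∑ j, ω⁻¹ i j * ω i j = 1 := by
      intro i
      have := hinv' i i
      simp only [if_true] at this
      rw [← this]
      exact Finset.sum_congr rfl fun j _ => by rw [hs i j]
    simp [this]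
  -- Contracting `hR` over `i, j` leaves the coefficient 3 - 1 - 1 = 1 on the Hessian of `s`, so
  -- dimension three is just large enough to solve for it.
  have hD : ∀ k l, X k (X l s) = -(ω k l • Δ) := by
    intro k l
    have e : ∑ i, ∑ j, ω⁻¹ i j • (ω i j • X k (X l s) - ω k i • X j (X l s)) =
        ∑ i, ∑ j, ω⁻¹ i j • (ω l j • X k (X i s) - ω k l • X j (X i s)) := by
      simp only [hR]
    simp only [smul_sub, Finset.sum_sub_distrib] at e
    have e1 : ∑ i, ∑ j, ω⁻¹ i j • (ω i j • X k (X l s)) = (3 : K) • X k (X l s) := by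
      simp only [smul_smul, ← Finset.sum_smul, htr]
    have e2 : ∑ i, ∑ j, ω⁻¹ i j • (ω k i • X j (X l s)) = X k (X l s) := by
      simp only [hs k]
      refine (Finset.sum_congr rfl fun i _ => Finset.sum_congr rfl fun j _ => ?_).trans
        (hc (fun j => X j (X l s)) k)
      rw [hinvs]
    have e3 : ∑ i, ∑ j, ω⁻¹ i j • (ω l j • X k (X i s)) = X k (X l s) := by
      simp only [hs l]
      exact hc' (fun i => X k (X i s)) l
    have e4 : ∑ i, ∑ j, ω⁻¹ i j • (ω k l • X j (X i s)) = ω k l • Δ := by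
      simp only [hΔ, Finset.smul_sum]
      exact Finset.sum_congr rfl fun i _ => Finset.sum_congr rfl fun j _ => smul_comm _ _ _
    rw [e1, e2, e3, e4] at e
    linear_combination (norm := module) e
  -- Tracing `hD` gives `Δ = -3 Δ`.
  have hΔ0 : Δ = 0 := by
    have e : Δ = -((3 : K) • Δ) := by
      conv_lhs => rw [hΔ]
      simp only [hD, smul_neg, smul_smul, Finset.sum_neg_distrib, ← Finset.sum_smul]
      rw [← htr]
      simp only [hs]
    have : (4 : K) • Δ = 0 := by linear_combination (norm := module) e
    exact (smul_eq_zero.1 this).resolve_left (by norm_num)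
  have hy0 : ∀ k l, X k (X l s) = 0 := fun k l => by rw [hD, hΔ0]; simp
  have h2 := congrArg (X l) (hT k i j)
  simp only [map_add, map_sub, map_smul, hy0, smul_zero, add_zero, sub_zero] at h2
  exact (smul_eq_zero.1 h2).resolve_left two_ne_zero

end Abstract

end FormalPDE

namespace FormalPDE

/-! ## Matrices with pure trace symmetric part -/

section SkewConf

variable {K : Type*} [Field K]

/-- The matrices whose symmetric part is a multiple of `h`. -/
def skewConf (h : Matrix (Fin 3) (Fin 3) K) : Submodule K (Matrix (Fin 3) (Fin 3) K) where
  carrier := {B | ∃ φ : K, B + B.transpose = φ • h}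
  zero_mem' := ⟨0, by simp⟩
  add_mem' := by
    rintro A B ⟨a, ha⟩ ⟨b, hb⟩
    refine ⟨a + b, ?_⟩
    rw [add_smul, ← ha, ← hb, Matrix.transpose_add]
    abel
  smul_mem' := by
    rintro c A ⟨a, ha⟩
    exact ⟨c * a, by rw [mul_smul, ← ha, Matrix.transpose_smul, smul_add]⟩

/-- The parametrization of `skewConf h`. -/
noncomputable def skewConfParam (h : Matrix (Fin 3) (Fin 3) K) :
    (Fin 4 → K) →ₗ[K] Matrix (Fin 3) (Fin 3) K where
  toFun c := (c 3 / 2) • h + !![0, c 0, c 1; -c 0, 0, c 2; -c 1, -c 2, 0]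
  map_add' c d := by
    ext i j
    fin_cases i <;> fin_cases j <;> simp <;> ring
  map_smul' a c := by
    ext i j
    fin_cases i <;> fin_cases j <;> simp <;> ring

/-- Three skew entries and the multiple of `h` are free parameters. They are independent because `h`
is symmetric and nonzero; the factor 1/2 in the parametrization compensates for `B + Bᵀ` doubling
the symmetric part. -/
theorem finrank_skewConf [CharZero K] {h : Matrix (Fin 3) (Fin 3) K} (hs : h.IsSymm)
    (h0 : h ≠ 0) : Module.finrank K (skewConf h) = 4 := by
  have hinj : Function.Injective (skewConfParam h) := by
    rw [← LinearMap.ker_eq_bot, LinearMap.ker_eq_bot']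
    intro c hc
    have e : ∀ i j, skewConfParam h c i j = 0 := fun i j => by rw [hc]; rfl
    have h3 : c 3 = 0 := by
      by_contra h3
      apply h0
      ext i j
      have e1 := e i j
      have e2 := e j i
      have hij := hs.apply i j
      fin_cases i <;> fin_cases j <;> simp [skewConfParam] at e1 e2 hij ⊢ <;> grind
    have e1 := e 0 1
    have e2 := e 0 2
    have e3 := e 1 2
    simp [skewConfParam, h3] at e1 e2 e3
    funext i
    fin_cases i <;> simp [*]
  have hr : LinearMap.range (skewConfParam h) = skewConf h := by
    ext B
    constructor
    · rintro ⟨c, rfl⟩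
      refine ⟨c 3, ?_⟩
      ext i j
      have hij := hs.apply i j
      fin_cases i <;> fin_cases j <;> simp [skewConfParam] at hij ⊢ <;> grind
    · rintro ⟨φ, hφ⟩
      refine ⟨![B 0 1 - φ / 2 * h 0 1, B 0 2 - φ / 2 * h 0 2, B 1 2 - φ / 2 * h 1 2, φ], ?_⟩
      ext i j
      have e := congrFun (congrFun hφ i) j
      have hij := hs.apply i j
      fin_cases i <;> fin_cases j <;> simp [skewConfParam] at hij e ⊢ <;> grind
  rw [← hr, LinearMap.finrank_range_of_inj hinj]
  simp

/-- Multiplying by `ω` lowers the upper index. The multiple of `ω` need not be prescribed: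
contraction with the inverse metric forces it to be two thirds of the trace. -/
theorem mem_confOne_iff [CharZero K] {ω : Matrix (Fin 3) (Fin 3) K} (hsymm : ω.IsSymm)
    (hdet : ω.det ≠ 0) (ξ : Matrix (Fin 3) (Fin 3) K) :
    (fun i => ξ i) ∈ confOne ω ↔ ξ * ω ∈ skewConf ω := by
  have hu : IsUnit ω.det := isUnit_iff_ne_zero.2 hdet
  have hs : ∀ a b, ω a b = ω b a := fun a b => hsymm.apply b a
  have key : ∀ i j, ∑ r, ω r j * ξ i r + ∑ r, ω i r * ξ j r
      - 2 / ((3 : ℕ) : K) * ω i j * ∑ r, ξ r r =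
      (ξ * ω + (ξ * ω).transpose - (2 / 3 * ξ.trace) • ω) i j := by
    intro i j
    simp only [Matrix.sub_apply, Matrix.add_apply, Matrix.transpose_apply, Matrix.mul_apply,
      Matrix.smul_apply, smul_eq_mul, Matrix.trace, Matrix.diag, hs i]
    push_cast
    simp only [mul_comm (ω _ _)]
    ring
  constructor
  · intro h
    refine ⟨2 / 3 * ξ.trace, ?_⟩
    rw [← sub_eq_zero]
    ext i j
    rw [← key]
    exact h i j
  · rintro ⟨φ, hφ⟩ i j
    have h1 : (2 : K) * ξ.trace = φ * 3 := by
      have := congrArg (fun B => (B * ω⁻¹).trace) hφ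
      simp only [add_mul, Matrix.trace_add, Matrix.mul_assoc, Matrix.mul_nonsing_inv _ hu,
        Matrix.mul_one, Matrix.transpose_mul, hsymm.eq, Matrix.smul_mul, Matrix.trace_smul,
        Matrix.trace_one, Fintype.card_fin, smul_eq_mul] at this
      rw [Matrix.trace_mul_comm, Matrix.mul_assoc, Matrix.nonsing_inv_mul _ hu, Matrix.mul_one,
        Matrix.trace_transpose] at this
      push_cast at this
      linear_combination this
    have h2 : (2 / 3 * ξ.trace) = φ := by linear_combination (1 / 3 : K) * h1
    rw [key, h2, hφ, sub_self]
    rfl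

theorem finrank_confOne [CharZero K] {ω : Matrix (Fin 3) (Fin 3) K} (hsymm : ω.IsSymm)
    (hdet : ω.det ≠ 0) : Module.finrank K (confOne ω) = 4 := by
  have hu : IsUnit ω.det := isUnit_iff_ne_zero.2 hdet
  have h0 : ω ≠ 0 := fun h => hdet (by rw [h, Matrix.det_zero])
  let e : (Fin 3 → Fin 3 → K) ≃ₗ[K] Matrix (Fin 3) (Fin 3) K :=
    { toFun := fun ξ => Matrix.of ξ * ω
      map_add' := fun a b => Matrix.add_mul (Matrix.of a) (Matrix.of b) ω
      map_smul' := fun c a => Matrix.smul_mul c (Matrix.of a) ω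
      invFun := fun B => Matrix.of.symm (B * ω⁻¹)
      left_inv := fun ξ => by
        simp [Matrix.mul_assoc, Matrix.mul_nonsing_inv _ hu]
      right_inv := fun B => by
        simp [Matrix.mul_assoc, Matrix.nonsing_inv_mul _ hu] }
  have he : confOne ω = (skewConf ω).comap (e : (Fin 3 → Fin 3 → K) →ₗ[K] _) := by
    ext ξ
    exact mem_confOne_iff hsymm hdet (Matrix.of ξ)
  rw [he, ← finrank_skewConf hsymm h0, ← LinearEquiv.finrank_map_eq e,
    Submodule.map_comap_eq_of_surjective e.surjective]

theorem finrank_fZero [CharZero K] {ω : Matrix (Fin 3) (Fin 3) K} (hsymm : ω.IsSymm)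
    (hdet : ω.det ≠ 0) : Module.finrank K (FZero ω) = 5 := by
  have := Submodule.finrank_quotient_add_finrank (confOne ω)
  rw [finrank_confOne hsymm hdet] at this
  simp only [Module.finrank_pi_fintype, Module.finrank_self, Finset.sum_const, Finset.card_univ,
    Fintype.card_fin, smul_eq_mul] at this
  unfold FZero
  omega

end SkewConf

/-! ## The Spencer complex in three variables -/

section Forms

variable {K : Type*} [Field K] {E : Type*} [AddCommGroup E] [Module K E]

/-- A form is determined by its components. -/
noncomputable def formsEquiv {n : ℕ} (s : ℕ) (g : Submodule K (Jet n E)) :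
    forms s g ≃ₗ[K] ({I : Finset (Fin n) // I.card = s} → g) where
  toFun v I := ⟨v.1 I.1, (v.2 I.1).1⟩
  map_add' _ _ := rfl
  map_smul' _ _ := rfl
  invFun w := ⟨fun I => if h : I.card = s then (w ⟨I, h⟩ : Jet n E) else 0, fun I => by
    by_cases h : I.card = s
    · simp [h]
    · simp [h]⟩
  left_inv v := by
    apply Subtype.ext
    funext I
    by_cases h : I.card = s
    · simp [h]
    · simp [h, (v.2 I).2 h]
  right_inv w := by
    funext I
    simp [I.2]

theorem finrank_forms {n : ℕ} (s : ℕ) (g : Submodule K (Jet n E)) [FiniteDimensional K g] :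
    Module.finrank K (forms s g) = n.choose s * Module.finrank K g := by
  rw [(formsEquiv s g).finrank_eq, Module.finrank_pi_fintype, Finset.sum_const,
    Finset.card_univ, smul_eq_mul, Fintype.card_finset_len, Fintype.card_fin]

instance {n : ℕ} (s : ℕ) (g : Submodule K (Jet n E)) [FiniteDimensional K g] :
    FiniteDimensional K (forms s g) :=
  Module.Finite.equiv (formsEquiv s g).symm

theorem finset_fin_three (I : Finset (Fin 3)) :
    I = ∅ ∨ I = {0} ∨ I = {1} ∨ I = {2} ∨ I = {0, 1} ∨ I = {0, 2} ∨ I = {1, 2} ∨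
      I = {0, 1, 2} := by
  revert I
  decide

variable (ω : Finset (Fin 3) → Jet 3 E)

theorem delta_apply (I : Finset (Fin 3)) (μ : Fin 3 →₀ ℕ) :
    delta K ω I μ = ∑ i ∈ I, (-1 : K) ^ (I.filter (fun j => j < i)).card •
      ω (I.erase i) (μ + Finsupp.single i 1) := rfl

theorem delta_empty : delta K ω ∅ = 0 := rfl

theorem delta_singleton (i : Fin 3) :
    delta K ω {i} = shift K (Finsupp.single i 1) (ω ∅) := by
  funext μ
  have : (Finset.filter (fun j => j < i) ({i} : Finset (Fin 3))) = ∅ := by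
    ext; simp +contextual
  simp [delta, shift_apply, this]

theorem delta_zero_one : delta K ω {0, 1} =
    shift K (Finsupp.single 0 1) (ω {1}) - shift K (Finsupp.single 1 1) (ω {0}) := by
  funext μ
  have h0 : (Finset.filter (fun j => j < 0) ({0, 1} : Finset (Fin 3))).card = 0 := by decide
  have h1 : (Finset.filter (fun j => j < 1) ({0, 1} : Finset (Fin 3))).card = 1 := by decide
  have e0 : ({0, 1} : Finset (Fin 3)).erase 0 = {1} := by decide
  have e1 : ({0, 1} : Finset (Fin 3)).erase 1 = {0} := by decide
  rw [delta_apply, Finset.sum_pair (by decide), h0, h1, e0, e1]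
  simp [shift_apply, sub_eq_add_neg]

theorem delta_zero_two : delta K ω {0, 2} =
    shift K (Finsupp.single 0 1) (ω {2}) - shift K (Finsupp.single 2 1) (ω {0}) := by
  funext μ
  have h0 : (Finset.filter (fun j => j < 0) ({0, 2} : Finset (Fin 3))).card = 0 := by decide
  have h1 : (Finset.filter (fun j => j < 2) ({0, 2} : Finset (Fin 3))).card = 1 := by decide
  have e0 : ({0, 2} : Finset (Fin 3)).erase 0 = {2} := by decide
  have e1 : ({0, 2} : Finset (Fin 3)).erase 2 = {0} := by decide
  rw [delta_apply, Finset.sum_pair (by decide), h0, h1, e0, e1]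
  simp [shift_apply, sub_eq_add_neg]

theorem delta_one_two : delta K ω {1, 2} =
    shift K (Finsupp.single 1 1) (ω {2}) - shift K (Finsupp.single 2 1) (ω {1}) := by
  funext μ
  have h0 : (Finset.filter (fun j => j < 1) ({1, 2} : Finset (Fin 3))).card = 0 := by decide
  have h1 : (Finset.filter (fun j => j < 2) ({1, 2} : Finset (Fin 3))).card = 1 := by decide
  have e0 : ({1, 2} : Finset (Fin 3)).erase 1 = {2} := by decide
  have e1 : ({1, 2} : Finset (Fin 3)).erase 2 = {1} := by decide
  rw [delta_apply, Finset.sum_pair (by decide), h0, h1, e0, e1]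
  simp [shift_apply, sub_eq_add_neg]

theorem delta_top : delta K ω {0, 1, 2} =
    shift K (Finsupp.single 0 1) (ω {1, 2}) - shift K (Finsupp.single 1 1) (ω {0, 2})
      + shift K (Finsupp.single 2 1) (ω {0, 1}) := by
  funext μ
  have h0 : (Finset.filter (fun j => j < 0) ({0, 1, 2} : Finset (Fin 3))).card = 0 := by decide
  have h1 : (Finset.filter (fun j => j < 1) ({0, 1, 2} : Finset (Fin 3))).card = 1 := by decide
  have h2 : (Finset.filter (fun j => j < 2) ({0, 1, 2} : Finset (Fin 3))).card = 2 := by decide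
  have e0 : ({0, 1, 2} : Finset (Fin 3)).erase 0 = {1, 2} := by decide
  have e1 : ({0, 1, 2} : Finset (Fin 3)).erase 1 = {0, 2} := by decide
  have e2 : ({0, 1, 2} : Finset (Fin 3)).erase 2 = {0, 1} := by decide
  rw [delta_apply, Finset.sum_insert (by decide), Finset.sum_pair (by decide), h0, h1, h2, e0, e1, e2]
  simp [shift_apply, sub_eq_add_neg, add_assoc]

/-- The `1`-form with components `u i`. -/
def oneForm (u : Fin 3 → Jet 3 E) : Finset (Fin 3) → Jet 3 E :=
  Pi.single {0} (u 0) + Pi.single {1} (u 1) + Pi.single {2} (u 2)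

theorem oneForm_mem {g : Submodule K (Jet 3 E)} {u : Fin 3 → Jet 3 E} (hu : ∀ i, u i ∈ g) :
    oneForm u ∈ forms 1 g := by
  intro I
  rcases finset_fin_three I with rfl | rfl | rfl | rfl | rfl | rfl | rfl | rfl <;>
    simp +decide [oneForm, hu, g.zero_mem]

theorem delta_oneForm (u : Fin 3 → Jet 3 E) (θ : Finset (Fin 3) → Jet 3 E)
    (hθ : ∀ I : Finset (Fin 3), I.card ≠ 2 → θ I = 0)
    (h12 : shift K (Finsupp.single 1 1) (u 2) - shift K (Finsupp.single 2 1) (u 1) = θ {1, 2})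
    (h02 : shift K (Finsupp.single 0 1) (u 2) - shift K (Finsupp.single 2 1) (u 0) = θ {0, 2})
    (h01 : shift K (Finsupp.single 0 1) (u 1) - shift K (Finsupp.single 1 1) (u 0) = θ {0, 1}) :
    delta K (oneForm u) = θ := by
  have e : ∀ i, oneForm u {i} = u i := by
    intro i
    fin_cases i <;> simp [oneForm]
  funext I
  rcases finset_fin_three I with rfl | rfl | rfl | rfl | rfl | rfl | rfl | rfl
  · rw [hθ _ (by decide), delta_empty]
  · rw [hθ _ (by decide), delta_singleton]
    simp [oneForm]
  · rw [hθ _ (by decide), delta_singleton]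
    simp [oneForm]
  · rw [hθ _ (by decide), delta_singleton]
    simp [oneForm]
  · rw [delta_zero_one, e, e, h01]
  · rw [delta_zero_two, e, e, h02]
  · rw [delta_one_two, e, e, h12]
  · rw [hθ _ (by decide), delta_top]
    simp +decide [oneForm]

/-- The `2`-form with components `a` on `dx^2 ∧ dx^3`, `b` on `dx^1 ∧ dx^3` and `c` on
`dx^1 ∧ dx^2`. -/
def twoForm (a b c : Jet 3 E) : Finset (Fin 3) → Jet 3 E :=
  Pi.single {1, 2} a + Pi.single {0, 2} b + Pi.single {0, 1} c

theorem twoForm_mem {g : Submodule K (Jet 3 E)} {a b c : Jet 3 E} (ha : a ∈ g) (hb : b ∈ g)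
    (hc : c ∈ g) : twoForm a b c ∈ forms 2 g := by
  intro I
  rcases finset_fin_three I with rfl | rfl | rfl | rfl | rfl | rfl | rfl | rfl <;>
    simp +decide [twoForm, ha, hb, hc, g.zero_mem]

theorem delta_twoForm (a b c : Jet 3 E) (θ : Finset (Fin 3) → Jet 3 E)
    (hθ : ∀ I : Finset (Fin 3), I.card ≠ 3 → θ I = 0)
    (h : shift K (Finsupp.single 0 1) a - shift K (Finsupp.single 1 1) b
      + shift K (Finsupp.single 2 1) c = θ {0, 1, 2}) :
    delta K (twoForm a b c) = θ := by
  funext I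
  rcases finset_fin_three I with rfl | rfl | rfl | rfl | rfl | rfl | rfl | rfl
  · rw [hθ _ (by decide), delta_empty]
  · rw [hθ _ (by decide), delta_singleton]
    simp +decide [twoForm]
  · rw [hθ _ (by decide), delta_singleton]
    simp +decide [twoForm]
  · rw [hθ _ (by decide), delta_singleton]
    simp +decide [twoForm]
  · rw [hθ _ (by decide), delta_zero_one]
    simp +decide [twoForm]
  · rw [hθ _ (by decide), delta_zero_two]
    simp +decide [twoForm]
  · rw [hθ _ (by decide), delta_one_two]
    simp +decide [twoForm]
  · rw [delta_top, ← h]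
    simp +decide [twoForm]

/-- The `0`-form `v`. -/
def zeroForm (v : Jet 3 E) : Finset (Fin 3) → Jet 3 E := Pi.single ∅ v

theorem zeroForm_mem {g : Submodule K (Jet 3 E)} {v : Jet 3 E} (hv : v ∈ g) :
    zeroForm v ∈ forms 0 g := by
  intro I
  by_cases h : I = ∅
  · simp [h, zeroForm, hv]
  · simp [h, zeroForm, g.zero_mem]

theorem delta_zeroForm (v : Jet 3 E) (θ : Finset (Fin 3) → Jet 3 E)
    (hθ : ∀ I : Finset (Fin 3), I.card ≠ 1 → θ I = 0)
    (h : ∀ i, shift K (Finsupp.single i 1) v = θ {i}) : delta K (zeroForm v) = θ := by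
  funext I
  rcases finset_fin_three I with rfl | rfl | rfl | rfl | rfl | rfl | rfl | rfl
  · rw [hθ _ (by decide), delta_empty]
  · rw [delta_singleton, ← h]
    simp [zeroForm]
  · rw [delta_singleton, ← h]
    simp [zeroForm]
  · rw [delta_singleton, ← h]
    simp [zeroForm]
  · rw [hθ _ (by decide), delta_zero_one]
    simp +decide [zeroForm]
  · rw [hθ _ (by decide), delta_zero_two]
    simp +decide [zeroForm]
  · rw [hθ _ (by decide), delta_one_two]
    simp +decide [zeroForm]
  · rw [hθ _ (by decide), delta_top]
    simp +decide [zeroForm]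

end Forms

end FormalPDE

namespace FormalPDE

/-! ## The symbols of the conformal Killing system in dimension three -/

section Conformal

variable {K : Type*} [Field K] (ω : Matrix (Fin 3) (Fin 3) K)

/-- The symbol map of the conformal Killing operator, on families of arbitrary degrees. -/
noncomputable def confMap : Jet 3 (Fin 3 → K) →ₗ[K] Jet 3 (FZero ω) where
  toFun v := fun ν => (confOne ω).mkQ (firstJet (K := K) ν v)
  map_add' v w := by
    funext ν
    simp
  map_smul' c v := by
    funext ν
    simp

variable {ω}

/-- The coefficients of the symbol equations do not depend on the multi-index. This commutation with
shifts is what carries the Poincaré lemmas from `T`-valued to `F̂_0`-valued families. -/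
theorem confMap_shift (ν : Fin 3 →₀ ℕ) (v : Jet 3 (Fin 3 → K)) :
    confMap ω (shift K ν v) = shift K ν (confMap ω v) := by
  funext μ
  change (confOne ω).mkQ _ = (confOne ω).mkQ _
  congr 1
  funext i
  change v _ = v _
  rw [add_right_comm]

theorem confMap_eq_zero_iff {v : Jet 3 (Fin 3 → K)} :
    confMap ω v = 0 ↔ ∀ ν, firstJet (K := K) ν v ∈ confOne ω := by
  rw [funext_iff]
  exact forall_congr' fun ν => Submodule.Quotient.mk_eq_zero _

theorem mem_confSymbol {q : ℕ} {v : Jet 3 (Fin 3 → K)} :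
    v ∈ confSymbol ω q ↔ v ∈ Sym K 3 q (Fin 3 → K) ∧ confMap ω v = 0 := by
  rw [confMap_eq_zero_iff]
  rfl

theorem mem_confImage {q : ℕ} {u : Jet 3 (FZero ω)} :
    u ∈ confImage ω q ↔ ∃ v ∈ Sym K 3 (q + 1) (Fin 3 → K), confMap ω v = u := by
  constructor
  · rintro ⟨_, ⟨v, rfl⟩, rfl⟩
    exact ⟨v.1, v.2, rfl⟩
  · rintro ⟨v, hv, rfl⟩
    exact ⟨_, ⟨⟨v, hv⟩, rfl⟩, rfl⟩

theorem confMap_mem_sym {q : ℕ} {v : Jet 3 (Fin 3 → K)} (hv : v ∈ Sym K 3 (q + 1) (Fin 3 → K)) :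
    confMap ω v ∈ Sym K 3 q (FZero ω) :=
  (symPhi ω q ⟨v, hv⟩).2

theorem confImage_le (q : ℕ) : confImage ω q ≤ Sym K 3 q (FZero ω) := by
  intro u hu
  obtain ⟨v, hv, rfl⟩ := mem_confImage.1 hu
  exact confMap_mem_sym hv

theorem shift_mem_confSymbol {q r : ℕ} {v : Jet 3 (Fin 3 → K)} (hv : v ∈ confSymbol ω (q + r))
    {ν : Fin 3 →₀ ℕ} (hν : ν.degree = r) : shift K ν v ∈ confSymbol ω q := by
  rw [mem_confSymbol] at hv ⊢
  exact ⟨shift_mem_sym hv.1 hν, by rw [confMap_shift, hv.2, map_zero]⟩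

/-- Every multi-index of length `q + r - 1` splits off a part of length `r`, so the equations in
degree `q + r` are shifts of those in degree `q`. In all other lengths the first jet is zero. -/
theorem prolong_confSymbol {q : ℕ} (hq : 1 ≤ q) (r : ℕ) :
    prolong q (confSymbol ω q) r = confSymbol ω (q + r) := by
  apply le_antisymm
  · rintro v ⟨hv, h⟩
    refine ⟨hv, fun ν => ?_⟩
    by_cases hν : ν.degree + 1 = q + r
    · obtain ⟨κ, τ, hτ, rfl⟩ := exists_eq_add_degree r ν (by omega)
      have := (h τ hτ).2 κ
      convert this using 1
      funext i
      change v _ = v _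
      rw [add_right_comm]
    · have : firstJet (K := K) ν v = 0 := by
        funext i
        exact hv _ (by simpa using hν)
      rw [this]
      exact Submodule.zero_mem _
  · intro v hv
    exact ⟨hv.1, fun ν hν => shift_mem_confSymbol hv hν⟩

variable [CharZero K] (hsymm : ω.IsSymm) (hdet : ω.det ≠ 0)
include hsymm hdet

/-- The shifts are commuting operators, and the unknowns with lowered index satisfy the hypothesis
of `conformal_third_prolongation`. Inverting `ω` recovers the original components. -/
theorem apply_eq_zero_of_confMap_eq_zero {v : Jet 3 (Fin 3 → K)} (hv : confMap ω v = 0)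
    {μ : Fin 3 →₀ ℕ} (hμ : 3 ≤ μ.degree) : v μ = 0 := by
  have hs : ∀ a b, ω a b = ω b a := fun a b => hsymm.apply b a
  have hu : IsUnit ω.det := isUnit_iff_ne_zero.2 hdet
  rw [confMap_eq_zero_iff] at hv
  have key := conformal_third_prolongation hsymm hdet
    (fun i => shift K (E := K) (Finsupp.single i 1))
    (fun i j m => by rw [shift_shift, shift_shift, add_comm])
    (fun j μ => ∑ r, ω r j * v μ r)
    (fun μ => 2 / ((3 : ℕ) : K) * ∑ r, v (μ + Finsupp.single r 1) r) (by
      intro i j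
      funext ν
      have := hv ν i j
      simp only [firstJet, LinearMap.coe_mk, AddHom.coe_mk] at this
      simp only [Pi.add_apply, shift_apply, Pi.smul_apply, smul_eq_mul, hs _ i] at this ⊢
      linear_combination this)
  obtain ⟨i, μ, rfl⟩ := exists_eq_add_single (show μ.degree ≠ 0 by omega)
  obtain ⟨k, μ, rfl⟩ := exists_eq_add_single (show μ.degree ≠ 0 by simp at hμ; omega)
  obtain ⟨l, μ, rfl⟩ := exists_eq_add_single (show μ.degree ≠ 0 by simp at hμ; omega)
  set w := v (μ + Finsupp.single l 1 + Finsupp.single k 1 + Finsupp.single i 1)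
  have h0 : Matrix.vecMul w ω = 0 := by
    funext j
    have := congrFun (key i j k l) μ
    simp only [shift_apply, Pi.zero_apply] at this
    rw [Pi.zero_apply, ← this]
    simp only [Matrix.vecMul, dotProduct, mul_comm (ω _ _), w]
  have := congrArg (fun u => Matrix.vecMul u ω⁻¹) h0
  simpa [Matrix.vecMul_vecMul, Matrix.mul_nonsing_inv _ hu] using this

theorem eq_zero_of_confMap_eq_zero {q : ℕ} (hq : 3 ≤ q) {v : Jet 3 (Fin 3 → K)}
    (hv : v ∈ Sym K 3 q (Fin 3 → K)) (h : confMap ω v = 0) : v = 0 := by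
  funext μ
  by_cases hμ : μ.degree = q
  · exact apply_eq_zero_of_confMap_eq_zero hsymm hdet h (by omega)
  · exact hv μ hμ

theorem confSymbol_eq_bot {q : ℕ} (hq : 3 ≤ q) : confSymbol ω q = ⊥ := by
  rw [eq_bot_iff]
  intro v hv
  rw [mem_confSymbol] at hv
  exact eq_zero_of_confMap_eq_zero hsymm hdet hq hv.1 hv.2

theorem symPhi_injective {q : ℕ} (hq : 2 ≤ q) : Function.Injective (symPhi ω q) := by
  rw [← LinearMap.ker_eq_bot, LinearMap.ker_eq_bot']
  rintro ⟨v, hv⟩ h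
  exact Subtype.ext (eq_zero_of_confMap_eq_zero hsymm hdet (by omega) hv (congrArg Subtype.val h))

omit [CharZero K] hsymm hdet in
theorem finrank_sym_vec (q : ℕ) :
    Module.finrank K (Sym K 3 q (Fin 3 → K)) = (q + 2).choose q * 3 := by
  rw [finrank_sym, Module.finrank_fin_fun, show 3 + q - 1 = q + 2 by omega]

theorem finrank_sym_fZero (q : ℕ) :
    Module.finrank K (Sym K 3 q (FZero ω)) = (q + 2).choose q * 5 := by
  rw [finrank_sym, finrank_fZero hsymm hdet, show 3 + q - 1 = q + 2 by omega]

/-- The two spaces have dimensions 10 · 3 and 6 · 5, so the injectivity coming from `ĝ_3 = 0` is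
enough. -/
theorem symPhi_two_surjective : Function.Surjective (symPhi ω 2) := by
  refine (LinearMap.injective_iff_surjective_of_finrank_eq_finrank ?_).1
    (symPhi_injective hsymm hdet le_rfl)
  rw [finrank_sym_vec, finrank_sym_fZero hsymm hdet]
  decide

theorem exists_confMap_eq {u : Jet 3 (FZero ω)} (hu : u ∈ Sym K 3 2 (FZero ω)) :
    ∃ v ∈ Sym K 3 3 (Fin 3 → K), confMap ω v = u := by
  obtain ⟨v, hv⟩ := symPhi_two_surjective hsymm hdet ⟨u, hu⟩
  exact ⟨v.1, v.2, congrArg Subtype.val hv⟩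

/-- Integrate the right-hand side in one variable, solve one degree higher, and shift the solution
back. -/
theorem exists_confMap_eq' {u : Jet 3 (FZero ω)} (hu : u ∈ Sym K 3 1 (FZero ω)) :
    ∃ v ∈ Sym K 3 2 (Fin 3 → K), confMap ω v = u := by
  obtain ⟨w, hw, rfl, -⟩ := exists_shift_eq (K := K) 0 u hu
  obtain ⟨v, hv, rfl⟩ := exists_confMap_eq hsymm hdet hw
  exact ⟨_, shift_single_mem_sym hv 0, confMap_shift _ _⟩

theorem exists_confMap_eq'' {u : Jet 3 (FZero ω)} (hu : u ∈ Sym K 3 0 (FZero ω)) :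
    ∃ v ∈ Sym K 3 1 (Fin 3 → K), confMap ω v = u := by
  obtain ⟨w, hw, rfl, -⟩ := exists_shift_eq (K := K) 0 u hu
  obtain ⟨v, hv, rfl⟩ := exists_confMap_eq' hsymm hdet hw
  exact ⟨_, shift_single_mem_sym hv 0, confMap_shift _ _⟩

omit [CharZero K] hsymm hdet in
theorem finrank_confSymbol_add (q : ℕ) (h : Function.Surjective (symPhi ω q)) :
    Module.finrank K (Sym K 3 q (FZero ω)) + Module.finrank K (confSymbol ω (q + 1)) =
      Module.finrank K (Sym K 3 (q + 1) (Fin 3 → K)) := by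
  have e : confSymbol ω (q + 1) = (LinearMap.ker (symPhi ω q)).map (Submodule.subtype _) := by
    ext v
    rw [mem_confSymbol]
    constructor
    · rintro ⟨hv, h⟩
      exact ⟨⟨v, hv⟩, Subtype.ext h, rfl⟩
    · rintro ⟨w, hw, rfl⟩
      exact ⟨w.2, congrArg Subtype.val hw⟩
  have := LinearMap.finrank_range_add_finrank_ker (symPhi ω q)
  rwa [LinearMap.range_eq_top.2 h, finrank_top, ← Submodule.finrank_map_subtype_eq, ← e] at this

theorem finrank_confSymbol_one : Module.finrank K (confSymbol ω 1) = 4 := by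
  have := finrank_confSymbol_add (ω := ω) 0 fun u => by
    obtain ⟨v, hv, h⟩ := exists_confMap_eq'' hsymm hdet u.2
    exact ⟨⟨v, hv⟩, Subtype.ext h⟩
  rw [finrank_sym_vec, finrank_sym_fZero hsymm hdet] at this
  simp [Nat.choose] at this
  omega

theorem finrank_confSymbol_two : Module.finrank K (confSymbol ω 2) = 3 := by
  have := finrank_confSymbol_add (ω := ω) 1 fun u => by
    obtain ⟨v, hv, h⟩ := exists_confMap_eq' hsymm hdet u.2
    exact ⟨⟨v, hv⟩, Subtype.ext h⟩
  rw [finrank_sym_vec, finrank_sym_fZero hsymm hdet] at this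
  simp [Nat.choose] at this
  omega

omit [CharZero K] hsymm hdet in
instance (q : ℕ) : FiniteDimensional K (confSymbol ω q) :=
  Module.Finite.of_injective (Submodule.inclusion (show confSymbol ω q ≤ Sym K 3 q _ from
    fun _ hv => hv.1)) (Submodule.inclusion_injective _)

/-- For surjectivity, first find a 2-form `w` with values in `S_2 T* ⊗ T` and the prescribed `δ`.
Its image in `F̂_0`-valued forms is closed, hence `δ` of a 1-form, which lifts along the isomorphism
`S_3 T* ⊗ T ≃ S_2 T* ⊗ F̂_0`. Subtracting `δ` of the lift moves `w` into `ĝ_2` without changing its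
own `δ`. -/
theorem map_delta_forms_two :
    (forms 2 (confSymbol ω 2)).map (delta K) = forms 3 (confSymbol ω 1) := by
  apply le_antisymm
  · rintro _ ⟨θ, hθ, rfl⟩ I
    have hsh : ∀ I i, shift K (Finsupp.single i 1) (θ I) ∈ confSymbol ω 1 := fun I i =>
      shift_mem_confSymbol (r := 1) (hθ I).1 (by simp)
    have h0 : ∀ I : Finset (Fin 3), I.card ≠ 2 → θ I = 0 := fun I h => (hθ I).2 h
    rcases finset_fin_three I with rfl | rfl | rfl | rfl | rfl | rfl | rfl | rfl
    · simp [delta_empty]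
    · simp [delta_singleton, h0 ∅ (by decide)]
    · simp [delta_singleton, h0 ∅ (by decide)]
    · simp [delta_singleton, h0 ∅ (by decide)]
    · simp [delta_zero_one, h0]
    · simp [delta_zero_two, h0]
    · simp [delta_one_two, h0]
    · rw [delta_top]
      refine ⟨Submodule.add_mem _ (Submodule.sub_mem _ (hsh _ _) (hsh _ _)) (hsh _ _),
        fun h => absurd (by decide) h⟩
  · intro θ hθ
    have hζ := mem_confSymbol.1 (hθ {0, 1, 2}).1
    -- The 2-form with the single component `w` on `dx^1 ∧ dx^2` has the required image.
    obtain ⟨w, hw, hs, -⟩ := exists_shift_eq (K := K) 2 _ hζ.1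
    obtain ⟨u, hu, h12, h02, h01⟩ := exists_shift_sub_shift_eq (K := K) 0 0 (confMap ω w)
      (Submodule.zero_mem _) (Submodule.zero_mem _) (confMap_mem_sym hw)
      (by rw [← confMap_shift, hs, hζ.2]; simp)
    choose e he heu using fun i => exists_confMap_eq hsymm hdet (hu i)
    simp only [← heu, ← confMap_shift, ← map_sub] at h12 h02 h01
    have hm : ∀ i j, shift K (Finsupp.single i 1) (e j) ∈ Sym K 3 2 (Fin 3 → K) := fun i j =>
      shift_single_mem_sym (he j) i
    refine ⟨twoForm (shift K (Finsupp.single 2 1) (e 1) - shift K (Finsupp.single 1 1) (e 2))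
      (shift K (Finsupp.single 2 1) (e 0) - shift K (Finsupp.single 0 1) (e 2))
      (w - (shift K (Finsupp.single 0 1) (e 1) - shift K (Finsupp.single 1 1) (e 0))),
      twoForm_mem ?_ ?_ ?_, delta_twoForm _ _ _ _ (fun I h => (hθ I).2 h) ?_⟩
    · refine mem_confSymbol.2 ⟨Submodule.sub_mem _ (hm _ _) (hm _ _), ?_⟩
      rw [← neg_eq_zero, ← map_neg, neg_sub, h12]
    · refine mem_confSymbol.2 ⟨Submodule.sub_mem _ (hm _ _) (hm _ _), ?_⟩
      rw [← neg_eq_zero, ← map_neg, neg_sub, h02]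
    · refine mem_confSymbol.2 ⟨Submodule.sub_mem _ hw
        (Submodule.sub_mem _ (hm _ _) (hm _ _)), ?_⟩
      rw [map_sub, h01, sub_self]
    · simp only [map_sub, shift_shift, hs]
      rw [add_comm (Finsupp.single 0 1) (Finsupp.single 1 1),
        add_comm (Finsupp.single 0 1) (Finsupp.single 2 1),
        add_comm (Finsupp.single 1 1) (Finsupp.single 2 1)]
      abel

theorem finrank_cocycles : Module.finrank K
    ↥(forms 2 (confSymbol ω 2) ⊓ LinearMap.ker (delta K (n := 3) (E := Fin 3 → K))) = 5 := by
  have h := LinearMap.finrank_range_add_finrank_ker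
    ((delta K (n := 3) (E := Fin 3 → K)).domRestrict (forms 2 (confSymbol ω 2)))
  rw [LinearMap.range_domRestrict, map_delta_forms_two hsymm hdet, finrank_forms, finrank_forms,
    finrank_confSymbol_one hsymm hdet, finrank_confSymbol_two hsymm hdet,
    LinearMap.ker_domRestrict, ← Submodule.finrank_map_subtype_eq,
    Submodule.map_comap_subtype] at h
  simp [Nat.choose] at h
  omega

/-- The cocycles in `∧² T* ⊗ ĝ_2` have dimension 5, but `ĝ_3 = 0` leaves only the zero coboundary.
For `q = 1` the obstruction sits at the first prolongation, whence the choice `r = 2 - q`. -/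
theorem not_isAcyclic {q : ℕ} (h1 : 1 ≤ q) (h2 : q ≤ 2) :
    ¬ IsAcyclic q (confSymbol ω q) 2 := by
  intro h
  have hne : forms 2 (confSymbol ω 2) ⊓ LinearMap.ker (delta K) ≠ ⊥ := by
    intro h0
    have := finrank_cocycles hsymm hdet
    rw [h0, finrank_bot] at this
    omega
  obtain ⟨θ, hθ, hne⟩ := Submodule.exists_mem_ne_zero_of_ne_bot hne
  obtain ⟨η, hη, e⟩ := h 2 (by omega) le_rfl (2 - q) θ
    (by rw [prolong_confSymbol h1, Nat.add_sub_cancel' h2]; exact hθ.1) hθ.2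
  have h0 : η = 0 := by
    funext I
    have := (hη I).1
    rw [prolong_confSymbol h1, confSymbol_eq_bot hsymm hdet (by omega)] at this
    simpa using this
  exact hne (by rw [← e, h0, map_zero])

theorem isAcyclic_three : IsAcyclic 3 (confSymbol ω 3) 2 := by
  intro t _ _ r θ hθ _
  refine ⟨0, Submodule.zero_mem _, ?_⟩
  rw [map_zero]
  funext I
  have := (hθ I).1
  rw [prolong_confSymbol (by omega), confSymbol_eq_bot hsymm hdet (by omega)] at this
  simpa using this.symm

theorem isLeast_acyclic :
    IsLeast {s : ℕ | IsAcyclic (1 + s) (confSymbol ω (1 + s)) 2} 2 := by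
  refine ⟨isAcyclic_three hsymm hdet, fun s hs => ?_⟩
  by_contra h
  exact not_isAcyclic hsymm hdet (by omega) (by omega) hs

/-! ## The image symbols -/

/-- Preimages of the derivatives of `u` satisfy the closedness condition because their mixed shifts
lie in degree `q ≥ 3`, where the symbol map is injective. The Poincaré lemma then glues them into a
preimage of `u`. -/
theorem mem_confImage_succ {q : ℕ} (hq : 3 ≤ q) {u : Jet 3 (FZero ω)}
    (hu : u ∈ Sym K 3 (q + 1) (FZero ω))
    (h : ∀ i, shift K (Finsupp.single i 1) u ∈ confImage ω q) : u ∈ confImage ω (q + 1) := by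
  choose w hw e using fun i => mem_confImage.1 (h i)
  obtain ⟨v, hv, hs⟩ := exists_shift_eq_of_closed (K := K) w hw fun i j => by
    have hm : ∀ i j, shift K (Finsupp.single i 1) (w j) ∈ Sym K 3 q (Fin 3 → K) := fun i j =>
      shift_single_mem_sym (hw j) i
    rw [← sub_eq_zero]
    refine eq_zero_of_confMap_eq_zero hsymm hdet hq (Submodule.sub_mem _ (hm i j) (hm j i)) ?_
    rw [map_sub, confMap_shift, confMap_shift, e, e, shift_shift, shift_shift, add_comm, sub_self]
  refine mem_confImage.2 ⟨v, hv, eq_of_shift_eq (confMap_mem_sym hv) hu fun i => ?_⟩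
  rw [← confMap_shift, hs, e]

theorem prolong_confImage (r : ℕ) : prolong 3 (confImage ω 3) r = confImage ω (3 + r) := by
  apply le_antisymm
  · induction r with
    | zero =>
      rintro u ⟨-, h⟩
      simpa [shift] using h 0 (by simp)
    | succ r ih =>
      rintro u ⟨hu, h⟩
      refine mem_confImage_succ hsymm hdet (q := 3 + r) (by omega) hu fun i => ih
        ⟨shift_single_mem_sym (q := 3 + r) hu i, fun ν hν => ?_⟩
      rw [shift_shift]
      exact h _ (by simp [hν])
  · intro u hu
    obtain ⟨v, hv, rfl⟩ := mem_confImage.1 hu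
    refine ⟨confImage_le _ hu, fun ν hν => mem_confImage.2 ⟨shift K ν v, ?_, confMap_shift _ _⟩⟩
    exact shift_mem_sym (by convert hv using 2; omega) hν

/-- Lift the components of a cocycle to `T`-valued families. The lift is again a cocycle, since its
`δ` lies in degree `3 + r`, where the symbol map has no kernel; so the Poincaré lemma gives a
primitive, and its image is a primitive of the given cocycle. -/
theorem isAcyclic_confImage : IsAcyclic 3 (confImage ω 3) 2 := by
  intro t ht1 ht2 r θ hθ h
  rw [prolong_confImage hsymm hdet] at hθ ⊢
  have h0 : ∀ I : Finset (Fin 3), I.card ≠ t → θ I = 0 := fun I h => (hθ I).2 h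
  choose w hw e using fun I => mem_confImage.1 (hθ I).1
  have hm : ∀ i I, shift K (Finsupp.single i 1) (w I) ∈ Sym K 3 (3 + r) (Fin 3 → K) :=
    fun i I => shift_single_mem_sym (hw I) i
  obtain rfl | rfl : t = 1 ∨ t = 2 := by omega
  · have hc : ∀ i j, i < j → shift K (Finsupp.single i 1) (θ {j}) =
        shift K (Finsupp.single j 1) (θ {i}) := by
      have h01 := congrFun h {0, 1}
      have h02 := congrFun h {0, 2}
      have h12 := congrFun h {1, 2}
      rw [delta_zero_one] at h01
      rw [delta_zero_two] at h02
      rw [delta_one_two] at h12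
      intro i j hij
      fin_cases i <;> fin_cases j <;> first | exact absurd hij (by decide) | skip
      · exact sub_eq_zero.1 h01
      · exact sub_eq_zero.1 h02
      · exact sub_eq_zero.1 h12
    have hc' : ∀ i j, shift K (Finsupp.single i 1) (θ {j}) =
        shift K (Finsupp.single j 1) (θ {i}) := by
      intro i j
      rcases lt_trichotomy i j with hij | rfl | hij
      · exact hc i j hij
      · rfl
      · exact (hc j i hij).symm
    obtain ⟨v, hv, hs⟩ := exists_shift_eq_of_closed (K := K) (fun i => w {i}) (fun i => hw _)
      fun i j => by
        rw [← sub_eq_zero]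
        refine eq_zero_of_confMap_eq_zero hsymm hdet (q := 3 + r) (by omega)
          (Submodule.sub_mem _ (hm i _) (hm j _)) ?_
        rw [map_sub, confMap_shift, confMap_shift, e, e, hc', sub_self]
    refine ⟨zeroForm (confMap ω v), zeroForm_mem ?_, delta_zeroForm _ _ h0 fun i => ?_⟩
    · exact mem_confImage.2 ⟨v, hv, rfl⟩
    · rw [← confMap_shift, hs, e]
  · have hc := congrFun h {0, 1, 2}
    rw [delta_top] at hc
    obtain ⟨u, hu, h12, h02, h01⟩ := exists_shift_sub_shift_eq (K := K) (w {1, 2}) (w {0, 2})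
      (w {0, 1}) (hw _) (hw _) (hw _) (by
        refine eq_zero_of_confMap_eq_zero hsymm hdet (q := 3 + r) (by omega)
          (Submodule.add_mem _ (Submodule.sub_mem _ (hm _ _) (hm _ _)) (hm _ _)) ?_
        rw [map_add, map_sub, confMap_shift, confMap_shift, confMap_shift, e, e, e]
        exact hc)
    refine ⟨oneForm fun i => confMap ω (u i), oneForm_mem fun i => ?_,
      delta_oneForm _ _ h0 ?_ ?_ ?_⟩
    · exact mem_confImage.2 ⟨u i, hu i, rfl⟩
    · rw [← confMap_shift, ← confMap_shift, ← map_sub, h12, e]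
    · rw [← confMap_shift, ← confMap_shift, ← map_sub, h02, e]
    · rw [← confMap_shift, ← confMap_shift, ← map_sub, h01, e]

/-! ## The cokernels -/

/-- By injectivity the dimension is 10 · 5 - 15 · 3. -/
theorem finrank_fOne : Module.finrank K (FOne ω) = 5 := by
  have h1 := Submodule.finrank_quotient_add_finrank (LinearMap.range (symPhi ω 3))
  rw [LinearMap.finrank_range_of_inj (symPhi_injective hsymm hdet (by omega)), finrank_sym_vec,
    finrank_sym_fZero hsymm hdet] at h1
  simp [Nat.choose] at h1
  unfold FOne
  omega

theorem exact_symPhi_symPsi : Function.Exact (symPhi ω 4) (symPsi ω) := by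
  rintro ⟨u, hu⟩
  have key : symPsi ω ⟨u, hu⟩ = 0 ↔
      ∀ i, shift K (Finsupp.single i 1) u ∈ confImage ω 3 := by
    rw [funext_iff]
    refine forall_congr' fun i => (Submodule.Quotient.mk_eq_zero _).trans ?_
    rw [mem_confImage]
    constructor
    · rintro ⟨v, hv⟩
      exact ⟨v.1, v.2, congrArg Subtype.val hv⟩
    · rintro ⟨v, hv, e⟩
      exact ⟨⟨v, hv⟩, Subtype.ext e⟩
  rw [key]
  constructor
  · intro h
    obtain ⟨v, hv, e⟩ := mem_confImage.1 (mem_confImage_succ hsymm hdet le_rfl hu h)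
    exact ⟨⟨v, hv⟩, Subtype.ext e⟩
  · rintro ⟨v, hv⟩ i
    have e : confMap ω v.1 = u := congrArg Subtype.val hv
    exact mem_confImage.2 ⟨_, shift_single_mem_sym v.2 i, by rw [confMap_shift, e]⟩

/-- Exactness gives `symPsi` the rank 15 · 5 - 21 · 3 = 12, inside a space of dimension 3 · 5. -/
theorem finrank_fTwo : Module.finrank K (FTwo ω) = 3 := by
  have h1 := Submodule.finrank_quotient_add_finrank (LinearMap.range (symPsi ω))
  have h2 := LinearMap.finrank_range_add_finrank_ker (symPsi ω)
  rw [(exact_symPhi_symPsi hsymm hdet).linearMap_ker_eq,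
    LinearMap.finrank_range_of_inj (symPhi_injective hsymm hdet (by omega)), finrank_sym_vec,
    finrank_sym_fZero hsymm hdet] at h2
  rw [Module.finrank_pi_fintype] at h1
  simp only [finrank_fOne hsymm hdet] at h1
  simp [Nat.choose] at h1 h2
  unfold FTwo
  omega

theorem finrank_forms_three : Module.finrank K (forms 3 (confSymbol ω 2)) = 3 := by
  rw [finrank_forms, finrank_confSymbol_two hsymm hdet]
  rfl

end Conformal

end FormalPDE

namespace FormalPDE

open MvPolynomial

/-! ## Rows of homogeneous polynomials -/

section Rows

variable {K : Type*} [Field K] {n m p : ℕ}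

/-- The rows of homogeneous polynomials of degree `d`. -/
noncomputable def homRow (K : Type*) [Field K] (n m d : ℕ) : Submodule K (Row K n m) :=
  Submodule.pi Set.univ fun _ => homogeneousSubmodule (Fin n) K d

theorem mem_homRow {d : ℕ} {v : Row K n m} : v ∈ homRow K n m d ↔ ∀ k, (v k).IsHomogeneous d := by
  simp [homRow]

/-- The homogeneous component of degree `d` of a row. -/
noncomputable def lead (d : ℕ) : Row K n m →ₗ[K] Row K n m :=
  (homogeneousComponent d).compLeft (Fin m)

theorem lead_apply (d : ℕ) (v : Row K n m) (k : Fin m) :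
    lead d v k = homogeneousComponent d (v k) := rfl

theorem lead_mem (d : ℕ) (v : Row K n m) : lead d v ∈ homRow K n m d :=
  mem_homRow.2 fun k => homogeneousComponent_isHomogeneous d (v k)

theorem lead_of_mem {d : ℕ} {v : Row K n m} (hv : v ∈ homRow K n m d) : lead d v = v :=
  funext fun k => homogeneousComponent_eq_self (mem_homRow.1 hv k)

theorem homogeneousComponent_mul_of_isHomogeneous {s : MvPolynomial (Fin n) K} {e : ℕ}
    (hs : s.IsHomogeneous e) (q : MvPolynomial (Fin n) K) (r : ℕ) :
    homogeneousComponent (r + e) (q * s) = homogeneousComponent r q * s := by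
  conv_lhs => rw [← sum_homogeneousComponent q]
  rw [Finset.sum_mul, map_sum]
  have h : ∀ i, homogeneousComponent (r + e) (homogeneousComponent i q * s) =
      if i = r then homogeneousComponent i q * s else 0 := fun i => by
    rw [homogeneousComponent_of_mem ((homogeneousComponent_isHomogeneous i q).mul hs)]
    simp only [add_left_inj, eq_comm]
  simp only [h, Finset.sum_ite_eq']
  split_ifs with hr
  · rfl
  · rw [homogeneousComponent_eq_zero r q (by simpa using hr), zero_mul]

theorem X_smul_mem {d : ℕ} {v : Row K n m} (hv : v ∈ homRow K n m d) (i : Fin n) :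
    (X i : MvPolynomial (Fin n) K) • v ∈ homRow K n m (d + 1) :=
  mem_homRow.2 fun k => by
    rw [add_comm]
    exact (isHomogeneous_X K i).mul (mem_homRow.1 hv k)

theorem lead_X_smul (d : ℕ) (v : Row K n m) (i : Fin n) :
    lead (d + 1) ((X i : MvPolynomial (Fin n) K) • v) =
      (X i : MvPolynomial (Fin n) K) • lead d v := by
  funext k
  change homogeneousComponent _ (X i * v k) = X i * homogeneousComponent _ (v k)
  rw [mul_comm, homogeneousComponent_mul_of_isHomogeneous (isHomogeneous_X K i), mul_comm]

/-- The map on rows given by a matrix of polynomials. -/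
noncomputable def symMul (s : Fin p → Row K n m) :
    Row K n p →ₗ[MvPolynomial (Fin n) K] Row K n m :=
  Fintype.linearCombination _ s

theorem symMul_apply (s : Fin p → Row K n m) (q : Row K n p) : symMul s q = ∑ a, q a • s a :=
  rfl

theorem lead_symMul {s : Fin p → Row K n m} {e : ℕ} (hs : ∀ a, s a ∈ homRow K n m e) (r : ℕ)
    (q : Row K n p) : lead (r + e) (symMul s q) = symMul s (lead r q) := by
  rw [symMul_apply, symMul_apply, map_sum]
  refine Finset.sum_congr rfl fun a _ => funext fun k => ?_
  exact homogeneousComponent_mul_of_isHomogeneous (mem_homRow.1 (hs a) k) _ _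

theorem symMul_mem {s : Fin p → Row K n m} {e : ℕ} (hs : ∀ a, s a ∈ homRow K n m e) {r : ℕ}
    {q : Row K n p} (hq : q ∈ homRow K n p r) : symMul s q ∈ homRow K n m (r + e) := by
  rw [← lead_of_mem hq, ← lead_symMul hs]
  exact lead_mem _ _

theorem exists_homRow_of_symMul_eq {s : Fin p → Row K n m} {e : ℕ}
    (hs : ∀ a, s a ∈ homRow K n m e) {r : ℕ} {v : Row K n m} (hv : v ∈ homRow K n m (r + e))
    (h : v ∈ LinearMap.range (symMul s)) : ∃ q ∈ homRow K n p r, symMul s q = v := by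
  obtain ⟨q, rfl⟩ := h
  exact ⟨lead r q, lead_mem _ _, by rw [← lead_symMul hs, lead_of_mem hv]⟩

theorem exists_sum_X_mul {d : ℕ} {f : MvPolynomial (Fin n) K} (hf : f.IsHomogeneous (d + 1)) :
    ∃ g : Fin n → MvPolynomial (Fin n) K, (∀ i, (g i).IsHomogeneous d) ∧ f = ∑ i, X i * g i := by
  classical
  rw [f.as_sum]
  refine Finset.sum_induction _ (fun f => ∃ g : Fin n → MvPolynomial (Fin n) K,
    (∀ i, (g i).IsHomogeneous d) ∧ f = ∑ i, X i * g i) ?_ ?_ ?_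
  · rintro _ _ ⟨g, hg, rfl⟩ ⟨g', hg', rfl⟩
    refine ⟨g + g', fun i => (hg i).add (hg' i), ?_⟩
    rw [← Finset.sum_add_distrib]
    exact Finset.sum_congr rfl fun i _ => (mul_add _ _ _).symm
  · exact ⟨0, fun i => isHomogeneous_zero _ _ _, by simp⟩
  · intro μ hμ
    have hd : μ.degree = d + 1 := by
      by_contra h
      exact mem_support_iff.1 hμ (hf.coeff_eq_zero h)
    obtain ⟨i, ν, rfl⟩ := exists_eq_add_single (show μ.degree ≠ 0 by omega)
    refine ⟨Pi.single i (monomial ν (coeff (ν + Finsupp.single i 1) f)), fun j => ?_, ?_⟩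
    · rw [Pi.single_apply]
      split_ifs
      · exact isHomogeneous_monomial _ (by simpa using hd)
      · exact isHomogeneous_zero _ _ _
    · rw [Finset.sum_eq_single i]
      · rw [Pi.single_eq_same, mul_comm, X, monomial_mul, mul_one]
      · intro j _ hj
        rw [Pi.single_eq_of_ne hj, mul_zero]
      · simp

theorem exists_sum_X_smul {d : ℕ} {v : Row K n m} (hv : v ∈ homRow K n m (d + 1)) :
    ∃ y : Fin n → Row K n m, (∀ i, y i ∈ homRow K n m d) ∧
      v = ∑ i, (X i : MvPolynomial (Fin n) K) • y i := by
  choose g hg e using fun k => exists_sum_X_mul (mem_homRow.1 hv k)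
  refine ⟨fun i k => g k i, fun i => mem_homRow.2 fun k => hg k i, funext fun k => ?_⟩
  rw [e k, Finset.sum_apply]
  rfl

/-! ## The Koszul complex in three variables -/

theorem not_X_dvd_X {i j : Fin n} (h : i ≠ j) :
    ¬ (X i : MvPolynomial (Fin n) K) ∣ X j := by
  rw [X_dvd_X]
  exact h

theorem X_mul_modMonomial_of_ne {i j : Fin n} (h : i ≠ j) (f : MvPolynomial (Fin n) K) :
    (X i * modMonomial f (Finsupp.single j 1)) = modMonomial (X i * f) (Finsupp.single j 1) := by
  classical
  ext μ
  by_cases hj : Finsupp.single j 1 ≤ μ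
  · rw [coeff_modMonomial_of_le _ hj, coeff_X_mul']
    split_ifs with hi
    · refine coeff_modMonomial_of_le _ ?_
      rw [Finsupp.single_le_iff] at hj ⊢
      simpa [Finsupp.single_apply, h] using hj
    · rfl
  · rw [coeff_modMonomial_of_not_le _ hj, coeff_X_mul', coeff_X_mul']
    split_ifs with hi
    · refine coeff_modMonomial_of_not_le _ fun hj' => hj ?_
      exact hj'.trans tsub_le_self
    · rfl

/-- Reducing modulo the last variable removes `h` and leaves a two-term relation between the
remainders `f'` and `g'`, which is solved by primality of `X 1`. The quotients of `f` and `g` by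
that variable supply `b` and `c`. -/
theorem koszul_one {f g h : MvPolynomial (Fin 3) K} (e : X 0 * f + X 1 * g + X 2 * h = 0) :
    ∃ a b c, f = X 1 * a + X 2 * b ∧ g = -(X 0 * a) + X 2 * c ∧ h = -(X 0 * b) - X 1 * c := by
  set f' := modMonomial f (Finsupp.single 2 1)
  set g' := modMonomial g (Finsupp.single 2 1)
  set b := divMonomial f (Finsupp.single 2 1)
  set c := divMonomial g (Finsupp.single 2 1)
  have hf : f = X 2 * b + f' := (divMonomial_add_modMonomial_single f 2).symm
  have hg : g = X 2 * c + g' := (divMonomial_add_modMonomial_single g 2).symm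
  have h0 : X 0 * f' + X 1 * g' = 0 := by
    have hadd : ∀ u v : MvPolynomial (Fin 3) K, modMonomial (u + v) (Finsupp.single 2 1) =
        modMonomial u (Finsupp.single 2 1) + modMonomial v (Finsupp.single 2 1) := by
      intro u v
      ext μ
      by_cases hj : Finsupp.single 2 1 ≤ μ
      · simp [coeff_modMonomial_of_le _ hj]
      · simp [coeff_modMonomial_of_not_le _ hj]
    rw [X_mul_modMonomial_of_ne (by decide), X_mul_modMonomial_of_ne (by decide), ← hadd]
    rw [← X_dvd_iff_modMonomial_eq_zero]
    exact ⟨-h, by linear_combination e⟩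
  obtain ⟨a, ha⟩ : X 1 ∣ f' := by
    have h1 : (X 1 : MvPolynomial (Fin 3) K) ∣ X 0 * f' := ⟨-g', by linear_combination h0⟩
    exact (X_prime.dvd_or_dvd h1).resolve_left (not_X_dvd_X (by decide))
  have hg' : g' = -(X 0 * a) := by
    have : X 1 * (g' + X 0 * a) = 0 := by
      rw [ha] at h0
      linear_combination h0
    have := (mul_eq_zero.1 this).resolve_left (X_ne_zero 1)
    linear_combination this
  refine ⟨a, b, c, by rw [hf, ha]; ring, by rw [hg, hg']; ring, ?_⟩
  have : X 2 * (h + X 0 * b + X 1 * c) = 0 := by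
    rw [hf, hg] at e
    linear_combination e - h0
  have := (mul_eq_zero.1 this).resolve_left (X_ne_zero 2)
  linear_combination this

theorem koszul_two {a b c : MvPolynomial (Fin 3) K} (h1 : X 1 * a + X 2 * b = 0)
    (h2 : -(X 0 * a) + X 2 * c = 0) : ∃ f, a = X 2 * f ∧ b = -(X 1 * f) ∧ c = X 0 * f := by
  obtain ⟨f, rfl⟩ : X 2 ∣ a := by
    have h : (X 2 : MvPolynomial (Fin 3) K) ∣ X 1 * a := ⟨-b, by linear_combination h1⟩
    exact (X_prime.dvd_or_dvd h).resolve_left (not_X_dvd_X (by decide))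
  refine ⟨f, rfl, ?_, ?_⟩
  · have : X 2 * (b + X 1 * f) = 0 := by linear_combination h1
    have := (mul_eq_zero.1 this).resolve_left (X_ne_zero 2)
    linear_combination this
  · have : X 2 * (c - X 0 * f) = 0 := by linear_combination h2
    have := (mul_eq_zero.1 this).resolve_left (X_ne_zero 2)
    linear_combination this

local notation "x₀" => (X 0 : MvPolynomial (Fin 3) K)
local notation "x₁" => (X 1 : MvPolynomial (Fin 3) K)
local notation "x₂" => (X 2 : MvPolynomial (Fin 3) K)

/-- Witnesses found entry by entry need not be homogeneous; their components of degree `d` satisfy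
the same relations because multiplication by a variable shifts components by one. -/
theorem koszul_one_row {d : ℕ} {y : Fin 3 → Row K 3 m} (hy : ∀ i, y i ∈ homRow K 3 m (d + 1))
    (e : ∑ i, (X i : MvPolynomial (Fin 3) K) • y i = 0) :
    ∃ a ∈ homRow K 3 m d, ∃ b ∈ homRow K 3 m d, ∃ c ∈ homRow K 3 m d,
      y 0 = x₁ • a + x₂ • b ∧ y 1 = -(x₀ • a) + x₂ • c ∧ y 2 = -(x₀ • b) - x₁ • c := by
  have e' : ∀ k, X 0 * y 0 k + X 1 * y 1 k + X 2 * y 2 k = 0 := fun k => by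
    have := congrFun e k
    rw [Fin.sum_univ_three] at this
    exact this
  choose a b c h0 h1 h2 using fun k => koszul_one (e' k)
  refine ⟨lead d a, lead_mem _ _, lead d b, lead_mem _ _, lead d c, lead_mem _ _, ?_, ?_, ?_⟩
  · rw [← lead_X_smul, ← lead_X_smul, ← map_add, ← lead_of_mem (hy 0)]
    exact congrArg _ (funext h0)
  · rw [← lead_X_smul, ← lead_X_smul, ← map_neg, ← map_add, ← lead_of_mem (hy 1)]
    exact congrArg _ (funext h1)
  · rw [← lead_X_smul, ← lead_X_smul, ← map_neg, ← map_sub, ← lead_of_mem (hy 2)]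
    exact congrArg _ (funext h2)

theorem koszul_two_row {d : ℕ} {a b c : Row K 3 m} (ha : a ∈ homRow K 3 m (d + 1))
    (hb : b ∈ homRow K 3 m (d + 1)) (hc : c ∈ homRow K 3 m (d + 1))
    (h1 : x₁ • a + x₂ • b = 0) (h2 : -(x₀ • a) + x₂ • c = 0) :
    ∃ f ∈ homRow K 3 m d, a = x₂ • f ∧ b = -(x₁ • f) ∧ c = x₀ • f := by
  choose f e0 e1 e2 using fun k => koszul_two (congrFun h1 k) (congrFun h2 k)
  refine ⟨lead d f, lead_mem _ _, ?_, ?_, ?_⟩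
  · rw [← lead_X_smul, ← lead_of_mem ha]
    exact congrArg _ (funext e0)
  · rw [← lead_X_smul, ← map_neg, ← lead_of_mem hb]
    exact congrArg _ (funext e1)
  · rw [← lead_X_smul, ← lead_of_mem hc]
    exact congrArg _ (funext e2)

variable {l : ℕ}

/-- If `s` is onto in high degrees, its syzygies are generated in low degrees. -/
theorem exists_syzygy_sum {s : Fin p → Row K 3 m} {e d : ℕ} (hs : ∀ a, s a ∈ homRow K 3 m e)
    (hsurj : ∀ v ∈ homRow K 3 m (d + e), ∃ q ∈ homRow K 3 p d, symMul s q = v)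
    {z : Row K 3 p} (hz : z ∈ homRow K 3 p (d + 2)) (h : symMul s z = 0) :
    ∃ y : Fin 3 → Row K 3 p, (∀ i, y i ∈ homRow K 3 p (d + 1)) ∧ (∀ i, symMul s (y i) = 0) ∧
      z = ∑ i, (X i : MvPolynomial (Fin 3) K) • y i := by
  obtain ⟨y, hy, rfl⟩ := exists_sum_X_smul (d := d + 1) hz
  have hy' : ∀ i, symMul s (y i) ∈ homRow K 3 m (d + e + 1) := fun i => by
    rw [add_right_comm]
    exact symMul_mem hs (hy i)
  rw [map_sum] at h
  simp only [map_smul] at h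
  -- The images of the `y i` form a Koszul cycle, hence a boundary. Lifting `a`, `b`, `c` through
  -- `s` and subtracting the boundary of the lifts turns each `y i` into a syzygy, while the sum `∑
  -- X_i y_i` is unchanged.
  obtain ⟨a, ha, b, hb, c, hc, h0, h1, h2⟩ := koszul_one_row hy' h
  obtain ⟨a, ha', rfl⟩ := hsurj a ha
  obtain ⟨b, hb', rfl⟩ := hsurj b hb
  obtain ⟨c, hc', rfl⟩ := hsurj c hc
  refine ⟨![y 0 - (x₁ • a + x₂ • b), y 1 - (-(x₀ • a) + x₂ • c), y 2 - (-(x₀ • b) - x₁ • c)],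
    fun i => ?_, fun i => ?_, ?_⟩
  · fin_cases i
    · exact Submodule.sub_mem _ (hy 0) (Submodule.add_mem _ (X_smul_mem ha' 1) (X_smul_mem hb' 2))
    · exact Submodule.sub_mem _ (hy 1)
        (Submodule.add_mem _ (Submodule.neg_mem _ (X_smul_mem ha' 0)) (X_smul_mem hc' 2))
    · exact Submodule.sub_mem _ (hy 2)
        (Submodule.sub_mem _ (Submodule.neg_mem _ (X_smul_mem hb' 0)) (X_smul_mem hc' 1))
  · fin_cases i
    · simp [h0]
    · simp [h1]
    · simp [h2]
  · simp only [Fin.sum_univ_three, Matrix.cons_val]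
    module

/-- If `s` is onto in high degrees, and `w` generates the syzygies of `s` in high degrees, the
syzygies of `w` are generated in low degrees. -/
theorem exists_second_syzygy_sum {s : Fin p → Row K 3 m} {w : Fin l → Row K 3 p} {e f d : ℕ}
    (hs : ∀ a, s a ∈ homRow K 3 m e) (hw : ∀ a, w a ∈ homRow K 3 p (f + 1))
    (hsurj : ∀ v ∈ homRow K 3 m (d + f + e), ∃ q ∈ homRow K 3 p (d + f), symMul s q = v)
    (hsw : ∀ q, symMul s (symMul w q) = 0)
    (hexact : ∀ z ∈ homRow K 3 p (d + (f + 1)), symMul s z = 0 →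
      ∃ q ∈ homRow K 3 l d, symMul w q = z)
    {z : Row K 3 l} (hz : z ∈ homRow K 3 l (d + 2)) (h : symMul w z = 0) :
    ∃ y : Fin 3 → Row K 3 l, (∀ i, y i ∈ homRow K 3 l (d + 1)) ∧ (∀ i, symMul w (y i) = 0) ∧
      z = ∑ i, (X i : MvPolynomial (Fin 3) K) • y i := by
  obtain ⟨y, hy, rfl⟩ := exists_sum_X_smul (d := d + 1) hz
  have hy' : ∀ i, symMul w (y i) ∈ homRow K 3 p (d + (f + 1) + 1) := fun i => by
    rw [add_right_comm]
    exact symMul_mem hw (hy i)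
  rw [map_sum] at h
  simp only [map_smul] at h
  obtain ⟨a, ha, b, hb, c, hc, h0, h1, h2⟩ := koszul_one_row hy' h
  have hsa : ∀ {u : Row K 3 p}, u ∈ homRow K 3 p (d + (f + 1)) →
      symMul s u ∈ homRow K 3 m (d + f + e + 1) := fun hu => by
    have := symMul_mem hs hu
    convert this using 1
    ring_nf
  -- Here `a`, `b`, `c` need not be syzygies of `s`, so they cannot be lifted through `w` directly.
  -- Their images under `s` form a Koszul cycle one step further on; lifting its primitive `g` and
  -- subtracting its boundary makes them syzygies.
  obtain ⟨g, hg, ea, eb, ec⟩ := koszul_two_row (hsa ha) (hsa hb) (hsa hc)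
    (by rw [← map_smul, ← map_smul, ← map_add, ← h0, hsw])
    (by rw [← map_smul, ← map_smul, ← map_neg, ← map_add, ← h1, hsw])
  obtain ⟨g, hg', rfl⟩ := hsurj g hg
  obtain ⟨a', ha', ea'⟩ := hexact (a - x₂ • g) (Submodule.sub_mem _ ha (X_smul_mem hg' 2))
    (by rw [map_sub, map_smul, ea, sub_self])
  obtain ⟨b', hb', eb'⟩ := hexact (b + x₁ • g) (Submodule.add_mem _ hb (X_smul_mem hg' 1))
    (by rw [map_add, map_smul, eb, neg_add_cancel])
  obtain ⟨c', hc', ec'⟩ := hexact (c - x₀ • g) (Submodule.sub_mem _ hc (X_smul_mem hg' 0))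
    (by rw [map_sub, map_smul, ec, sub_self])
  rw [eq_sub_iff_add_eq] at ea' ec'
  rw [← sub_eq_iff_eq_add] at eb'
  refine ⟨![y 0 - (x₁ • a' + x₂ • b'), y 1 - (-(x₀ • a') + x₂ • c'),
    y 2 - (-(x₀ • b') - x₁ • c')], fun i => ?_, fun i => ?_, ?_⟩
  · fin_cases i
    · exact Submodule.sub_mem _ (hy 0) (Submodule.add_mem _ (X_smul_mem ha' 1) (X_smul_mem hb' 2))
    · exact Submodule.sub_mem _ (hy 1)
        (Submodule.add_mem _ (Submodule.neg_mem _ (X_smul_mem ha' 0)) (X_smul_mem hc' 2))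
    · exact Submodule.sub_mem _ (hy 2)
        (Submodule.sub_mem _ (Submodule.neg_mem _ (X_smul_mem hb' 0)) (X_smul_mem hc' 1))
  · fin_cases i
    · simp [h0, ← ea', ← eb']
      module
    · simp [h1, ← ea', ← ec']
      module
    · simp [h2, ← eb', ← ec']
      module
  · simp only [Fin.sum_univ_three, Matrix.cons_val]
    module

/-! ## Dimensions -/

instance (d : ℕ) : FiniteDimensional K (homogeneousSubmodule (Fin n) K d) :=
  Module.Finite.of_fg (homogeneousSubmodule_fg (Fin n) K d)

theorem finrank_homogeneousSubmodule (d : ℕ) :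
    Module.finrank K (homogeneousSubmodule (Fin n) K d) = (n + d - 1).choose d := by
  rw [homogeneousSubmodule_eq_finsupp_supported, ← card_deg]
  exact Module.finrank_eq_card_basis (basisRestrictSupport K {μ : Fin n →₀ ℕ | μ.degree = d})

/-- The rows with entries in a space of polynomials. -/
noncomputable def piEquiv (V : Submodule K (MvPolynomial (Fin n) K)) :
    (Submodule.pi Set.univ fun _ : Fin m => V : Submodule K (Row K n m)) ≃ₗ[K] (Fin m → V) where
  toFun v k := ⟨v.1 k, v.2 k trivial⟩
  map_add' _ _ := rfl
  map_smul' _ _ := rfl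
  invFun w := ⟨fun k => w k, fun k _ => (w k).2⟩
  left_inv _ := rfl
  right_inv _ := rfl

instance (d : ℕ) : FiniteDimensional K (homRow K n m d) :=
  Module.Finite.equiv (piEquiv _).symm

theorem finrank_homRow (d : ℕ) :
    Module.finrank K (homRow K n m d) = m * (n + d - 1).choose d := by
  rw [homRow, (piEquiv _).finrank_eq, Module.finrank_pi_fintype]
  simp [finrank_homogeneousSubmodule]

instance (r : ℕ) : FiniteDimensional K (ordLE K n m r) :=
  Module.Finite.equiv (piEquiv _).symm

theorem finrank_restrictTotalDegree (r : ℕ) :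
    Module.finrank K (restrictTotalDegree (Fin 3) K r) = (r + 3).choose 3 := by
  let e : {μ : Fin 3 →₀ ℕ // (μ.sum fun _ e => e) ≤ r} ≃ Σ q : Fin (r + 1), Deg 3 q :=
    { toFun := fun μ => ⟨⟨μ.1.degree, Nat.lt_succ_of_le μ.2⟩, ⟨μ.1, rfl⟩⟩
      invFun := fun x => ⟨x.2.1, x.2.2.le.trans (Nat.le_of_lt_succ x.1.2)⟩
      left_inv := fun μ => rfl
      right_inv := by
        rintro ⟨⟨q, hq⟩, ⟨μ, hμ⟩⟩
        change μ.degree = q at hμ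
        subst hμ
        rfl }
  rw [restrictTotalDegree, Module.finrank_eq_nat_card_basis
    (basisRestrictSupport K {μ : Fin 3 →₀ ℕ | (μ.sum fun _ e => e) ≤ r})]
  refine (Nat.card_congr e).trans ?_
  simp only [Nat.card_eq_fintype_card, Fintype.card_sigma, card_deg]
  rw [Fin.sum_univ_eq_sum_range (fun q => (3 + q - 1).choose q) (r + 1)]
  clear e
  induction r with
  | zero => rfl
  | succ r ih =>
    rw [Finset.sum_range_succ, ih, show 3 + (r + 1) - 1 = r + 3 by omega,
      show r + 1 + 3 = r + 3 + 1 by omega, Nat.choose_succ_succ' (r + 3) 2,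
      Nat.choose_symm_of_eq_add (show r + 3 = r + 1 + 2 by omega), add_comm]

theorem finrank_ordLE (r : ℕ) :
    Module.finrank K (ordLE K 3 m r) = m * (r + 3).choose 3 := by
  rw [ordLE, (piEquiv _).finrank_eq, Module.finrank_pi_fintype]
  simp [finrank_restrictTotalDegree]

/-! ## The symbol of the conformal Killing operator -/

/-- The symbols of the conformal Killing equations. -/
noncomputable def confLead (ω : Matrix (Fin 3) (Fin 3) K) (i j : Fin 3) : Row K 3 3 := fun r =>
  C (ω r j) * X i + C (ω i r) * X j - C (2 / 3 * ω i j) * X r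

variable [CharZero K] {ω : Matrix (Fin 3) (Fin 3) K} (hsymm : ω.IsSymm) (hdet : ω.det ≠ 0)
  {s : Fin p → Row K 3 3} (hs : ∀ a, s a ∈ homRow K 3 3 1)
  (hω : ∀ i j, confLead ω i j ∈ LinearMap.range (symMul s))
include hsymm hdet hω

/-- The prolongation argument is applied in the quotient by the symbol module, with the variables as
commuting operators and the classes of the columns of `ω` as unknowns. These columns span all rows
since `ω` is invertible. -/
theorem X_mul_X_mul_X_smul_mem (i k l : Fin 3) (v : Row K 3 3) :
    (X l : MvPolynomial (Fin 3) K) • (X k : MvPolynomial (Fin 3) K) •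
      (X i : MvPolynomial (Fin 3) K) • v ∈ LinearMap.range (symMul s) := by
  have hu : IsUnit ω.det := isUnit_iff_ne_zero.2 hdet
  have hsy : ∀ a b, ω a b = ω b a := fun a b => hsymm.apply b a
  set N := LinearMap.range (symMul s)
  have key := conformal_third_prolongation hsymm hdet (M := Row K 3 3 ⧸ N)
    (fun i => (LinearMap.lsmul (MvPolynomial (Fin 3) K) (Row K 3 3 ⧸ N) (X i)).restrictScalars K)
    (fun i j m => smul_comm (X i : MvPolynomial (Fin 3) K) (X j : MvPolynomial (Fin 3) K) m)
    (fun j => N.mkQ fun r => C (ω r j)) ((2 / 3 : K) • N.mkQ fun r => X r) (by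
      intro i j
      have h := (Submodule.Quotient.mk_eq_zero N).2 (hω i j)
      rw [← sub_eq_zero, ← h]
      have e : confLead ω i j = (X i : MvPolynomial (Fin 3) K) • (fun r => C (ω r j)) +
          (X j : MvPolynomial (Fin 3) K) • (fun r => C (ω r i)) -
          (ω i j) • (2 / 3 : K) • (fun r => X r) := by
        funext r
        simp only [confLead, Pi.sub_apply, Pi.add_apply, Pi.smul_apply, smul_eq_mul, hsy i r,
          smul_eq_C_mul, C_mul]
        ring
      rw [e]
      rfl)
  have hξ : ∀ j, (X l : MvPolynomial (Fin 3) K) • (X k : MvPolynomial (Fin 3) K) •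
      (X i : MvPolynomial (Fin 3) K) • (fun r => C (ω r j) : Row K 3 3) ∈ N := fun j =>
    (Submodule.Quotient.mk_eq_zero N).1 (key i j k l)
  have hv : v = ∑ j, (∑ a, v a * C (ω⁻¹ j a)) • (fun r => C (ω r j) : Row K 3 3) := by
    funext r
    have h1 : ∀ a, ∑ j, ω r j * ω⁻¹ j a = if r = a then 1 else 0 := fun a => by
      rw [← Matrix.mul_apply, Matrix.mul_nonsing_inv _ hu, Matrix.one_apply]
    rw [Finset.sum_apply]
    simp only [Pi.smul_apply, smul_eq_mul, Finset.sum_mul]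
    rw [Finset.sum_comm]
    have h2 : ∀ a, ∑ j, v a * C (ω⁻¹ j a) * C (ω r j) =
        v a * (C (if r = a then 1 else 0) : MvPolynomial (Fin 3) K) := fun a => by
      rw [← h1, map_sum, Finset.mul_sum]
      refine Finset.sum_congr rfl fun j _ => ?_
      rw [C_mul]
      ring
    simp only [h2]
    rw [Finset.sum_eq_single r (fun a _ ha => by simp [Ne.symm ha]) (by simp)]
    simp
  rw [hv]
  simp only [Finset.smul_sum]
  refine Submodule.sum_mem _ fun j _ => ?_
  rw [smul_comm (X i : MvPolynomial (Fin 3) K), smul_comm (X k : MvPolynomial (Fin 3) K),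
    smul_comm (X l : MvPolynomial (Fin 3) K)]
  exact N.smul_mem _ (hξ j)

include hs

/-- In degree at least 3, three variables can be factored out of every row. -/
theorem symMul_surjective {d : ℕ} (hd : 2 ≤ d) {v : Row K 3 3} (hv : v ∈ homRow K 3 3 (d + 1)) :
    ∃ q ∈ homRow K 3 p d, symMul s q = v := by
  refine exists_homRow_of_symMul_eq hs hv ?_
  obtain ⟨d, rfl⟩ := Nat.exists_eq_add_of_le' hd
  obtain ⟨y, hy, rfl⟩ := exists_sum_X_smul hv
  refine Submodule.sum_mem _ fun l _ => ?_
  obtain ⟨z, hz, e⟩ := exists_sum_X_smul (hy l)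
  rw [e, Finset.smul_sum]
  refine Submodule.sum_mem _ fun k _ => ?_
  obtain ⟨t, ht, e⟩ := exists_sum_X_smul (hz k)
  rw [e, Finset.smul_sum, Finset.smul_sum]
  exact Submodule.sum_mem _ fun i _ => X_mul_X_mul_X_smul_mem hsymm hdet hω i k l _

/-- Source and target have dimensions 5 · 6 and 3 · 10, so surjectivity suffices. -/
theorem symMul_injective_two (hp : p = 5) {v : Row K 3 p} (hv : v ∈ homRow K 3 p 2)
    (h : symMul s v = 0) : v = 0 := by
  let f : homRow K 3 p 2 →ₗ[K] homRow K 3 3 3 :=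
    ((symMul s).restrictScalars K).restrict fun v hv => symMul_mem hs hv
  have hf : Function.Surjective f := by
    rintro ⟨u, hu⟩
    obtain ⟨q, hq, e⟩ := symMul_surjective hsymm hdet hs hω le_rfl hu
    exact ⟨⟨q, hq⟩, Subtype.ext e⟩
  have hi : Function.Injective f := by
    refine (LinearMap.injective_iff_surjective_of_finrank_eq_finrank ?_).2 hf
    rw [finrank_homRow, finrank_homRow, hp]
    decide
  have h0 : f ⟨v, hv⟩ = 0 := Subtype.ext h
  rw [← map_zero f] at h0
  exact congrArg Subtype.val (hi h0)

theorem symMul_injective (hp : p = 5) {d : ℕ} (hd : d ≤ 2) {v : Row K 3 p}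
    (hv : v ∈ homRow K 3 p d) (h : symMul s v = 0) : v = 0 := by
  have hX : ∀ {u : Row K 3 p}, (X 0 : MvPolynomial (Fin 3) K) • u = 0 → u = 0 := fun hu =>
    (smul_eq_zero.1 hu).resolve_left (X_ne_zero 0)
  interval_cases d
  · refine hX (hX (symMul_injective_two hsymm hdet hs hω hp
      (X_smul_mem (X_smul_mem hv 0) 0) ?_))
    rw [map_smul, map_smul, h, smul_zero, smul_zero]
  · refine hX (symMul_injective_two hsymm hdet hs hω hp (X_smul_mem hv 0) ?_)
    rw [map_smul, h, smul_zero]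
  · exact symMul_injective_two hsymm hdet hs hω hp hv h

end Rows

end FormalPDE

namespace FormalPDE

open MvPolynomial

/-! ## Modules over the ring of differential operators -/

section Operators

variable {K : Type*} [Field K] {n m p : ℕ} {der : Fin n → Derivation ℤ K K}

theorem coeff_dLeft (i : Fin n) (P : MvPolynomial (Fin n) K) (ν : Fin n →₀ ℕ) :
    coeff ν (dLeft der i P) = coeff ν (X i * P) + der i (coeff ν P) := by
  classical
  rw [dLeft, coeff_add, coeff_sum]
  simp only [coeff_monomial, Finset.sum_ite_eq']
  split_ifs with h
  · rfl
  · rw [notMem_support_iff.1 h, map_zero]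

theorem dLeft_add (i : Fin n) (P Q : MvPolynomial (Fin n) K) :
    dLeft der i (P + Q) = dLeft der i P + dLeft der i Q := by
  ext ν
  simp only [coeff_dLeft, mul_add, coeff_add, map_add]
  abel

theorem dLeft_smul (i : Fin n) (a : K) (P : MvPolynomial (Fin n) K) :
    dLeft der i (a • P) = der i a • P + a • dLeft der i P := by
  ext ν
  simp only [coeff_dLeft, mul_smul_comm, coeff_add, coeff_smul, smul_eq_mul, Derivation.leibniz]
  ring

theorem coeff_X_mul_dLeft (i j : Fin n) (P : MvPolynomial (Fin n) K) (ν : Fin n →₀ ℕ) :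
    coeff ν (X i * dLeft der j P) = coeff ν (X i * (X j * P)) + der j (coeff ν (X i * P)) := by
  classical
  have e : ∀ Q : MvPolynomial (Fin n) K, coeff ν (X i * Q) = if i ∈ ν.support then
      coeff (ν - Finsupp.single i 1) Q else 0 := fun Q => coeff_X_mul' ν i Q
  simp only [e]
  split_ifs
  · exact coeff_dLeft _ _ _
  · simp

theorem dLeft_comm (hder : ∀ i j a, der i (der j a) = der j (der i a)) (i j : Fin n)
    (P : MvPolynomial (Fin n) K) : dLeft der i (dLeft der j P) = dLeft der j (dLeft der i P) := by
  ext ν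
  simp only [coeff_dLeft, coeff_X_mul_dLeft, map_add, hder i j]
  rw [mul_left_comm (X i)]
  abel

theorem dLeft_monomial (i : Fin n) (μ : Fin n →₀ ℕ) (c : K) : dLeft der i (monomial μ c) =
    monomial (μ + Finsupp.single i 1) c + monomial μ (der i c) := by
  classical
  ext ν
  rw [coeff_dLeft, X, monomial_mul, one_mul, coeff_add, add_comm μ]
  simp only [coeff_monomial]
  rw [apply_ite (der i), map_zero]

variable (der) in
/-- A `K`-vector space with commuting operators `∇_i` with `∇_i (a x) = a ∇_i x + (∂_i a) x`,
that is a left `D`-module. -/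
structure FlatConnection (M : Type*) [AddCommGroup M] [Module K M] where
  /-- The operators `∇_i`. -/
  nab : Fin n → M →+ M
  leibniz : ∀ i (a : K) (x : M), nab i (a • x) = der i a • x + a • nab i x
  flat : ∀ i j x, nab i (nab j x) = nab j (nab i x)

/-- `D^m` as a left `D`-module. -/
noncomputable def rowConnection (hder : ∀ i j a, der i (der j a) = der j (der i a)) (m : ℕ) :
    FlatConnection der (Row K n m) where
  nab i :=
    { toFun := fun v k => dLeft der i (v k)
      map_zero' := funext fun k => by
        simpa using dLeft_smul (der := der) i 0 (0 : MvPolynomial (Fin n) K)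
      map_add' := fun v w => funext fun k => dLeft_add i _ _ }
  leibniz i a v := funext fun k => dLeft_smul i a (v k)
  flat i j v := funext fun k => dLeft_comm hder i j (v k)

namespace FlatConnection

variable {M : Type*} [AddCommGroup M] [Module K M] (D : FlatConnection der M)

/-- The action of `d_μ`. -/
def pow (μ : Fin n →₀ ℕ) (x : M) : M :=
  (List.finRange n).foldr (fun i P => (D.nab i)^[μ i] P) x

theorem pow_zero (x : M) : D.pow 0 x = x := by
  have : ∀ l : List (Fin n), l.foldr (fun i P => (D.nab i)^[(0 : Fin n →₀ ℕ) i] P) x = x := by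
    intro l
    induction l with
    | nil => rfl
    | cons a l ih => rw [List.foldr_cons, ih]; rfl
  exact this _

/-- The power is an ordered product; flatness moves the extra `∇_i` to the front. -/
theorem pow_add_single (μ : Fin n →₀ ℕ) (i : Fin n) (x : M) :
    D.pow (μ + Finsupp.single i 1) x = D.nab i (D.pow μ x) := by
  classical
  have : ∀ l : List (Fin n), l.Nodup →
      l.foldr (fun j P => (D.nab j)^[(μ + Finsupp.single i 1 : Fin n →₀ ℕ) j] P) x =
        if i ∈ l then D.nab i (l.foldr (fun j P => (D.nab j)^[μ j] P) x)
        else l.foldr (fun j P => (D.nab j)^[μ j] P) x := by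
    intro l hl
    induction l with
    | nil => simp
    | cons a l ih =>
      rw [List.nodup_cons] at hl
      rw [List.foldr_cons, List.foldr_cons, ih hl.2]
      by_cases ha : i = a
      · subst ha
        rw [if_neg hl.1, if_pos List.mem_cons_self]
        simp [Function.iterate_succ_apply']
      · have e : (μ + Finsupp.single i 1 : Fin n →₀ ℕ) a = μ a := by simp [ha]
        rw [e]
        simp only [List.mem_cons, ha, false_or]
        split_ifs
        · exact ((show Function.Commute (D.nab i) (D.nab a) from
            fun y => D.flat i a y).iterate_right (μ a) _).symm
        · rfl
  refine (this _ (List.nodup_finRange n)).trans ?_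
  rw [if_pos (List.mem_finRange i)]
  rfl

/-- The action of a row of operators on a column of elements of `M`. -/
noncomputable def eval (x : Fin p → M) : Row K n p →ₗ[K] M :=
  ∑ a, ((MvPolynomial.basisMonomials (Fin n) K).constr K fun μ => D.pow μ (x a)) ∘ₗ
    LinearMap.proj a

theorem eval_single (x : Fin p → M) (a : Fin p) (μ : Fin n →₀ ℕ) (c : K) :
    D.eval x (Pi.single a (monomial μ c)) = c • D.pow μ (x a) := by
  rw [eval, LinearMap.sum_apply, Finset.sum_eq_single a]
  · have e : (monomial μ c : MvPolynomial (Fin n) K) = c • basisMonomials (Fin n) K μ := by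
      rw [coe_basisMonomials, smul_monomial, smul_eq_mul, mul_one]
    rw [LinearMap.comp_apply, LinearMap.proj_apply, Pi.single_eq_same, e, map_smul,
      Module.Basis.constr_basis]
  · intro b _ hb
    rw [LinearMap.comp_apply, LinearMap.proj_apply, Pi.single_eq_of_ne hb, map_zero]
  · simp

end FlatConnection

theorem row_eq_sum (Q : Row K n p) :
    Q = ∑ a, ∑ μ ∈ (Q a).support, Pi.single a (monomial μ (coeff μ (Q a))) := by
  classical
  funext b
  rw [Finset.sum_apply, Finset.sum_eq_single b]
  · rw [Finset.sum_apply]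
    simp only [Pi.single_eq_same]
    exact (Q b).as_sum
  · intro a _ ha
    rw [Finset.sum_apply]
    exact Finset.sum_eq_zero fun μ _ => Pi.single_eq_of_ne (Ne.symm ha) _
  · simp

/-- Coefficients range over all of `K`, since the maps compared are only additive: the operators
`∇_i` differentiate scalars. -/
theorem row_addHom_ext {M : Type*} [AddCommGroup M] (f g : Row K n p →+ M)
    (h : ∀ a μ c, f (Pi.single a (monomial μ c)) = g (Pi.single a (monomial μ c)))
    (Q : Row K n p) : f Q = g Q := by
  rw [row_eq_sum Q]
  simp only [map_sum, h]

variable (hder : ∀ i j a, der i (der j a) = der j (der i a))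

theorem dPow_eq (μ : Fin n →₀ ℕ) (v : Row K n m) :
    dPow der μ v = (rowConnection hder m).pow μ v := by
  funext k
  have hit : ∀ (i : Fin n) (N : ℕ) (w : Row K n m),
      ((rowConnection hder m).nab i)^[N] w k = (dLeft der i)^[N] (w k) := by
    intro i N
    induction N with
    | zero => exact fun w => rfl
    | succ N ih => exact fun w => ih _
  have : ∀ l : List (Fin n), l.foldr (fun i P => (dLeft der i)^[μ i] P) (v k) =
      l.foldr (fun i P => ((rowConnection hder m).nab i)^[μ i] P) v k := by
    intro l
    induction l with
    | nil => rfl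
    | cons a l ih => rw [List.foldr_cons, List.foldr_cons, hit, ih]
  exact this _

theorem rowMul_eq (S : Fin p → Row K n m) : rowMul der S = (rowConnection hder m).eval S := by
  simp only [rowMul, FlatConnection.eval, dPow_eq hder]

theorem rowMul_single (S : Fin p → Row K n m) (a : Fin p) (μ : Fin n →₀ ℕ) (c : K) :
    rowMul der S (Pi.single a (monomial μ c)) = c • (rowConnection hder m).pow μ (S a) := by
  rw [rowMul_eq hder, FlatConnection.eval_single]

section Eval

variable {M : Type*} [AddCommGroup M] [Module K M] (D : FlatConnection der M)

theorem nab_single (a : Fin p) (μ : Fin n →₀ ℕ) (c : K) (i : Fin n) :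
    (rowConnection hder p).nab i (Pi.single a (monomial μ c)) =
      Pi.single a (monomial (μ + Finsupp.single i 1) c) + Pi.single a (monomial μ (der i c)) := by
  funext b
  rw [Pi.add_apply]
  change dLeft der i _ = _
  by_cases hb : b = a
  · subst hb
    simp only [Pi.single_eq_same, dLeft_monomial]
  · simp only [Pi.single_eq_of_ne hb]
    simpa using dLeft_smul (der := der) i 0 (0 : MvPolynomial (Fin n) K)

/-- Evaluation is linear over `D`: the rule `d_i a = a d_i + ∂_i a` in `D` matches the Leibniz rule
of the connection. -/
theorem eval_nab (x : Fin p → M) (i : Fin n) (Q : Row K n p) :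
    D.eval x ((rowConnection hder p).nab i Q) = D.nab i (D.eval x Q) := by
  refine row_addHom_ext ((D.eval x).toAddMonoidHom.comp ((rowConnection hder p).nab i))
    ((D.nab i).comp (D.eval x).toAddMonoidHom) (fun a μ c => ?_) Q
  change D.eval x _ = D.nab i (D.eval x _)
  rw [nab_single, map_add, D.eval_single, D.eval_single, D.eval_single, D.leibniz,
    D.pow_add_single, add_comm]

theorem eval_pow (x : Fin p → M) (μ : Fin n →₀ ℕ) (Q : Row K n p) :
    D.eval x ((rowConnection hder p).pow μ Q) = D.pow μ (D.eval x Q) := by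
  induction h : μ.degree generalizing μ with
  | zero =>
    have : μ = 0 := (Finsupp.degree_eq_zero_iff μ).1 h
    rw [this, FlatConnection.pow_zero, FlatConnection.pow_zero]
  | succ d ih =>
    obtain ⟨i, ν, rfl⟩ := exists_eq_add_single (show μ.degree ≠ 0 by omega)
    rw [FlatConnection.pow_add_single, FlatConnection.pow_add_single, eval_nab,
      ih ν (by simpa using h)]

include hder in
theorem eval_rowMul (x : Fin m → M) (S : Fin p → Row K n m) (Q : Row K n p) :
    D.eval x (rowMul der S Q) = D.eval (fun a => D.eval x (S a)) Q := by
  refine row_addHom_ext ((D.eval x).toAddMonoidHom.comp (rowMul der S).toAddMonoidHom)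
    (D.eval fun a => D.eval x (S a)).toAddMonoidHom (fun a μ c => ?_) Q
  change D.eval x (rowMul der S _) = D.eval _ _
  rw [rowMul_single hder, map_smul, eval_pow, D.eval_single]

theorem eval_zero (Q : Row K n p) : D.eval (0 : Fin p → M) Q = 0 := by
  refine row_addHom_ext (D.eval (0 : Fin p → M)).toAddMonoidHom 0 (fun a μ c => ?_) Q
  change D.eval _ _ = 0
  have h0 : D.pow μ 0 = 0 := by
    induction h : μ.degree generalizing μ with
    | zero =>
      have : μ = 0 := (Finsupp.degree_eq_zero_iff μ).1 h
      rw [this, FlatConnection.pow_zero]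
    | succ d ih =>
      obtain ⟨i, ν, rfl⟩ := exists_eq_add_single (show μ.degree ≠ 0 by omega)
      rw [FlatConnection.pow_add_single, ih ν (by simpa using h), map_zero]
  rw [D.eval_single, Pi.zero_apply, h0, smul_zero]

include hder in
theorem eval_rowMul_eq_zero {x : Fin m → M} {S : Fin p → Row K n m}
    (h : ∀ a, D.eval x (S a) = 0) (Q : Row K n p) : D.eval x (rowMul der S Q) = 0 := by
  rw [eval_rowMul hder D, show (fun a => D.eval x (S a)) = 0 from funext h, eval_zero]

end Eval

include hder in
theorem rowMul_rowMul_eq_zero {l : ℕ} {S : Fin p → Row K n m} {S' : Fin l → Row K n p}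
    (h : ∀ a, rowMul der S (S' a) = 0) (Q : Row K n l) :
    rowMul der S (rowMul der S' Q) = 0 := by
  rw [rowMul_eq hder S] at h ⊢
  exact eval_rowMul_eq_zero hder _ h Q

/-! ## Orders and symbols -/

theorem mem_ordLE {r : ℕ} {v : Row K n m} :
    v ∈ ordLE K n m r ↔ ∀ k μ, r < μ.degree → coeff μ (v k) = 0 := by
  have : ∀ P : MvPolynomial (Fin n) K, P ∈ restrictTotalDegree (Fin n) K r ↔
      ∀ μ : Fin n →₀ ℕ, r < μ.degree → coeff μ P = 0 := by
    intro P
    rw [restrictTotalDegree, mem_restrictSupport_iff]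
    constructor
    · intro h μ hμ
      by_contra hc
      exact absurd (h (mem_support_iff.2 hc)) (not_le.2 hμ)
    · intro h μ hμ
      by_contra hc
      exact mem_support_iff.1 hμ (h μ (not_le.1 hc))
  simp only [ordLE, Submodule.mem_pi, Set.mem_univ, true_implies, this]

theorem ordLE_mono {r r' : ℕ} (h : r ≤ r') : ordLE K n m r ≤ ordLE K n m r' := fun _ hv =>
  mem_ordLE.2 fun k μ hμ => mem_ordLE.1 hv k μ (by omega)

theorem coeff_lead (d : ℕ) (v : Row K n m) (k : Fin m) (μ : Fin n →₀ ℕ) :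
    coeff μ (lead d v k) = if μ.degree = d then coeff μ (v k) else 0 := by
  rw [lead_apply, coeff_homogeneousComponent]

theorem mem_ordLE_of_lead_eq_zero {r : ℕ} {v : Row K n m} (hv : v ∈ ordLE K n m (r + 1))
    (h : lead (r + 1) v = 0) : v ∈ ordLE K n m r := by
  refine mem_ordLE.2 fun k μ hμ => ?_
  by_cases h' : μ.degree = r + 1
  · have := coeff_lead (r + 1) v k μ
    rw [if_pos h', h] at this
    exact this.symm
  · exact mem_ordLE.1 hv k μ (by omega)

theorem lead_eq_zero {r d : ℕ} (hd : r < d) {v : Row K n m} (hv : v ∈ ordLE K n m r) :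
    lead d v = 0 := by
  funext k
  ext μ
  rw [coeff_lead]
  split_ifs with h
  · exact mem_ordLE.1 hv k μ (by omega)
  · rfl

theorem homRow_le_ordLE (d : ℕ) : homRow K n m d ≤ ordLE K n m d := fun v hv =>
  mem_ordLE.2 fun k _ hμ => (mem_homRow.1 hv k).coeff_eq_zero (by omega)

theorem lead_eq_zero_iff_of_ordLE_zero {v : Row K n m} (hv : v ∈ ordLE K n m 0) :
    lead 0 v = v := by
  funext k
  ext μ
  rw [coeff_lead]
  split_ifs with h
  · rfl
  · exact (mem_ordLE.1 hv k μ (by omega)).symm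

theorem nab_mem_ordLE {r : ℕ} {v : Row K n m} (hv : v ∈ ordLE K n m r) (i : Fin n) :
    (rowConnection hder m).nab i v ∈ ordLE K n m (r + 1) := by
  classical
  refine mem_ordLE.2 fun k μ hμ => ?_
  have h1 := mem_ordLE.1 hv k μ (by omega)
  change coeff μ (dLeft der i (v k)) = 0
  rw [coeff_dLeft, h1, map_zero, add_zero, coeff_X_mul']
  split_ifs with h
  · obtain ⟨ν, rfl⟩ : ∃ ν, μ = ν + Finsupp.single i 1 :=
      ⟨μ - Finsupp.single i 1, (tsub_add_cancel_of_le (by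
        rw [Finsupp.single_le_iff]
        exact Nat.one_le_iff_ne_zero.2 (Finsupp.mem_support_iff.1 h))).symm⟩
    rw [add_tsub_cancel_right]
    exact mem_ordLE.1 hv k ν (by simpa using hμ)
  · rfl

/-- Differentiating coefficients does not raise the order, so only multiplication by the variable is
visible in top degree. -/
theorem lead_nab {r : ℕ} {v : Row K n m} (hv : v ∈ ordLE K n m r) (i : Fin n) :
    lead (r + 1) ((rowConnection hder m).nab i v) =
      (X i : MvPolynomial (Fin n) K) • lead r v := by
  rw [← lead_X_smul]
  funext k
  ext μ
  rw [coeff_lead, coeff_lead]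
  split_ifs with h
  · change coeff μ (dLeft der i (v k)) = coeff μ (X i * v k)
    rw [coeff_dLeft, mem_ordLE.1 hv k μ (by omega), map_zero, add_zero]
  · rfl

theorem lead_pow {e : ℕ} {v : Row K n m} (hv : v ∈ ordLE K n m e) (μ : Fin n →₀ ℕ) :
    (rowConnection hder m).pow μ v ∈ ordLE K n m (μ.degree + e) ∧
      lead (μ.degree + e) ((rowConnection hder m).pow μ v) =
        (monomial μ 1 : MvPolynomial (Fin n) K) • lead e v := by
  induction h : μ.degree generalizing μ with
  | zero =>
    have : μ = 0 := (Finsupp.degree_eq_zero_iff μ).1 h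
    subst this
    rw [FlatConnection.pow_zero, zero_add]
    exact ⟨hv, by simp⟩
  | succ d ih =>
    obtain ⟨i, ν, rfl⟩ := exists_eq_add_single (show μ.degree ≠ 0 by omega)
    obtain ⟨h1, h2⟩ := ih ν (by simpa using h)
    rw [FlatConnection.pow_add_single, add_right_comm, lead_nab hder h1, h2, smul_smul, X,
      monomial_mul, one_mul, add_comm (Finsupp.single i 1)]
    exact ⟨nab_mem_ordLE hder h1 i, rfl⟩

variable {S : Fin p → Row K n m} {e : ℕ} (hS : ∀ a, S a ∈ ordLE K n m e)
include hder hS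

/-- Commuting derivations past coefficients only creates terms of lower order. Hence composition of
operators becomes multiplication of symbols; it is enough to check this on monomial rows. -/
theorem rowMul_aux {r : ℕ} {Q : Row K n p} (hQ : Q ∈ ordLE K n p r) :
    rowMul der S Q ∈ ordLE K n m (r + e) ∧
      lead (r + e) (rowMul der S Q) = symMul (fun a => lead e (S a)) (lead r Q) := by
  have key : ∀ a, ∀ μ ∈ (Q a).support,
      rowMul der S (Pi.single a (monomial μ (coeff μ (Q a)))) ∈ ordLE K n m (r + e) ∧
        lead (r + e) (rowMul der S (Pi.single a (monomial μ (coeff μ (Q a))))) =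
          symMul (fun a => lead e (S a)) (lead r (Pi.single a (monomial μ (coeff μ (Q a))))) := by
    intro a μ hμ
    have hr : μ.degree ≤ r := by
      by_contra h
      exact mem_support_iff.1 hμ (mem_ordLE.1 hQ a μ (by omega))
    obtain ⟨h1, h2⟩ := lead_pow hder (hS a) μ
    rw [rowMul_single hder]
    refine ⟨Submodule.smul_mem _ _ (ordLE_mono (by omega) h1), ?_⟩
    have hl : lead r (Pi.single a (monomial μ (coeff μ (Q a))) : Row K n p) =
        if μ.degree = r then Pi.single a (monomial μ (coeff μ (Q a))) else 0 := by
      funext b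
      rw [lead_apply]
      by_cases hb : b = a
      · subst hb
        rw [Pi.single_eq_same, homogeneousComponent_of_mem (isHomogeneous_monomial _ rfl)]
        simp only [eq_comm (a := r)]
        split_ifs <;> simp
      · rw [Pi.single_eq_of_ne hb, map_zero]
        split_ifs
        · rw [Pi.single_eq_of_ne hb]
        · rfl
    rw [hl, map_smul]
    split_ifs with hd
    · subst hd
      rw [h2, symMul_apply, Finset.sum_eq_single a, Pi.single_eq_same]
      · rw [← smul_assoc, smul_monomial, smul_eq_mul, mul_one]
      · intro b _ hb
        rw [Pi.single_eq_of_ne hb, zero_smul]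
      · simp
    · rw [map_zero, lead_eq_zero (by omega) h1, smul_zero]
  rw [row_eq_sum Q]
  simp only [map_sum]
  exact ⟨Submodule.sum_mem _ fun a _ => Submodule.sum_mem _ fun μ hμ => (key a μ hμ).1,
    Finset.sum_congr rfl fun a _ => Finset.sum_congr rfl fun μ hμ => (key a μ hμ).2⟩

theorem rowMul_mem_ordLE {r : ℕ} {Q : Row K n p} (hQ : Q ∈ ordLE K n p r) :
    rowMul der S Q ∈ ordLE K n m (r + e) := (rowMul_aux hder hS hQ).1

theorem lead_rowMul {r : ℕ} {Q : Row K n p} (hQ : Q ∈ ordLE K n p r) :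
    lead (r + e) (rowMul der S Q) = symMul (fun a => lead e (S a)) (lead r Q) :=
  (rowMul_aux hder hS hQ).2

theorem symMul_lead_eq_zero {r : ℕ} {Q : Row K n p} (hQ : Q ∈ compat der S r) :
    symMul (fun a => lead e (S a)) (lead r Q) = 0 := by
  rw [← lead_rowMul hder hS hQ.2, LinearMap.mem_ker.1 hQ.1, map_zero]

/-- If the symbol of `S'` generates the syzygies of the symbol of `S` and there are no compatibility
conditions of order less than that of `S'`, then `S'` generates the compatibility conditions. -/
theorem generates_of_symbol {l f : ℕ} {S' : Fin l → Row K n p}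
    (hS' : ∀ a, S' a ∈ compat der S (f + 1)) (h0 : compat der S f = ⊥)
    (hex : ∀ r, ∀ z ∈ homRow K n p (r + (f + 1)), symMul (fun a => lead e (S a)) z = 0 →
      ∃ q ∈ homRow K n l r, symMul (fun a => lead (f + 1) (S' a)) q = z) :
    Generates der S' (f + 1) S := by
  have hS'o : ∀ a, S' a ∈ ordLE K n p (f + 1) := fun a => (hS' a).2
  have hSS : ∀ Q, rowMul der S (rowMul der S' Q) = 0 :=
    rowMul_rowMul_eq_zero hder fun a => LinearMap.mem_ker.1 (hS' a).1
  intro r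
  apply le_antisymm
  · rintro _ ⟨Q, hQ, rfl⟩
    exact ⟨LinearMap.mem_ker.2 (hSS Q), rowMul_mem_ordLE hder hS'o hQ⟩
  -- The leading part of a compatibility condition is a syzygy, hence is matched by the leading part
  -- of some `Q S'`; subtracting lowers the order by one. The descent ends at order `f`, where
  -- nothing is left.
  · have step : ∀ r, ∀ P ∈ compat der S (r + (f + 1)), ∃ Q ∈ ordLE K n l r,
        P - rowMul der S' Q ∈ compat der S (r + f) := by
      intro r P hP
      obtain ⟨q, hq, e'⟩ := hex r _ (lead_mem _ _) (symMul_lead_eq_zero hder hS hP)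
      refine ⟨q, homRow_le_ordLE _ hq, ?_, ?_⟩
      · refine LinearMap.mem_ker.2 ?_
        rw [map_sub, hSS, LinearMap.mem_ker.1 hP.1, sub_zero]
      · have hq' := rowMul_mem_ordLE hder hS'o (homRow_le_ordLE _ hq)
        refine mem_ordLE_of_lead_eq_zero (r := r + f) (Submodule.sub_mem _ hP.2 hq') ?_
        rw [map_sub]
        change lead (r + (f + 1)) P - lead (r + (f + 1)) _ = 0
        rw [lead_rowMul hder hS'o (homRow_le_ordLE _ hq), lead_of_mem hq, e', sub_self]
    induction r with
    | zero =>
      intro P hP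
      obtain ⟨Q, hQ, h⟩ := step 0 P hP
      rw [zero_add, h0, Submodule.mem_bot, sub_eq_zero] at h
      exact ⟨Q, hQ, h.symm⟩
    | succ r ih =>
      intro P hP
      obtain ⟨Q, hQ, h⟩ := step (r + 1) P hP
      obtain ⟨Q', hQ', e'⟩ := ih (by convert h using 2; omega)
      refine ⟨Q + Q', Submodule.add_mem _ hQ (ordLE_mono (by omega) hQ'), ?_⟩
      rw [map_add, e', add_sub_cancel]

end Operators

end FormalPDE

namespace FormalPDE

open MvPolynomial

/-! ## The flat connection of a metric of constant curvature -/

section Tractor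

variable {K : Type*} [Field K] {der : Fin 3 → Derivation ℤ K K} {g : Matrix (Fin 3) (Fin 3) K}

theorem christoffel_symm (hsymm : g.IsSymm) (k i j : Fin 3) :
    christoffel der g k i j = christoffel der g k j i := by
  have hs : ∀ a b, g a b = g b a := fun a b => hsymm.apply b a
  simp only [christoffel]
  congr 1
  refine Finset.sum_congr rfl fun r _ => ?_
  rw [hs r j, hs i r, hs i j]
  ring

theorem sum_mul_christoffel [CharZero K] (hdet : g.det ≠ 0) (m i j : Fin 3) :
    2 * ∑ k, g m k * christoffel der g k i j =
      der i (g m j) + der j (g i m) - der m (g i j) := by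
  have hu : IsUnit g.det := isUnit_iff_ne_zero.2 hdet
  have h1 : ∀ r, ∑ k, g m k * g⁻¹ k r = if m = r then 1 else 0 := fun r => by
    rw [← Matrix.mul_apply, Matrix.mul_nonsing_inv _ hu, Matrix.one_apply]
  have h2 : 2 * ∑ k, g m k * christoffel der g k i j =
      ∑ r, (∑ k, g m k * g⁻¹ k r) * (der i (g r j) + der j (g i r) - der r (g i j)) := by
    simp only [christoffel, Finset.mul_sum, Finset.sum_mul]
    rw [Finset.sum_comm]
    refine Finset.sum_congr rfl fun r _ => Finset.sum_congr rfl fun k _ => ?_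
    ring
  rw [h2]
  simp only [h1, ite_mul, one_mul, zero_mul, Finset.sum_ite_eq, Finset.mem_univ, if_true]

/-- The indices of a frame `f_1, f_2, f_3, f, h`. -/
abbrev TractorIndex : Type := Fin 3 ⊕ Fin 2

variable (der g) in
/-- The connection `∇_i f = f_i`, `∇_i f_j = γ^k_{ij} f_k + ω_{ij} h`, `∇_i h = - c f_i`. -/
noncomputable def tractorMatrix (c : K) (i : Fin 3) : Matrix TractorIndex TractorIndex K :=
  Matrix.fromBlocks (Matrix.of fun j k => christoffel der g k i j)
    (Matrix.of fun j a => if a = 0 then 0 else g i j)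
    (Matrix.of fun a k => if i = k then if a = 0 then 1 else -c else 0) 0

/-- Block by block, flatness means: the constant curvature equation on the `f_j`; the Levi-Civita
formula for `γ`, by which the derivatives of the metric match, in the `h`-component; symmetry of `γ`
together with constancy of `c` on `f` and `h`; and symmetry of the metric in the last block. -/
theorem tractorMatrix_flat [CharZero K] (hsymm : g.IsSymm) (hdet : g.det ≠ 0) {c : K}
    (hc : ∀ i, der i c = 0)
    (hR : ∀ k l i j, riemann der g k l i j = c * ((1 : Matrix (Fin 3) (Fin 3) K) k i * g l j
      - (1 : Matrix (Fin 3) (Fin 3) K) k j * g l i)) (i j : Fin 3) :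
    (tractorMatrix der g c j).map (der i) + tractorMatrix der g c j * tractorMatrix der g c i =
    (tractorMatrix der g c i).map (der j) + tractorMatrix der g c i * tractorMatrix der g c j := by
  have hs : ∀ a b, g a b = g b a := fun a b => hsymm.apply b a
  have hΓ := christoffel_symm (der := der) hsymm
  ext a b
  rcases a with l | a <;> rcases b with k | b
  · have h := hR k l i j
    simp only [riemann, Finset.sum_sub_distrib, Matrix.one_apply, hΓ _ l, hΓ k _ i, hΓ k _ j] at h
    simp only [tractorMatrix, Matrix.add_apply, Matrix.map_apply, Matrix.mul_apply,
      Fintype.sum_sum_type, Matrix.fromBlocks_apply₁₁, Matrix.fromBlocks_apply₁₂,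
      Matrix.fromBlocks_apply₂₁, Matrix.of_apply, Fin.sum_univ_two]
    simp only [hs l, eq_comm (a := k)] at h
    simp
    split_ifs at h ⊢ <;> linear_combination h
  · have h1 := sum_mul_christoffel (der := der) hdet i j l
    have h2 := sum_mul_christoffel (der := der) hdet j i l
    have e : ∀ i j, ∑ k, christoffel der g k j l * g i k =
        ∑ k, g i k * christoffel der g k j l := fun i j =>
      Finset.sum_congr rfl fun k _ => mul_comm _ _
    simp only [tractorMatrix, Matrix.add_apply, Matrix.map_apply, Matrix.mul_apply,
      Fintype.sum_sum_type, Matrix.fromBlocks_apply₁₁, Matrix.fromBlocks_apply₁₂,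
      Matrix.fromBlocks_apply₂₂, Matrix.of_apply]
    fin_cases b
    · simp
    · simp [e]
      rw [hs j i] at h1
      linear_combination (1 / 2 : K) * h1 - (1 / 2 : K) * h2
  · simp only [tractorMatrix, Matrix.add_apply, Matrix.map_apply, Matrix.mul_apply,
      Fintype.sum_sum_type, Matrix.fromBlocks_apply₁₁, Matrix.fromBlocks_apply₂₁,
      Matrix.fromBlocks_apply₂₂, Matrix.of_apply]
    fin_cases a <;> simp [apply_ite, hc, hΓ k i j]
  · simp only [tractorMatrix, Matrix.add_apply, Matrix.map_apply, Matrix.mul_apply,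
      Fintype.sum_sum_type, Matrix.fromBlocks_apply₁₂, Matrix.fromBlocks_apply₂₁,
      Matrix.fromBlocks_apply₂₂, Matrix.of_apply]
    fin_cases a <;> fin_cases b <;> simp [hs j i]

/-! ### The induced connection on bilinear forms -/

variable {ι : Type*} [Fintype ι] [DecidableEq ι]

omit [DecidableEq ι] in
theorem map_der_mul (d : Derivation ℤ K K) (A B : Matrix ι ι K) :
    (A * B).map d = A.map d * B + A * B.map d := by
  ext a b
  simp only [Matrix.map_apply, Matrix.mul_apply, Matrix.add_apply, map_sum, Derivation.leibniz,
    smul_eq_mul, ← Finset.sum_add_distrib]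
  refine Finset.sum_congr rfl fun k _ => ?_
  ring

omit [Fintype ι] [DecidableEq ι] in
theorem map_der_add (d : Derivation ℤ K K) (A B : Matrix ι ι K) :
    (A + B).map d = A.map d + B.map d := by
  ext a b
  simp

/-- The second tensor power of a flat connection. -/
noncomputable def tensorConnection (hder : ∀ i j a, der i (der j a) = der j (der i a))
    (A : Fin 3 → Matrix ι ι K)
    (hA : ∀ i j, (A j).map (der i) + A j * A i = (A i).map (der j) + A i * A j) :
    FlatConnection der (Matrix ι ι K) where
  nab i :=
    { toFun := fun X => X.map (der i) + (A i).transpose * X + X * A i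
      map_zero' := by
        ext a b
        simp
      map_add' := fun X Y => by
        rw [map_der_add, Matrix.mul_add, Matrix.add_mul]
        abel }
  leibniz i a X := by
    ext p q
    simp [Matrix.mul_apply, Finset.mul_sum, mul_left_comm a]
    ring
  flat i j X := by
    have h1 := hA i j
    have h2 := congrArg Matrix.transpose h1
    simp only [Matrix.transpose_add, Matrix.transpose_mul] at h2
    have h3 : (X.map (der j)).map (der i) = (X.map (der i)).map (der j) := by
      ext p q
      exact hder i j _
    have h4 : ∀ i j, ((A j).transpose).map (der i) = ((A j).map (der i)).transpose :=
      fun i j => rfl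
    change (X.map (der j) + (A j).transpose * X + X * A j).map (der i) +
      (A i).transpose * (X.map (der j) + (A j).transpose * X + X * A j) +
      (X.map (der j) + (A j).transpose * X + X * A j) * A i =
      (X.map (der i) + (A i).transpose * X + X * A i).map (der j) +
      (A j).transpose * (X.map (der i) + (A i).transpose * X + X * A i) +
      (X.map (der i) + (A i).transpose * X + X * A i) * A j
    simp only [map_der_add, map_der_mul, h3, h4, Matrix.mul_add, Matrix.add_mul]
    -- Flatness is used once on each tensor factor, the left one in transposed form; the mixed terms
    -- are symmetric in `i` and `j`.
    have e1 := congrArg (fun Y => X * Y) h1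
    have e2 := congrArg (fun Y => Y * X) h2
    simp only [Matrix.mul_add, Matrix.add_mul] at e1 e2
    simp only [Matrix.mul_assoc] at e1 e2 ⊢
    linear_combination (norm := abel) e1 + e2

theorem tensorConnection_single (hder : ∀ i j a, der i (der j a) = der j (der i a))
    (A : Fin 3 → Matrix ι ι K)
    (hA : ∀ i j, (A j).map (der i) + A j * A i = (A i).map (der j) + A i * A j) (i : Fin 3)
    (a b : ι) :
    (tensorConnection hder A hA).nab i (Matrix.single a b 1) =
      ∑ k, A i a k • Matrix.single k b 1 + ∑ k, A i b k • Matrix.single a k 1 := by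
  change (Matrix.single a b 1).map (der i) + (A i).transpose * Matrix.single a b 1 +
    Matrix.single a b 1 * A i = _
  have h0 : (Matrix.single a b (1 : K)).map (der i) = 0 := by
    ext p q
    simp only [Matrix.map_apply, Matrix.single_apply, Matrix.zero_apply]
    split_ifs <;> simp
  rw [h0, zero_add]
  congr 1
  · ext p q
    simp [Matrix.mul_apply, Matrix.sum_apply, Matrix.single_apply, ite_and]
  · ext p q
    simp [Matrix.mul_apply, Matrix.sum_apply, Matrix.single_apply, ite_and]

/-- The bivector `e_a ∧ e_b`. -/
def wedge (K : Type*) [Field K] (a b : ι) : Matrix ι ι K :=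
  Matrix.single a b 1 - Matrix.single b a 1

omit [Fintype ι] in
theorem wedge_swap (a b : ι) : wedge K b a = -wedge K a b := by
  simp [wedge]

theorem tensorConnection_wedge (hder : ∀ i j a, der i (der j a) = der j (der i a))
    (A : Fin 3 → Matrix ι ι K)
    (hA : ∀ i j, (A j).map (der i) + A j * A i = (A i).map (der j) + A i * A j) (i : Fin 3)
    (a b : ι) :
    (tensorConnection hder A hA).nab i (wedge K a b) =
      ∑ k, A i a k • wedge K k b + ∑ k, A i b k • wedge K a k := by
  simp only [wedge, map_sub, tensorConnection_single, smul_sub, Finset.sum_sub_distrib]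
  abel

/-- The number of bivectors. -/
theorem finrank_ge_of_wedge_mem {E : Submodule K (Matrix TractorIndex TractorIndex K)}
    (h : ∀ a b, wedge K a b ∈ E) : 10 ≤ Module.finrank K E := by
  let P := {p : TractorIndex × TractorIndex // finSumFinEquiv p.1 < finSumFinEquiv p.2}
  let π : Matrix TractorIndex TractorIndex K →ₗ[K] (P → K) :=
    { toFun := fun X p => X p.1.1 p.1.2
      map_add' := fun _ _ => rfl
      map_smul' := fun _ _ => rfl }
  -- Reading only the entries with ordered indices sends the bivectors of ordered pairs to the
  -- coordinate basis, and there are 10 such pairs.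
  have hπ : E.map π = ⊤ := by
    rw [eq_top_iff, ← (Pi.basisFun K P).span_eq, Submodule.span_le]
    rintro _ ⟨⟨⟨a, b⟩, hab⟩, rfl⟩
    refine ⟨wedge K a b, h a b, ?_⟩
    funext ⟨⟨a', b'⟩, hab'⟩
    have h2 : ¬ (b = a' ∧ a = b') := by
      rintro ⟨rfl, rfl⟩
      exact lt_asymm hab hab'
    change (Matrix.single a b 1 - Matrix.single b a 1 : Matrix _ _ K) a' b' = _
    rw [Pi.basisFun_apply, Pi.single_apply, Matrix.sub_apply, Matrix.single_apply,
      Matrix.single_apply, if_neg h2, sub_zero]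
    refine if_congr ⟨?_, fun h => ?_⟩ rfl rfl
    · rintro ⟨rfl, rfl⟩
      rfl
    · cases h
      exact ⟨rfl, rfl⟩
  have h1 := Submodule.finrank_map_le π E
  rw [hπ, finrank_top, Module.finrank_fintype_fun_eq_card] at h1
  exact le_trans (by decide) h1

/-! ### The conformal Killing equations -/

theorem eval_row {n p : ℕ} {der : Fin n → Derivation ℤ K K} {M : Type*} [AddCommGroup M]
    [Module K M] (D : FlatConnection der M) (x : Fin p → M) (a : Fin p → K) (i : Fin n) :
    D.eval x (fun r => C (a r) * X i) = ∑ r, a r • D.nab i (x r) := by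
  have e : (fun r => C (a r) * X i : Row K n p) =
      ∑ r, Pi.single r (monomial (0 + Finsupp.single i 1) (a r)) := by
    funext b
    rw [Finset.sum_apply, Finset.sum_eq_single b]
    · rw [Pi.single_eq_same, zero_add, C_mul_X_eq_monomial]
    · intro c _ hc
      exact Pi.single_eq_of_ne (Ne.symm hc) _
    · simp
  rw [e, map_sum]
  simp only [D.eval_single, D.pow_add_single, D.pow_zero]

theorem eval_const {n p : ℕ} {der : Fin n → Derivation ℤ K K} {M : Type*} [AddCommGroup M]
    [Module K M] (D : FlatConnection der M) (x : Fin p → M) (a : Fin p → K) :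
    D.eval x (fun r => C (a r)) = ∑ r, a r • x r := by
  have e : (fun r => C (a r) : Row K n p) = ∑ r, Pi.single r (monomial 0 (a r)) := by
    funext b
    rw [Finset.sum_apply, Finset.sum_eq_single b]
    · rw [Pi.single_eq_same]
      rfl
    · intro c _ hc
      exact Pi.single_eq_of_ne (Ne.symm hc) _
    · simp
  rw [e, map_sum]
  simp only [D.eval_single, D.pow_zero]

/-- For a metric of constant curvature, the conformal Killing equations have a quotient of
dimension at least ten. -/
theorem exists_solution_space [CharZero K] (hder : ∀ i j a, der i (der j a) = der j (der i a))
    (hsymm : g.IsSymm) (hdet : g.det ≠ 0) (hK : IsConstCurvature der g) :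
    ∃ ev : Row K 3 3 →ₗ[K] Matrix TractorIndex TractorIndex K,
      (∀ {p : ℕ} (S : Fin p → Row K 3 3), (∀ a, S a ∈ confEquations der g) →
        ∀ Q, ev (rowMul der S Q) = 0) ∧
      10 ≤ Module.finrank K ((ordLE K 3 3 2).map ev) := by
  obtain ⟨c, hc, hR⟩ := hK
  have hs : ∀ a b, g a b = g b a := fun a b => hsymm.apply b a
  have hu : IsUnit g.det := isUnit_iff_ne_zero.2 hdet
  set A := tractorMatrix der g c with hAdef
  have hA := tractorMatrix_flat hsymm hdet hc hR
  set D := tensorConnection hder A hA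
  let f : TractorIndex := Sum.inr 0
  let h : TractorIndex := Sum.inr 1
  let e : Fin 3 → TractorIndex := Sum.inl
  have hff : ∀ a : TractorIndex, wedge K a a = 0 := fun a => sub_self _
  have nabfe : ∀ i j, D.nab i (wedge K f (e j)) = wedge K (e i) (e j) +
      ∑ k, christoffel der g k i j • wedge K f (e k) + g i j • wedge K f h := by
    intro i j
    rw [tensorConnection_wedge]
    simp [Fintype.sum_sum_type, hAdef, tractorMatrix, f, e, h, add_assoc]
  have nabfh : ∀ i, D.nab i (wedge K f h) = wedge K (e i) h + c • wedge K (e i) f := by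
    intro i
    rw [tensorConnection_wedge]
    simp [Fintype.sum_sum_type, hAdef, tractorMatrix, f, e, h]
    rw [wedge_swap (Sum.inr 0) (Sum.inl i), smul_neg]
  -- The formal solution is the vector field whose components with lowered index are `f ∧ f_j`.
  let x : Fin 3 → Matrix TractorIndex TractorIndex K := fun r => ∑ l, g⁻¹ r l • wedge K f (e l)
  have hgx : ∀ j, ∑ r, g r j • x r = wedge K f (e j) := by
    intro j
    have h1 : ∀ l, ∑ r, g j r * g⁻¹ r l = if j = l then 1 else 0 := fun l => by
      rw [← Matrix.mul_apply, Matrix.mul_nonsing_inv _ hu, Matrix.one_apply]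
    simp only [x, Finset.smul_sum, smul_smul]
    rw [Finset.sum_comm]
    simp only [← Finset.sum_smul, hs _ j, h1, ite_smul, one_smul, zero_smul, Finset.sum_ite_eq,
      Finset.mem_univ, if_true]
  have hgn : ∀ i j, ∑ r, g r j • D.nab i (x r) =
      D.nab i (wedge K f (e j)) - ∑ r, der i (g r j) • x r := by
    intro i j
    rw [← hgx, map_sum]
    simp only [D.leibniz, Finset.sum_add_distrib]
    abel
  -- The terms `f_i ∧ f_j` are skew and cancel, and the Christoffel terms cancel against the
  -- derivatives of the metric. Only a multiple of the metric survives, and the trace-free equations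
  -- kill it.
  have hkill : ∀ i j, D.eval x (killing der g i j) = (2 * g i j) • wedge K f h := by
    intro i j
    have e1 : killing der g i j = (fun r => C (g r j) * X i) + (fun r => C (g i r) * X j) +
        (fun r => C (der r (g i j))) := rfl
    rw [e1, map_add, map_add, eval_row, eval_row, eval_const]
    simp only [hs i]
    rw [hgn, hgn, nabfe, nabfe, wedge_swap (e i) (e j), hs j i]
    have e2 : ∑ r, (der i (g r j) + der j (g i r) - der r (g i j)) • x r =
        (2 : K) • ∑ k, christoffel der g k i j • wedge K f (e k) := by
      simp only [x, Finset.smul_sum, smul_smul]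
      rw [Finset.sum_comm]
      refine Finset.sum_congr rfl fun k _ => ?_
      rw [← Finset.sum_smul, christoffel, ← mul_assoc, Finset.mul_sum]
      congr 1
      refine Finset.sum_congr rfl fun r _ => ?_
      have := hsymm.inv.apply k r
      rw [this]
      ring
    simp only [add_smul, sub_smul, Finset.sum_add_distrib, Finset.sum_sub_distrib] at e2
    simp only [hs i] at e2
    rw [hs j i] at e2
    simp only [christoffel_symm hsymm _ j i]
    linear_combination (norm := module) (-1 : K) • e2
  have htr : ∑ k, ∑ l, g⁻¹ k l * g k l = 3 := by
    have h1 : ∀ k, ∑ l, g⁻¹ k l * g k l = 1 := fun k => by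
      have : (g⁻¹ * g) k k = 1 := by rw [Matrix.nonsing_inv_mul _ hu, Matrix.one_apply_eq]
      rw [← this, Matrix.mul_apply]
      exact Finset.sum_congr rfl fun l _ => by rw [hs k l]
    simp [h1]
  have hconf : ∀ v ∈ confEquations der g, D.eval x v = 0 := by
    intro v hv
    refine (Submodule.span_le.2 ?_ hv : v ∈ LinearMap.ker (D.eval x))
    rintro _ ⟨⟨i, j⟩, rfl⟩
    change D.eval x (confKilling der g i j) = 0
    rw [confKilling, map_sub, map_smul, map_sum]
    simp only [map_sum, map_smul, hkill, smul_smul, ← Finset.sum_smul, mul_left_comm _ (2 : K),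
      ← Finset.mul_sum, htr]
    rw [← sub_smul]
    convert zero_smul K _ using 2
    push_cast
    ring
  refine ⟨D.eval x, fun S hS Q => eval_rowMul_eq_zero hder D (fun a => hconf _ (hS a)) Q, ?_⟩
  -- Filtering by order, the bivectors appear as `f ∧ f_l` in order 0, `f ∧ h` and `f_i ∧ f_j` in
  -- order 1, and `f_i ∧ h` in order 2: 3 + 4 + 3 = 10.
  let E : ℕ → Submodule K (Matrix TractorIndex TractorIndex K) := fun r =>
    (ordLE K 3 3 r).map (D.eval x)
  have hmono : ∀ {r r'}, r ≤ r' → E r ≤ E r' := fun hr => Submodule.map_mono (ordLE_mono hr)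
  have hnab : ∀ {r y}, y ∈ E r → ∀ i, D.nab i y ∈ E (r + 1) := by
    rintro r _ ⟨v, hv, rfl⟩ i
    exact ⟨_, nab_mem_ordLE hder hv i, eval_nab hder D x i v⟩
  have h0 : ∀ l, wedge K f (e l) ∈ E 0 := by
    intro l
    refine ⟨fun r => C (g r l), mem_ordLE.2 fun k μ hμ => ?_, by rw [eval_const, hgx]⟩
    rw [coeff_C, if_neg]
    rintro rfl
    simp at hμ
  have h1 : ∀ i j, wedge K (e i) (e j) + g i j • wedge K f h ∈ E 1 := by
    intro i j
    have h2 := hnab (h0 j) i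
    rw [nabfe] at h2
    have h3 : ∑ k, christoffel der g k i j • wedge K f (e k) ∈ E 1 :=
      Submodule.sum_mem _ fun k _ => Submodule.smul_mem _ _ (hmono (by omega) (h0 k))
    convert Submodule.sub_mem _ h2 h3 using 1
    abel
  -- Symmetrizing `h1` in `i, j` isolates `f ∧ h` at an index pair where the metric does not vanish.
  have hfh : wedge K f h ∈ E 1 := by
    obtain ⟨i, j, hij⟩ : ∃ i j, g i j ≠ 0 := by
      by_contra! h0
      exact hdet (by rw [show g = 0 from Matrix.ext h0, Matrix.det_zero])
    have h2 := Submodule.add_mem _ (h1 i j) (h1 j i)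
    rw [wedge_swap (e i) (e j), hs j i] at h2
    have h3 : (2 * g i j) • wedge K f h ∈ E 1 := by
      convert h2 using 1
      module
    exact (Submodule.smul_mem_iff _ (mul_ne_zero two_ne_zero hij)).1 h3
  have hee : ∀ i j, wedge K (e i) (e j) ∈ E 1 := fun i j => by
    convert Submodule.sub_mem _ (h1 i j) (Submodule.smul_mem _ (g i j) hfh) using 1
    abel
  have heh : ∀ i, wedge K (e i) h ∈ E 2 := by
    intro i
    have h2 := hnab hfh i
    rw [nabfh, wedge_swap f (e i)] at h2
    have h3 := Submodule.smul_mem (E 2) c (hmono (by omega) (h0 i))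
    convert Submodule.add_mem _ h2 h3 using 1
    module
  have hneg : ∀ {a b}, wedge K a b ∈ E 2 → wedge K b a ∈ E 2 := fun hab => by
    rw [wedge_swap]
    exact Submodule.neg_mem _ hab
  refine finrank_ge_of_wedge_mem fun a b => ?_
  change _ ∈ E 2
  rcases a with i | a <;> rcases b with j | b
  · exact hmono (by omega) (hee i j)
  · fin_cases b
    · exact hneg (hmono (by omega) (h0 i))
    · exact heh i
  · fin_cases a
    · exact hmono (by omega) (h0 j)
    · exact hneg (heh j)
  · fin_cases a <;> fin_cases b
    · exact (hff f).symm ▸ Submodule.zero_mem _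
    · exact hmono (by omega) hfh
    · exact hneg (hmono (by omega) hfh)
    · exact (hff h).symm ▸ Submodule.zero_mem _

end Tractor

end FormalPDE

namespace FormalPDE

open MvPolynomial

/-! ## The space of conformal Killing equations -/

section ConfEquations

variable {K : Type*} [Field K] [CharZero K] {der : Fin 3 → Derivation ℤ K K}
  {ω : Matrix (Fin 3) (Fin 3) K} (hsymm : ω.IsSymm) (hdet : ω.det ≠ 0)
include hsymm hdet

omit [CharZero K] in
theorem sum_inv_mul_self : ∑ k, ∑ l, ω⁻¹ k l * ω k l = 3 := by
  have h1 : ∀ k, ∑ l, ω⁻¹ k l * ω k l = 1 := fun k => by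
    have : (ω⁻¹ * ω) k k = 1 := by
      rw [Matrix.nonsing_inv_mul _ (isUnit_iff_ne_zero.2 hdet), Matrix.one_apply_eq]
    rw [← this, Matrix.mul_apply]
    exact Finset.sum_congr rfl fun l _ => by rw [hsymm.apply k l]
  simp [h1]

/-- Both first-order terms of the trace contract to `d_r`, so removing a third of the trace
subtracts 2/3 in the symbol; all derivatives of the metric are of order zero. -/
theorem confKilling_eq (i j : Fin 3) : confKilling der ω i j = confLead ω i j +
    fun r => C (der r (ω i j) - 1 / 3 * ω i j * ∑ k, ∑ l, ω⁻¹ k l * der r (ω k l)) := by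
  have hs : ∀ a b, ω a b = ω b a := fun a b => hsymm.apply b a
  have hu : IsUnit ω.det := isUnit_iff_ne_zero.2 hdet
  funext r
  have h1 : ∀ k, ∑ l, ω⁻¹ k l * ω l r = if k = r then 1 else 0 := fun k => by
    rw [← Matrix.mul_apply, Matrix.nonsing_inv_mul _ hu, Matrix.one_apply]
  have h2 : ∀ l, ∑ k, ω⁻¹ k l * ω k r = if l = r then 1 else 0 := fun l => by
    rw [← h1]
    exact Finset.sum_congr rfl fun k _ => by rw [hsymm.inv.apply l k]
  have e1 : ∑ k, ∑ l, C (ω⁻¹ k l) * (C (ω r l) * X k) = (X r : MvPolynomial (Fin 3) K) := by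
    have : ∀ k, ∑ l, C (ω⁻¹ k l) * (C (ω r l) * X k) =
        C (if k = r then 1 else 0) * (X k : MvPolynomial (Fin 3) K) := fun k => by
      rw [← h1, map_sum, Finset.sum_mul]
      exact Finset.sum_congr rfl fun l _ => by rw [hs r l, C_mul, mul_assoc]
    simp [this]
  have e2 : ∑ k, ∑ l, C (ω⁻¹ k l) * (C (ω k r) * X l) = (X r : MvPolynomial (Fin 3) K) := by
    rw [Finset.sum_comm]
    have : ∀ l, ∑ k, C (ω⁻¹ k l) * (C (ω k r) * X l) =
        C (if l = r then 1 else 0) * (X l : MvPolynomial (Fin 3) K) := fun l => by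
      rw [← h2, map_sum, Finset.sum_mul]
      exact Finset.sum_congr rfl fun k _ => by rw [C_mul, mul_assoc]
    simp [this]
  simp only [confKilling, killing, confLead, Pi.sub_apply, Pi.add_apply, Pi.smul_apply,
    Finset.sum_apply, smul_eq_C_mul, mul_add, Finset.sum_add_distrib, e1, e2]
  push_cast
  simp only [C_mul, C_sub, map_sum]
  have h3 : (C (2 / 3) : MvPolynomial (Fin 3) K) = C (1 / 3) + C (1 / 3) := by
    rw [← C_add]
    norm_num
  rw [h3]
  ring

/-- Rescaling the metric adds to the rescaled Killing expression a multiple of `ω` involving the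
derivative of the factor, and the trace-free part removes it. Thus the metric may be replaced by its
constant curvature multiple. -/
theorem confEquations_smul {lam : K} (hlam : lam ≠ 0) :
    confEquations der (lam • ω) = confEquations der ω := by
  have hu : IsUnit ω.det := isUnit_iff_ne_zero.2 hdet
  have hinv : (lam • ω)⁻¹ = lam⁻¹ • ω⁻¹ := by
    apply Matrix.inv_eq_left_inv
    rw [Matrix.smul_mul, Matrix.mul_smul, smul_smul, inv_mul_cancel₀ hlam, one_smul,
      Matrix.nonsing_inv_mul _ hu]
  have hdet' : (lam • ω).det ≠ 0 := by
    rw [Matrix.det_smul]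
    exact mul_ne_zero (pow_ne_zero _ hlam) hdet
  have hsymm' : (lam • ω).IsSymm := by
    rw [Matrix.IsSymm, Matrix.transpose_smul, hsymm.eq]
  have key : ∀ i j, confKilling der (lam • ω) i j = lam • confKilling der ω i j := by
    intro i j
    have h1 : confLead (lam • ω) i j = lam • confLead ω i j := by
      funext r
      simp only [confLead, Matrix.smul_apply, Pi.smul_apply, smul_eq_mul, smul_eq_C_mul, C_mul]
      ring
    rw [confKilling_eq hsymm' hdet', confKilling_eq hsymm hdet, smul_add, h1]
    congr 1
    funext r
    rw [Pi.smul_apply, smul_eq_C_mul, ← C_mul]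
    congr 1
    have h2 : ∑ k, ∑ l, (lam • ω)⁻¹ k l * der r ((lam • ω) k l) =
        ∑ k, ∑ l, ω⁻¹ k l * der r (ω k l) + 3 * lam⁻¹ * der r lam := by
      rw [← sum_inv_mul_self hsymm hdet, hinv]
      simp only [Finset.sum_mul, ← Finset.sum_add_distrib]
      refine Finset.sum_congr rfl fun k _ => Finset.sum_congr rfl fun l _ => ?_
      simp only [Matrix.smul_apply, smul_eq_mul, Derivation.leibniz]
      field_simp
    rw [h2]
    simp only [Matrix.smul_apply, smul_eq_mul, Derivation.leibniz]
    field_simp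
    ring
  apply le_antisymm
  · refine Submodule.span_le.2 ?_
    rintro _ ⟨⟨i, j⟩, rfl⟩
    change confKilling der (lam • ω) i j ∈ confEquations der ω
    rw [key]
    exact Submodule.smul_mem _ _ (Submodule.subset_span ⟨(i, j), rfl⟩)
  · refine Submodule.span_le.2 ?_
    rintro _ ⟨⟨i, j⟩, rfl⟩
    change confKilling der ω i j ∈ confEquations der (lam • ω)
    rw [← Submodule.smul_mem_iff _ hlam, ← key]
    exact Submodule.subset_span ⟨(i, j), rfl⟩

omit [CharZero K] hsymm hdet in
theorem confLead_mem (i j : Fin 3) : confLead ω i j ∈ homRow K 3 3 1 := by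
  exact mem_homRow.2 fun r => ((isHomogeneous_C_mul_X _ _).add (isHomogeneous_C_mul_X _ _)).sub
    (isHomogeneous_C_mul_X _ _)

omit [CharZero K] hsymm hdet in
theorem const_mem_homRow {n m : ℕ} (c : Fin m → K) :
    (fun a => C (c a) : Row K n m) ∈ homRow K n m 0 :=
  mem_homRow.2 fun _ => isHomogeneous_C _ _

theorem confKilling_mem_ordLE (i j : Fin 3) : confKilling der ω i j ∈ ordLE K 3 3 1 := by
  rw [confKilling_eq hsymm hdet]
  exact Submodule.add_mem _ (homRow_le_ordLE _ (confLead_mem i j))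
    (ordLE_mono zero_le_one (homRow_le_ordLE _ (const_mem_homRow _)))

theorem lead_confKilling (i j : Fin 3) : lead 1 (confKilling der ω i j) = confLead ω i j := by
  rw [confKilling_eq hsymm hdet, map_add, lead_of_mem (confLead_mem i j),
    lead_eq_zero zero_lt_one (homRow_le_ordLE _ (const_mem_homRow _)), add_zero]

theorem confEquations_le_ordLE : confEquations der ω ≤ ordLE K 3 3 1 := by
  refine Submodule.span_le.2 ?_
  rintro _ ⟨⟨i, j⟩, rfl⟩
  exact confKilling_mem_ordLE hsymm hdet i j

/-- The nine equations are indexed by matrix entries. Their relations express symmetry in `i, j` and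
vanishing trace, so they are the matrices whose symmetric part is a multiple of the inverse metric,
a space of dimension 4. -/
theorem finrank_confEquations : Module.finrank K (confEquations der ω) = 5 := by
  have hs : ∀ a b, ω a b = ω b a := fun a b => hsymm.apply b a
  have hu : IsUnit ω.det := isUnit_iff_ne_zero.2 hdet
  let L : Matrix (Fin 3) (Fin 3) K →ₗ[K] Row K 3 3 :=
    { toFun := fun B => ∑ i, ∑ j, B i j • confKilling der ω i j
      map_add' := fun A B => by
        simp only [Matrix.add_apply, add_smul, Finset.sum_add_distrib]
      map_smul' := fun c B => by
        simp only [Matrix.smul_apply, smul_assoc, Finset.smul_sum, RingHom.id_apply] }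
  have hrange : LinearMap.range L = confEquations der ω := by
    apply le_antisymm
    · rintro _ ⟨B, rfl⟩
      have hmem : ∀ i j, confKilling der ω i j ∈ confEquations der ω := fun i j =>
        Submodule.subset_span ⟨(i, j), rfl⟩
      change ∑ i, ∑ j, B i j • confKilling der ω i j ∈ _
      exact Submodule.sum_mem _ fun i _ => Submodule.sum_mem _ fun j _ =>
        Submodule.smul_mem _ _ (hmem i j)
    · refine Submodule.span_le.2 ?_
      rintro _ ⟨⟨i, j⟩, rfl⟩
      refine ⟨Matrix.single i j 1, ?_⟩
      change ∑ a, ∑ b, Matrix.single i j (1 : K) a b • confKilling der ω a b = _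
      simp [Matrix.single_apply, ite_and]
  have hker : LinearMap.ker L = skewConf ω⁻¹ := by
    ext B
    rw [LinearMap.mem_ker]
    constructor
    · intro hB
      refine ⟨2 / 3 * ∑ i, ∑ j, B i j * ω i j, ?_⟩
      -- Entry `(a, r)` is the coefficient of `X_a` in component `r` of the leading part of `L B`.
      have h1 : (B + B.transpose) * ω = (2 / 3 * ∑ i, ∑ j, B i j * ω i j) • 1 := by
        ext a r
        have h2 : lead 1 (L B) r = 0 := by rw [hB]; simp
        have h3 : lead 1 (L B) = ∑ i, ∑ j, B i j • confLead ω i j := by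
          change lead 1 (∑ i, ∑ j, B i j • confKilling der ω i j) = _
          simp only [map_sum, map_smul, lead_confKilling hsymm hdet]
        have hX : ∀ (c : K) (i : Fin 3), coeff (Finsupp.single a 1)
            (C c * X i : MvPolynomial (Fin 3) K) = if i = a then c else 0 := fun c i => by
          rw [C_mul_X_eq_monomial, coeff_monomial]
          simp only [Finsupp.single_left_inj one_ne_zero]
        have hco : ∀ i j, coeff (Finsupp.single a 1) (confLead ω i j r) =
            (if i = a then ω r j else 0) + (if j = a then ω i r else 0) -
              (if r = a then 2 / 3 * ω i j else 0) := fun i j => by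
          simp only [confLead, coeff_add, coeff_sub, hX]
        have h5 := congrArg (coeff (Finsupp.single a 1)) h2
        rw [h3] at h5
        have e1 : ∑ i, ∑ j, B i j * (if i = a then ω r j else 0) = ∑ j, B a j * ω j r := by
          rw [Finset.sum_comm]
          simp only [mul_ite, mul_zero, Finset.sum_ite_eq', Finset.mem_univ, if_true, hs r]
        have e2 : ∑ i, ∑ j, B i j * (if j = a then ω i r else 0) = ∑ j, B j a * ω j r := by
          simp only [mul_ite, mul_zero, Finset.sum_ite_eq', Finset.mem_univ, if_true]
        have e3 : ∑ i, ∑ j, B i j * (if r = a then 2 / 3 * ω i j else 0) =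
            if a = r then 2 / 3 * ∑ i, ∑ j, B i j * ω i j else 0 := by
          simp only [eq_comm (a := a)]
          split_ifs
          · simp only [mul_left_comm _ (2 / 3 : K), ← Finset.mul_sum]
          · simp
        simp only [Finset.sum_apply, Pi.smul_apply, coeff_sum, coeff_smul, hco, smul_eq_mul,
          coeff_zero, mul_sub, mul_add, Finset.sum_add_distrib, Finset.sum_sub_distrib, e1, e2,
          e3] at h5
        simp only [Matrix.mul_apply, Matrix.add_apply, Matrix.transpose_apply,
          Matrix.smul_apply, Matrix.one_apply, smul_eq_mul, add_mul, Finset.sum_add_distrib,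
          mul_ite, mul_one, mul_zero]
        exact sub_eq_zero.1 h5
      rw [← Matrix.mul_one (B + B.transpose), ← Matrix.mul_nonsing_inv _ hu, ← Matrix.mul_assoc,
        h1, Matrix.smul_mul, Matrix.one_mul]
    · rintro ⟨φ, hφ⟩
      have hsw : ∀ i j, confKilling der ω j i = confKilling der ω i j := by
        intro i j
        have : killing der ω j i = killing der ω i j := by
          funext r
          simp only [killing, hs j i, hs r i, hs j r]
          ring
        simp only [confKilling, this, hs j i]
      have h1 : ∑ i, ∑ j, ω⁻¹ i j • confKilling der ω i j = 0 := by
        simp only [confKilling, smul_sub, smul_smul, Finset.sum_sub_distrib, ← Finset.sum_smul,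
          mul_left_comm _ (1 / ((3 : ℕ) : K)), ← Finset.mul_sum, sum_inv_mul_self hsymm hdet]
        simp
      have h2 : (2 : K) • L B = 0 := by
        have h3 : L B = ∑ i, ∑ j, B.transpose i j • confKilling der ω i j := by
          change ∑ i, ∑ j, B i j • confKilling der ω i j = _
          rw [Finset.sum_comm]
          exact Finset.sum_congr rfl fun i _ => Finset.sum_congr rfl fun j _ => by
            rw [hsw i j]; rfl
        rw [two_smul]
        nth_rewrite 2 [h3]
        change ∑ i, ∑ j, B i j • confKilling der ω i j + _ = 0
        simp only [← Finset.sum_add_distrib, ← add_smul, ← Matrix.add_apply, hφ]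
        simp only [Matrix.smul_apply, smul_assoc, ← Finset.smul_sum, h1, smul_zero]
      exact (smul_eq_zero.1 h2).resolve_left two_ne_zero
  have h := LinearMap.finrank_range_add_finrank_ker L
  have h0 : ω⁻¹ ≠ 0 := fun h0 => by
    have := Matrix.mul_nonsing_inv _ hu
    rw [h0, Matrix.mul_zero] at this
    exact zero_ne_one this
  rw [hrange, hker, finrank_skewConf hsymm.inv h0, Module.finrank_matrix] at h
  simp at h
  omega

end ConfEquations

end FormalPDE

namespace FormalPDE

open MvPolynomial

/-! ## The sequence of operators -/

section Sequence

variable {K : Type*} [Field K]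

theorem finrank_map_add_finrank_ker_inf {V W : Type*} [AddCommGroup V] [Module K V]
    [AddCommGroup W] [Module K W] (f : V →ₗ[K] W) (p : Submodule K V) [FiniteDimensional K p] :
    Module.finrank K (p.map f) + Module.finrank K ↥(LinearMap.ker f ⊓ p) =
      Module.finrank K p := by
  have h := LinearMap.finrank_range_add_finrank_ker (f.domRestrict p)
  rwa [LinearMap.range_domRestrict, LinearMap.ker_domRestrict, ← Submodule.finrank_map_subtype_eq,
    Submodule.map_comap_subtype, inf_comm] at h

theorem six_mul_choose (r : ℕ) : 6 * (r + 3).choose 3 = (r + 1) * (r + 2) * (r + 3) := by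
  have h1 := Nat.add_one_mul_choose_eq (r + 2) 2
  have h2 := Nat.add_one_mul_choose_eq (r + 1) 1
  simp only [Nat.choose_one_right] at h1 h2
  norm_num at h1 h2
  rw [show r + 2 + 1 = r + 3 by omega] at h1
  rw [show r + 1 + 1 = r + 2 by omega] at h2
  nlinarith

theorem symMul_const {n m p : ℕ} (s : Fin p → Row K n m) (c : Fin p → K) :
    symMul s (fun a => C (c a)) = ∑ a, c a • s a := by
  rw [symMul_apply]
  refine Finset.sum_congr rfl fun a _ => funext fun k => ?_
  simp [smul_eq_C_mul]

variable {der : Fin 3 → Derivation ℤ K K} (hder : ∀ i j a, der i (der j a) = der j (der i a))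
include hder

theorem rowMul_const {m p : ℕ} (S : Fin p → Row K 3 m) (c : Fin p → K) :
    rowMul der S (fun a => C (c a)) = ∑ a, c a • S a := by
  rw [rowMul_eq hder, eval_const]

variable [CharZero K] {ω : Matrix (Fin 3) (Fin 3) K} (hsymm : ω.IsSymm) (hdet : ω.det ≠ 0)
  {S : Fin 5 → Row K 3 3} (hS : ∀ a, S a ∈ ordLE K 3 3 1)
  (hω : ∀ i j, confLead ω i j ∈ LinearMap.range (symMul fun a => lead 1 (S a)))
include hsymm hdet hS hω

/-- The leading part of a compatibility condition is a symbol syzygy, and there are none in degrees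
2, 1 and 0. -/
theorem compat_two_eq_bot : compat der S 2 = ⊥ := by
  rw [eq_bot_iff]
  intro Q hQ
  have key : ∀ d ≤ 2, Q ∈ ordLE K 3 5 d → lead d Q = 0 := fun d hd hQd =>
    symMul_injective hsymm hdet (fun a => lead_mem 1 (S a)) hω rfl hd (lead_mem _ _)
      (symMul_lead_eq_zero hder hS ⟨hQ.1, hQd⟩)
  have h1 := mem_ordLE_of_lead_eq_zero hQ.2 (key 2 le_rfl hQ.2)
  have h0 := mem_ordLE_of_lead_eq_zero h1 (key 1 (by omega) h1)
  rw [Submodule.mem_bot, ← lead_eq_zero_iff_of_ordLE_zero h0]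
  exact key 0 (by omega) h0

theorem exists_sub_rowMul_mem {r : ℕ} (hr : 2 ≤ r) {P : Row K 3 3}
    (hP : P ∈ ordLE K 3 3 (r + 1)) :
    ∃ q ∈ ordLE K 3 5 r, P - rowMul der S q ∈ ordLE K 3 3 r := by
  obtain ⟨q, hq, e⟩ := symMul_surjective hsymm hdet (fun a => lead_mem 1 (S a)) hω hr
    (lead_mem (r + 1) P)
  have hq' := homRow_le_ordLE _ hq
  refine ⟨q, hq', mem_ordLE_of_lead_eq_zero
    (Submodule.sub_mem _ hP (rowMul_mem_ordLE hder hS hq')) ?_⟩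
  rw [map_sub, lead_rowMul hder hS hq', lead_of_mem hq, e, sub_self]

variable {V : Type*} [AddCommGroup V] [Module K V] {ev : Row K 3 3 →ₗ[K] V}
  (hev : ∀ Q, ev (rowMul der S Q) = 0) (h10 : 10 ≤ Module.finrank K ((ordLE K 3 3 2).map ev))
include hev h10

omit [CharZero K] hω hsymm hdet h10 in
theorem map_rowMul_le (r : ℕ) :
    (ordLE K 3 5 r).map (rowMul der S) ≤ LinearMap.ker ev ⊓ ordLE K 3 3 (r + 1) := by
  rintro _ ⟨Q, hQ, rfl⟩
  exact ⟨LinearMap.mem_ker.2 (hev Q), rowMul_mem_ordLE hder hS hQ⟩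

/-- A dimension squeeze. The consequences of order at most 3 have dimension 5 · 10 = 50, by absence
of compatibility conditions of order 2. The kernel of `ev` contains them and has dimension at most
60 - 10. So no hidden equation of order at most 3 exists. -/
theorem map_rowMul_two_and_finrank :
    (ordLE K 3 5 2).map (rowMul der S) = LinearMap.ker ev ⊓ ordLE K 3 3 3 ∧
      Module.finrank K ((ordLE K 3 3 3).map ev) = 10 := by
  have h1 := finrank_map_add_finrank_ker_inf (rowMul der S) (ordLE K 3 5 2)
  have h2 := finrank_map_add_finrank_ker_inf ev (ordLE K 3 3 3)
  have h3 : Module.finrank K ((ordLE K 3 3 2).map ev) ≤ Module.finrank K ((ordLE K 3 3 3).map ev) :=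
    Submodule.finrank_mono (Submodule.map_mono (ordLE_mono (by omega)))
  rw [show LinearMap.ker (rowMul der S) ⊓ ordLE K 3 5 2 = ⊥ from
    compat_two_eq_bot hder hsymm hdet hS hω, finrank_bot, finrank_ordLE] at h1
  rw [finrank_ordLE] at h2
  simp [Nat.choose] at h1 h2
  have : FiniteDimensional K ↥(LinearMap.ker ev ⊓ ordLE K 3 3 3) :=
    Submodule.finiteDimensional_inf_right _ _
  have hle : (ordLE K 3 5 2).map (rowMul der S) ≤ LinearMap.ker ev ⊓ ordLE K 3 3 3 :=
    map_rowMul_le hder hS hev 2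
  have h4 := Submodule.finrank_mono hle
  rw [h1] at h4
  refine ⟨Submodule.eq_of_le_of_finrank_le hle ?_, ?_⟩
  · rw [h1]
    omega
  · omega

/-- Above order 3 the symbol is onto, so every row reduces by a consequence of the equations to a
row of one order less, with the same value under `ev`. -/
theorem map_rowMul_and_finrank {r : ℕ} (hr : 2 ≤ r) :
    (ordLE K 3 5 r).map (rowMul der S) = LinearMap.ker ev ⊓ ordLE K 3 3 (r + 1) ∧
      Module.finrank K ((ordLE K 3 3 (r + 1)).map ev) = 10 := by
  induction r, hr using Nat.le_induction with
  | base => exact map_rowMul_two_and_finrank hder hsymm hdet hS hω hev h10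
  | succ r hr ih =>
    refine ⟨le_antisymm (map_rowMul_le hder hS hev _) ?_, ?_⟩
    · rintro P ⟨hP0, hP⟩
      obtain ⟨q, hq, h⟩ := exists_sub_rowMul_mem hder hsymm hdet hS hω (by omega) hP
      have : P - rowMul der S q ∈ LinearMap.ker ev ⊓ ordLE K 3 3 (r + 1) :=
        ⟨Submodule.sub_mem _ hP0 (LinearMap.mem_ker.2 (hev q)), h⟩
      rw [← ih.1] at this
      obtain ⟨q', hq', e⟩ := this
      refine ⟨q + q', Submodule.add_mem _ hq (ordLE_mono (by omega) hq'), ?_⟩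
      rw [map_add, e, add_sub_cancel]
    · suffices e : (ordLE K 3 3 (r + 1 + 1)).map ev = (ordLE K 3 3 (r + 1)).map ev by
        rw [e, ih.2]
      apply le_antisymm
      · rintro _ ⟨P, hP, rfl⟩
        obtain ⟨q, hq, h⟩ := exists_sub_rowMul_mem hder hsymm hdet hS hω (by omega) hP
        exact ⟨_, h, by rw [map_sub, hev, sub_zero]⟩
      · exact Submodule.map_mono (ordLE_mono (by omega))

/-- Rank-nullity for the two consecutive maps; the constant 10 is the dimension of the space of
values of `ev`. -/
theorem finrank_compat {r : ℕ} (hr : 2 ≤ r) :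
    Module.finrank K (compat der S r) + 3 * (r + 4).choose 3 = 5 * (r + 3).choose 3 + 10 := by
  obtain ⟨h1, h2⟩ := map_rowMul_and_finrank hder hsymm hdet hS hω hev h10 hr
  have h3 := finrank_map_add_finrank_ker_inf (rowMul der S) (ordLE K 3 5 r)
  have h4 := finrank_map_add_finrank_ker_inf ev (ordLE K 3 3 (r + 1))
  rw [h1, finrank_ordLE] at h3
  rw [h2, finrank_ordLE, show r + 1 + 3 = r + 4 by omega] at h4
  unfold compat
  omega

theorem finrank_compat_three : Module.finrank K (compat der S 3) = 5 := by
  have := finrank_compat hder hsymm hdet hS hω hev h10 (r := 3) (by omega)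
  simp [Nat.choose] at this
  omega

/-! ### The Weyl operator -/

variable {W : Fin 5 → Row K 3 5} (hW : ∀ a, W a ∈ compat der S 3)
  (hWspan : ∀ P ∈ compat der S 3, ∃ c : Fin 5 → K, P = ∑ a, c a • W a)
include hW hWspan

-- Degree 3 is the integrability step, from the dimension squeeze; higher degrees descend to it
-- through the Koszul argument.
omit hW in
theorem weyl_symbol_exact (r : ℕ) : ∀ z ∈ homRow K 3 5 (r + 3),
    symMul (fun a => lead 1 (S a)) z = 0 →
      ∃ q ∈ homRow K 3 5 r, symMul (fun a => lead 3 (W a)) q = z := by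
  induction r with
  | zero =>
    intro z hz h
    have hz' := homRow_le_ordLE _ hz
    rw [zero_add] at hz hz'
    have h1 : rowMul der S z ∈ ordLE K 3 3 3 := by
      refine mem_ordLE_of_lead_eq_zero (rowMul_mem_ordLE hder hS hz') ?_
      rw [lead_rowMul hder hS hz', lead_of_mem hz, h]
    have h2 : rowMul der S z ∈ LinearMap.ker ev ⊓ ordLE K 3 3 3 :=
      ⟨LinearMap.mem_ker.2 (hev z), h1⟩
    -- Applying `S` to the symbol syzygy `z` loses the top order, and the result is killed by `ev`;
    -- so it also arises from some `y` of order at most 2, and `z - y` is a compatibility condition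
    -- with leading part `z`.
    rw [← (map_rowMul_two_and_finrank hder hsymm hdet hS hω hev h10).1] at h2
    obtain ⟨y, hy, e⟩ := h2
    obtain ⟨c, hc⟩ := hWspan (z - y)
      ⟨LinearMap.mem_ker.2 (by rw [map_sub, e, sub_self]),
        Submodule.sub_mem _ hz' (ordLE_mono (by omega) hy)⟩
    refine ⟨fun a => C (c a), const_mem_homRow c, ?_⟩
    have h3 := congrArg (lead 3) hc
    rw [map_sub, lead_eq_zero (by omega) hy, sub_zero, lead_of_mem hz] at h3
    rw [h3, symMul_const]
    simp only [map_sum, map_smul]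
  | succ r ih =>
    intro z hz h
    have hz' : z ∈ homRow K 3 5 (r + 2 + 2) := by
      convert hz using 1
    obtain ⟨y, hy, hy0, rfl⟩ := exists_syzygy_sum (d := r + 2) (fun a => lead_mem 1 (S a))
      (fun v hv => symMul_surjective hsymm hdet (fun a => lead_mem 1 (S a)) hω (by omega) hv) hz' h
    choose q hq e using fun i => ih (y i) (hy i) (hy0 i)
    refine ⟨∑ i, (X i : MvPolynomial (Fin 3) K) • q i,
      Submodule.sum_mem _ fun i _ => X_smul_mem (hq i) i, ?_⟩
    simp only [map_sum, map_smul, e]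

theorem weyl_generates : Generates der W 3 S :=
  generates_of_symbol (f := 2) hder hS hW (compat_two_eq_bot hder hsymm hdet hS hω)
    (weyl_symbol_exact hder hsymm hdet hS hω hev h10 hWspan)

omit hsymm hdet hS hω hev h10 hW hWspan [CharZero K] in
theorem compat_zero_eq_bot (hWind : LinearIndependent K W) : compat der W 0 = ⊥ := by
  rw [eq_bot_iff]
  rintro Q ⟨hQ, hQ0⟩
  have e : Q = fun a => C (coeff 0 (Q a)) := by
    rw [← lead_eq_zero_iff_of_ordLE_zero hQ0]
    funext a
    rw [lead_apply, homogeneousComponent_zero]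
    simp
  have hQ := LinearMap.mem_ker.1 hQ
  rw [e, rowMul_const hder] at hQ
  have h := Fintype.linearIndependent_iff.1 hWind _ hQ
  rw [Submodule.mem_bot, e]
  funext a
  simp [h a]

theorem finrank_compat_weyl (r : ℕ) :
    Module.finrank K (compat der W (r + 1)) = 3 * (r + 3).choose 3 := by
  have h1 := finrank_map_add_finrank_ker_inf (rowMul der W) (ordLE K 3 5 (r + 1))
  rw [weyl_generates hder hsymm hdet hS hω hev h10 hW hWspan (r + 1), finrank_ordLE] at h1
  have h2 := finrank_compat hder hsymm hdet hS hω hev h10 (r := r + 1 + 3) (by omega)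
  -- Multiplied by 6, the binomials become cubics in `r`, and the claim is the identity `5 C(r+4,3)
  -- - 5 C(r+7,3) + 3 C(r+8,3) - 10 = 3 C(r+3,3)`.
  have e1 := six_mul_choose r
  have e2 := six_mul_choose (r + 1)
  have e3 := six_mul_choose (r + 1 + 3)
  have e4 := six_mul_choose (r + 1 + 3 + 1)
  rw [show r + 1 + 3 + 1 + 3 = r + 1 + 3 + 4 by omega] at e4
  unfold compat at h1 h2 ⊢
  zify at *
  linarith

/-! ### The Bianchi operator -/

variable {B : Fin 3 → Row K 3 5} (hB : ∀ a, B a ∈ compat der W 1)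
  (hBspan : ∀ P ∈ compat der W 1, ∃ c : Fin 3 → K, P = ∑ a, c a • B a)
  (hWind : LinearIndependent K W)
include hBspan

/-- Again the lowest degree needs a lift: applying `W` to the syzygy gives a compatibility condition
of `S` of order only 3, which by generation is a constant combination of the rows of `W`.
Subtracting these constants yields a compatibility condition of `W`. -/
theorem bianchi_symbol_exact (r : ℕ) : ∀ z ∈ homRow K 3 5 (r + 1),
    symMul (fun a => lead 3 (W a)) z = 0 →
      ∃ q ∈ homRow K 3 3 r, symMul (fun a => lead 1 (B a)) q = z := by
  have hWo : ∀ a, W a ∈ ordLE K 3 5 3 := fun a => (hW a).2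
  induction r with
  | zero =>
    intro z hz h
    have hz' := homRow_le_ordLE _ hz
    rw [zero_add] at hz hz'
    have h1 : rowMul der W z ∈ ordLE K 3 5 3 := by
      refine mem_ordLE_of_lead_eq_zero (r := 3) ?_ ?_
      · have := rowMul_mem_ordLE hder hWo hz'
        rwa [add_comm] at this
      · have := lead_rowMul hder hWo hz'
        rwa [lead_of_mem hz, h, add_comm] at this
    have h2 : rowMul der W z ∈ compat der S (0 + 3) :=
      ⟨LinearMap.mem_ker.2 (rowMul_rowMul_eq_zero hder
        (fun a => LinearMap.mem_ker.1 (hW a).1) z), h1⟩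
    rw [← weyl_generates hder hsymm hdet hS hω hev h10 hW hWspan 0] at h2
    obtain ⟨y, hy, e⟩ := h2
    obtain ⟨c, hc⟩ := hBspan (z - y)
      ⟨LinearMap.mem_ker.2 (by rw [map_sub, e, sub_self]),
        Submodule.sub_mem _ hz' (ordLE_mono (by omega) hy)⟩
    refine ⟨fun a => C (c a), const_mem_homRow c, ?_⟩
    have h3 := congrArg (lead 1) hc
    rw [map_sub, lead_eq_zero (by omega) hy, sub_zero, lead_of_mem hz] at h3
    rw [h3, symMul_const]
    simp only [map_sum, map_smul]
  | succ r ih =>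
    intro z hz h
    have hsw : ∀ q, symMul (fun a => lead 1 (S a)) (symMul (fun a => lead 3 (W a)) q) = 0 := by
      intro q
      rw [symMul_apply (fun a => lead 3 (W a)), map_sum]
      refine Finset.sum_eq_zero fun a _ => ?_
      rw [map_smul, symMul_lead_eq_zero hder hS (hW a), smul_zero]
    obtain ⟨y, hy, hy0, rfl⟩ := exists_second_syzygy_sum (d := r) (f := 2)
      (fun a => lead_mem 1 (S a)) (fun a => lead_mem 3 (W a))
      (fun v hv => symMul_surjective hsymm hdet (fun a => lead_mem 1 (S a)) hω (by omega) hv)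
      hsw (weyl_symbol_exact hder hsymm hdet hS hω hev h10 hWspan r) hz h
    choose q hq e using fun i => ih (y i) (hy i) (hy0 i)
    refine ⟨∑ i, (X i : MvPolynomial (Fin 3) K) • q i,
      Submodule.sum_mem _ fun i _ => X_smul_mem (hq i) i, ?_⟩
    simp only [map_sum, map_smul, e]

include hB hWind

theorem bianchi_generates : Generates der B 1 W :=
  generates_of_symbol (f := 0) hder (fun a => (hW a).2) hB (compat_zero_eq_bot hder hWind)
    (bianchi_symbol_exact hder hsymm hdet hS hω hev h10 hW hWspan hBspan)

/-- Each row has finite order, and on rows of order at most `r` source and image have the same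
dimension `3 C(r+3,3)`. -/
theorem bianchi_injective : Function.Injective (rowMul der B) := by
  rw [← LinearMap.ker_eq_bot, LinearMap.ker_eq_bot']
  intro Q hQ
  obtain ⟨r, hr⟩ : ∃ r, Q ∈ ordLE K 3 3 r := by
    refine ⟨Finset.univ.sup fun a => (Q a).totalDegree, mem_ordLE.2 fun a μ hμ => ?_⟩
    refine coeff_eq_zero_of_totalDegree_lt (lt_of_le_of_lt ?_ hμ)
    exact Finset.le_sup (f := fun a => (Q a).totalDegree) (Finset.mem_univ a)
  have h1 := finrank_map_add_finrank_ker_inf (rowMul der B) (ordLE K 3 3 r)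
  rw [bianchi_generates hder hsymm hdet hS hω hev h10 hW hWspan hB hBspan hWind r,
    finrank_compat_weyl hder hsymm hdet hS hω hev h10 hW hWspan, finrank_ordLE] at h1
  have : FiniteDimensional K ↥(LinearMap.ker (rowMul der B) ⊓ ordLE K 3 3 r) :=
    Submodule.finiteDimensional_inf_right _ _
  have h2 := Submodule.finrank_eq_zero.1
    (show Module.finrank K ↥(LinearMap.ker (rowMul der B) ⊓ ordLE K 3 3 r) = 0 by omega)
  have h3 : Q ∈ LinearMap.ker (rowMul der B) ⊓ ordLE K 3 3 r := ⟨hQ, hr⟩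
  rwa [h2, Submodule.mem_bot] at h3

end Sequence

end FormalPDE

/-! ### Assembly of the symbol statements and the operator sequence -/

theorem mainTheorem6 {K : Type*} [Field K] [CharZero K]
    (der : Fin 3 → Derivation ℤ K K)
    (hder : ∀ i j a, der i (der j a) = der j (der i a))
    (ω : Matrix (Fin 3) (Fin 3) K) (hsymm : ω.IsSymm) (hdet : ω.det ≠ 0) :
    -- the symbols `ĝ_q`
    (¬ FormalPDE.IsAcyclic 2 (FormalPDE.confSymbol ω 2) 2 ∧
      FormalPDE.confSymbol ω 3 = ⊥ ∧
      IsLeast {s : ℕ | FormalPDE.IsAcyclic (1 + s) (FormalPDE.confSymbol ω (1 + s)) 2} 2) ∧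
    -- `F̂_0`, and `0 → S_4 T* ⊗ T → S_3 T* ⊗ F̂_0 → F̂_1 → 0`,
    -- `0 → F̂_1 → ∧² T* ⊗ ĝ_2 → ∧³ T* ⊗ ĝ_1 → 0`
    (Module.finrank K (FormalPDE.FZero ω) = 5 ∧
      Function.Injective (FormalPDE.symPhi ω 3) ∧
      Module.finrank K (FormalPDE.FOne ω) = 5 ∧
      Nonempty (FormalPDE.FOne ω ≃ₗ[K]
        ↥(FormalPDE.forms 2 (FormalPDE.confSymbol ω 2) ⊓ LinearMap.ker (FormalPDE.delta K))) ∧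
      (FormalPDE.forms 2 (FormalPDE.confSymbol ω 2)).map (FormalPDE.delta K) =
        FormalPDE.forms 3 (FormalPDE.confSymbol ω 1)) ∧
    -- `ĥ_3`, and `0 → S_5 T* ⊗ T → S_4 T* ⊗ F̂_0 → T* ⊗ F̂_1 → F̂_2 → 0`, `F̂_2 ≃ ∧³ T* ⊗ ĝ_2`
    (FormalPDE.IsAcyclic 3 (FormalPDE.confImage ω 3) 2 ∧
      Function.Injective (FormalPDE.symPhi ω 4) ∧
      Function.Exact (FormalPDE.symPhi ω 4) (FormalPDE.symPsi ω) ∧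
      Module.finrank K (FormalPDE.FTwo ω) = 3 ∧
      Nonempty (FormalPDE.FTwo ω ≃ₗ[K] ↥(FormalPDE.forms 3 (FormalPDE.confSymbol ω 2)))) ∧
    -- the operators; the frames `φ`, `ψ`, `χ` of (the duals of) `F̂_0`, `F̂_1`, `F̂_2` are arbitrary
    ((∃ lam : K, lam ≠ 0 ∧ FormalPDE.IsConstCurvature der (lam • ω)) →
      Module.finrank K (FormalPDE.confEquations der ω) = 5 ∧
      ∀ φ : Module.Basis (Fin 5) K (FormalPDE.confEquations der ω),
      ∀ CKilling : Fin 5 → FormalPDE.Row K 3 3, (∀ a, CKilling a = φ a) →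
        FormalPDE.compat der CKilling 2 = ⊥ ∧
        Module.finrank K (FormalPDE.compat der CKilling 3) = 5 ∧
        Nonempty (Module.Dual K (FormalPDE.compat der CKilling 3) ≃ₗ[K] FormalPDE.FOne ω) ∧
        ∀ ψ : Module.Basis (Fin 5) K (FormalPDE.compat der CKilling 3),
        ∀ Weyl : Fin 5 → FormalPDE.Row K 3 5, (∀ a, Weyl a = ψ a) →
          FormalPDE.Generates der Weyl 3 CKilling ∧
          FormalPDE.compat der Weyl 0 = ⊥ ∧
          Module.finrank K (FormalPDE.compat der Weyl 1) = 3 ∧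
          Nonempty (Module.Dual K (FormalPDE.compat der Weyl 1) ≃ₗ[K] FormalPDE.FTwo ω) ∧
          ∀ χ : Module.Basis (Fin 3) K (FormalPDE.compat der Weyl 1),
          ∀ Bianchi : Fin 3 → FormalPDE.Row K 3 5, (∀ a, Bianchi a = χ a) →
            FormalPDE.Generates der Bianchi 1 Weyl ∧
            Function.Injective (FormalPDE.rowMul der Bianchi)) := by
  open FormalPDE in
  refine ⟨⟨not_isAcyclic hsymm hdet (by omega) le_rfl, confSymbol_eq_bot hsymm hdet le_rfl,
      isLeast_acyclic hsymm hdet⟩,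
    ⟨finrank_fZero hsymm hdet, symPhi_injective hsymm hdet (by omega), finrank_fOne hsymm hdet,
      ⟨LinearEquiv.ofFinrankEq _ _ ?_⟩, map_delta_forms_two hsymm hdet⟩,
    ⟨isAcyclic_confImage hsymm hdet, symPhi_injective hsymm hdet (by omega),
      exact_symPhi_symPsi hsymm hdet, finrank_fTwo hsymm hdet,
      ⟨LinearEquiv.ofFinrankEq _ _ ?_⟩⟩, ?_⟩
  -- The isomorphisms with spaces of Spencer forms are obtained from equality of dimensions.
  · rw [finrank_fOne hsymm hdet, finrank_cocycles hsymm hdet]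
  · rw [finrank_fTwo hsymm hdet, finrank_forms_three hsymm hdet]
  · rintro ⟨lam, hlam, hK⟩
    have hdet' : (lam • ω).det ≠ 0 := by
      rw [Matrix.det_smul]
      exact mul_ne_zero (pow_ne_zero _ hlam) hdet
    have hsymm' : (lam • ω).IsSymm := by
      rw [Matrix.IsSymm, Matrix.transpose_smul, hsymm.eq]
    -- The formal solution is built from the constant curvature metric; conformal invariance of the
    -- equations transfers it to `ω`.
    obtain ⟨ev, hev, h10⟩ := exists_solution_space hder hsymm' hdet' hK
    rw [confEquations_smul hsymm hdet hlam] at hev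
    refine ⟨finrank_confEquations hsymm hdet, fun φ S hφ => ?_⟩
    have hmem : ∀ a, S a ∈ confEquations der ω := fun a => hφ a ▸ (φ a).2
    have hS : ∀ a, S a ∈ ordLE K 3 3 1 := fun a => confEquations_le_ordLE hsymm hdet (hmem a)
    have hspan : ∀ {V : Type _} [AddCommGroup V] [Module K V] {p : ℕ} {E : Submodule K V}
        (b : Module.Basis (Fin p) K E) {T : Fin p → V}, (∀ a, T a = b a) →
        ∀ P ∈ E, ∃ c : Fin p → K, P = ∑ a, c a • T a := by
      intro V _ _ p E b T hT P hP
      refine ⟨fun a => b.repr ⟨P, hP⟩ a, ?_⟩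
      have := congrArg Subtype.val (b.sum_repr ⟨P, hP⟩)
      simp only [AddSubmonoidClass.coe_finsetSum, Submodule.coe_smul] at this
      simp only [hT, this]
    -- Any basis spans the conformal Killing equations, so their symbols lie in the module generated
    -- by the symbols of the basis; nothing else about the choice of basis is used.
    have hω : ∀ i j, confLead ω i j ∈ LinearMap.range (symMul fun a => lead 1 (S a)) := by
      intro i j
      obtain ⟨c, hc⟩ := hspan φ hφ (confKilling der ω i j)
        (Submodule.subset_span ⟨(i, j), rfl⟩)
      refine ⟨fun a => MvPolynomial.C (c a), ?_⟩
      rw [symMul_const, ← lead_confKilling (der := der) hsymm hdet, hc]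
      simp only [map_sum, map_smul]
    have hevS := hev S hmem
    have hc3 := finrank_compat_three hder hsymm hdet hS hω hevS h10
    refine ⟨compat_two_eq_bot hder hsymm hdet hS hω, hc3, ?_, fun ψ W hψ => ?_⟩
    · have : FiniteDimensional K (compat der S 3) := Module.finite_of_finrank_pos (by omega)
      exact ⟨LinearEquiv.ofFinrankEq _ _ (by
        rw [Subspace.dual_finrank_eq, hc3, finrank_fOne hsymm hdet])⟩
    have hW : ∀ a, W a ∈ compat der S 3 := fun a => hψ a ▸ (ψ a).2
    have hWspan := hspan ψ hψ
    have hWind : LinearIndependent K W := by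
      rw [show W = Submodule.subtype (compat der S 3) ∘ ψ from funext hψ]
      exact ψ.linearIndependent.map' (Submodule.subtype _) (Submodule.ker_subtype _)
    have hc1 : Module.finrank K (compat der W 1) = 3 :=
      finrank_compat_weyl hder hsymm hdet hS hω hevS h10 hW hWspan 0
    refine ⟨weyl_generates hder hsymm hdet hS hω hevS h10 hW hWspan,
      compat_zero_eq_bot hder hWind, hc1, ?_, fun χ B hχ => ?_⟩
    · have : FiniteDimensional K (compat der W 1) := Module.finite_of_finrank_pos (by omega)
      exact ⟨LinearEquiv.ofFinrankEq _ _ (by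
        rw [Subspace.dual_finrank_eq, hc1, finrank_fTwo hsymm hdet])⟩
    have hB : ∀ a, B a ∈ compat der W 1 := fun a => hχ a ▸ (χ a).2
    have hBspan := hspan χ hχ
    exact ⟨bianchi_generates hder hsymm hdet hS hω hevS h10 hW hWspan hB hBspan hWind,
      bianchi_injective hder hsymm hdet hS hω hevS h10 hW hWspan hB hBspan hWind⟩
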